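/- **Setting.** Let $(X,d)$ be a finite metric space, $N=|X|$, $1\le k<N$. For a function $d':X\times X\to\mathbb{R}_{\ge 0}$, the $k$-median cost of a partition $P_1,\dots,P_k$ of $X$ with centers $p_1,\dots,p_k\in X$ is $\sum_i\sum_{p\in P_i}d'(p,p_i)$. Let $\mathcal C=\{C_1,\dots,C_k\}$ with centers $\mathbf c=\{c_1,\dots,c_k\}$ be an optimal clustering under $d$, and let $\mathcal{OPT}$ be its cost. $(X,d)$ is *$(\alpha,\epsilon)$-perturbation resilient* if for every $d'$ with $d(p,q)\le d'(p,q)\le\alpha d(p,q)$ for all $p,q$, every optimal clustering $\mathcal C'$ under $d'$ satisfies $\min_{\sigma\in S_k}\sum_i|C_i\setminus C'_{\sigma(i)}|\le\epsilon N$. Put $\rho=\min_i|C_i|/N$, $D=\max_{p,q}d(p,q)$, $\zeta=\mathcal{OPT}/N$. **Algorithm 2.** Input: a list $S$ of $n$ items, distances $d$ on $S$, the number $k$, a minimum cluster size $\mu$, and a parameter $\epsilon'>0$. *Phase 1.* Start with the clustering of $S$ into singletons. Process the pairs $(p,q)$ in ascending order of $d(p,q)$. Let $\mathbb B=\{x\in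 S: d(x,p)\le d(p,q)\}$ and let $U$ be the set of current clusters that meet $\mathbb B$ and have at most $\epsilon' n$ points outside $\mathbb B$. Merge the clusters in $U$ into one if $|U|>1$ and the following hold: $|\bigcup U|\ge\mu-\epsilon' n$; $|\bigcup U\setminus\mathbb B|\le\epsilon' n$; and there is $E\subseteq S\setminus\mathbb B$ with $|E|\le\epsilon' n$ such that $d(p_1,p_2)<d(p_1,q_1)$ for all $p_1,p_2\in\mathbb B$ and $q_1\in S\setminus(\mathbb B\cup E)$. The merges define a tree $T$ with the single items as leaves. *Phase 2.* Turn every node all of whose children are single items into a leaf (delete its children). Then move every remaining single item to the non-singleton leaf of smallest median distance to it. *Phase 3.* By dynamic programming on the resulting tree (nodes with more than two children being replaced by chains of binary merges) find the minimum $k$-median cost pruning with $k$ clusters, where a leaf may also be used as one cluster when more are allowed. Output it with its centers, which are chosen in $S$. **Theorem.** There is an absolute constant $a>0$, and for every constant $A$ there is a constant $M$ depending only on $A$, such that the following holds. Let $(X,d)$ be $(\alpha,\epsilon)$-perturbation resilient for $k$-median with $\alpha>8$ and $0<\epsilon<\rho/20$. Let $0<\lambda<1$, $0<\delta<1$, and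 let $$Q=\frac{kD^2}{\lambda^2\epsilon^2\zeta^2}\ln\frac N\delta .$$ Let $S$ consist of $n$ independent uniformly random points of $X$ (treated as $n$ items, with repetitions), where $aQ\le n\le AQ$. Then: 1. With probability at least $1-\delta$ we have $\tfrac{\rho n}2\le\min_i|C_i\cap S|$ (counted with multiplicity), and for every value $\mu\in[\tfrac{\rho n}2,\ \min_i|C_i\cap S|]$ of the minimum cluster size, Algorithm 2 run on $S$ with this $\mu$ and $\epsilon'=2\epsilon$ outputs at least one and at most $k$ centers $\tilde{\mathbf c}$ such that the implicit clustering of $X$ that assigns each point to its nearest center in $\tilde{\mathbf c}$ satisfies $$\sum_{x\in X}\min_{\tilde c\in\tilde{\mathbf c}}d(x,\tilde c)\ \le\ 2\,\frac{1+\lambda}{1-\lambda}\Bigl(1+\frac{8\epsilon}{\rho-12\epsilon}\Bigr)\mathcal{OPT}.$$ 2. For every sample $S$ and every $\mu$, computing $\tilde{\mathbf c}$ takes at most $MQ^5$ elementary steps (distance queries, arithmetic operations and comparisons, list and tree operations). -/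

import Mathlib

open MeasureTheory

/-! ### The k-median objective and perturbation resilience -/

namespace KMedian

section Objective

variable {X : Type*} [Fintype X] {k : ℕ}

/-- The `k`-median cost of the clustering `C_i = {x | f x = i}` with centers `c i`
with respect to a function `d` (which need not be a metric). -/
def cost (d : X → X → ℝ) (f : X → Fin k) (c : Fin k → X) : ℝ :=
  ∑ x, d x (c (f x))

/-- `(f, c)` is an optimal `k`-median clustering with respect to `d`.  Empty clusters and repeated
centers are allowed among the competitors; for `k < |X|` they are never optimal when
`d x y > 0 = d x x` for all `x ≠ y`, so this is the usual optimum over partitions into `k` parts. -/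
def IsOptimal (d : X → X → ℝ) (f : X → Fin k) (c : Fin k → X) : Prop :=
  ∀ (f' : X → Fin k) (c' : Fin k → X), cost d f c ≤ cost d f' c'

/-- The number of points in cluster `i`. -/
noncomputable def clusterSize {Y : Type*} (f : Y → Fin k) (i : Fin k) : ℕ :=
  Nat.card {y : Y // f y = i}

/-- `f'` is `ε`-close to `f`: for some matching `σ` of the indices,
`∑ i, |C_i \ C'_{σ i}| ≤ ε |X|`. -/
def EpsClose (ε : ℝ) (f f' : X → Fin k) : Prop :=
  ∃ σ : Equiv.Perm (Fin k),
    ∑ i, (Nat.card {x : X // f x = i ∧ f' x ≠ σ i} : ℝ) ≤ ε * Fintype.card X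

/-- `(α, ε)`-perturbation resilience of the finite metric space `X` for `k`-median, where `f` is
the optimal clustering for the metric: the optimal clustering for any `d'` with
`dist ≤ d' ≤ α dist` (symmetry and the triangle inequality are not required of `d'`) is
`ε`-close to `f`. -/
def PerturbationResilient [MetricSpace X] (α ε : ℝ) (f : X → Fin k) : Prop :=
  ∀ d' : X → X → ℝ, (∀ p q, dist p q ≤ d' p q ∧ d' p q ≤ α * dist p q) →
    ∀ (f' : X → Fin k) (c' : Fin k → X), IsOptimal d' f' c' → EpsClose ε f f'

/-- `ρ`, the fraction of the points that lie in the smallest cluster. -/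
noncomputable def minFraction (f : X → Fin k) : ℝ :=
  (⨅ i : Fin k, (clusterSize f i : ℝ)) / Fintype.card X

/-- `ζ`, the average cost of a point in the clustering `(f, c)`. -/
noncomputable def avgCost [MetricSpace X] (f : X → Fin k) (c : Fin k → X) : ℝ :=
  cost dist f c / Fintype.card X

/-- The cost of the implicit clustering given by a nonempty list `l` of centers: every
point of `X` is assigned to its nearest center in `l`. -/
noncomputable def implicitCost [MetricSpace X] (l : List X) : ℝ :=
  ∑ x, Metric.infDist x {y | y ∈ l}

/-- The quantity `k D² / (λ² ε² ζ²) · ln (N / δ)`, where `D` is the diameter of `X`, `N = |X|` and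
`ζ` is the average cost of `(f, c)`. -/
noncomputable def sampleScale [MetricSpace X] (f : X → Fin k) (c : Fin k → X)
    (lam ε δ : ℝ) : ℝ :=
  k * Metric.diam (Set.univ : Set X) ^ 2 / (lam ^ 2 * ε ^ 2 * avgCost f c ^ 2) *
    Real.log (Fintype.card X / δ)

/-- The law of `n` independent uniformly distributed points of `X`. -/
noncomputable def sampleLaw (X : Type*) [Fintype X] [Nonempty X] [MeasurableSpace X] (n : ℕ) :
    Measure (Fin n → X) :=
  Measure.pi fun _ => (PMF.uniformOfFintype X).toMeasure

end Objective

/-! ### Step counting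

A computation returns its value together with the number of elementary steps it took.  In the
programs below a step is one of: a distance query, an arithmetic operation or comparison of two
numbers, a comparison of two points, or the inspection or creation of a list or tree cell.  Every
traversal of a list or a tree is done by one of the programs here and pays for each cell. -/

/-- A value with the number of steps used to compute it. -/
structure Timed (α : Type) where
  val : α
  steps : ℕ

namespace Timed

instance : Monad Timed where
  pure a := ⟨a, 0⟩
  bind x g := ⟨(g x.val).val, x.steps + (g x.val).steps⟩

/-- One elementary step with result `a`. -/
def step {α : Type} (a : α) : Timed α := ⟨a, 1⟩

open Classical in
/-- Comparison `a ≤ b`. -/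
noncomputable def le (a b : ℝ) : Timed Bool := step (decide (a ≤ b))

open Classical in
/-- Comparison `a < b`. -/
noncomputable def lt (a b : ℝ) : Timed Bool := step (decide (a < b))

def mapT {α β : Type} (g : α → Timed β) : List α → Timed (List β)
  | [] => step []
  | a :: l => do
    let b ← g a
    let bs ← mapT g l
    step (b :: bs)

def foldlT {α β : Type} (g : β → α → Timed β) (b : β) : List α → Timed β
  | [] => step b
  | a :: l => do
    let b' ← g b a
    let r ← foldlT g b' l
    step r

def filterT {α : Type} (g : α → Timed Bool) : List α → Timed (List α)
  | [] => step []
  | a :: l => do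
    let t ← g a
    let r ← filterT g l
    step (if t then a :: r else r)

def countT {α : Type} (g : α → Timed Bool) : List α → Timed ℕ
  | [] => step 0
  | a :: l => do
    let t ← g a
    let m ← countT g l
    step (if t then m + 1 else m)

def existsT {α : Type} (g : α → Timed Bool) : List α → Timed Bool
  | [] => step false
  | a :: l => do
    let t ← g a
    let s ← existsT g l
    step (t || s)

def sumT {α : Type} (g : α → Timed ℝ) : List α → Timed ℝ
  | [] => step 0
  | a :: l => do
    let x ← g a
    let y ← sumT g l
    step (x + y)

def lengthT {α : Type} : List α → Timed ℕ
  | [] => step 0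
  | _ :: l => do
    let m ← lengthT l
    step (m + 1)

def appendT {α : Type} : List α → List α → Timed (List α)
  | [], l' => step l'
  | a :: l, l' => do
    let r ← appendT l l'
    step (a :: r)

def takeT {α : Type} : ℕ → List α → Timed (List α)
  | 0, _ => step []
  | _ + 1, [] => step []
  | m + 1, a :: l => do
    let r ← takeT m l
    step (a :: r)

def replicateT {α : Type} (a : α) : ℕ → Timed (List α)
  | 0 => step []
  | m + 1 => do
    let r ← replicateT a m
    step (a :: r)

/-- The entry with index `i`, or `x` if there is none. -/
def getT {α : Type} (x : α) : List α → ℕ → Timed α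
  | [], _ => step x
  | a :: _, 0 => step a
  | _ :: l, i + 1 => do
    let b ← getT x l i
    step b

/-- The last entry, or `x` if the list is empty. -/
def lastT {α : Type} (x : α) : List α → Timed α
  | [] => step x
  | a :: l => do
    let b ← lastT a l
    step b

/-- All ordered pairs with first entry from the first list and second entry from the second. -/
def pairsT {α β : Type} : List α → List β → Timed (List (α × β))
  | [], _ => step []
  | a :: l, l' => do
    let row ← mapT (fun b => step (a, b)) l'
    let rest ← pairsT l l'
    appendT row rest

noncomputable def insertT {α : Type} (a : ℝ × α) : List (ℝ × α) → Timed (List (ℝ × α))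
  | [] => step [a]
  | b :: l => do
    let t ← le a.1 b.1
    if t then step (a :: b :: l)
    else do
      let r ← insertT a l
      step (b :: r)

/-- Insertion sort in ascending order of the first components. -/
noncomputable def sortT {α : Type} : List (ℝ × α) → Timed (List (ℝ × α))
  | [] => step []
  | a :: l => do
    let r ← sortT l
    insertT a r

/-- An entry of `a :: l` with the smallest first component. -/
noncomputable def argminT {α : Type} : ℝ × α → List (ℝ × α) → Timed (ℝ × α)
  | a, [] => step a
  | a, b :: l => do
    let t ← lt b.1 a.1
    let r ← argminT (if t then b else a) l
    step r

end Timed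

open Timed

/-! ### Trees of clusters -/

/-- An ordered list of rooted trees in which the leaves carry lists of points.
`leaf pts F` is the list whose first tree is a leaf and whose other trees are those of `F`;
`node ch F` is the list whose first tree is an internal node with children `ch` and whose other
trees are those of `F`. -/
inductive Forest (P : Type) where
  | nil : Forest P
  | leaf (pts : List P) (siblings : Forest P) : Forest P
  | node (children : Forest P) (siblings : Forest P) : Forest P

/-- Trees in which every internal node has two children. -/
inductive BinTree (P : Type) where
  | leaf (pts : List P) : BinTree P
  | node (left right : BinTree P) : BinTree P

/-- A cluster of the current clustering: its points and the children of the corresponding tree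
node (none if the cluster is one of the initial singletons). -/
structure Cluster (P : Type) where
  pts : List P
  children : Forest P

/-! ### Phase 1: approximate closure linkage -/

/-- Is `x` in the ball `{x | d x p ≤ r}`? -/
noncomputable def inBall {P : Type} (d : P → P → ℝ) (p : P) (r : ℝ) (x : P) : Timed Bool := do
  let s ← step (d x p)
  le s r

noncomputable def outBall {P : Type} (d : P → P → ℝ) (p : P) (r : ℝ) (x : P) : Timed Bool := do
  let t ← inBall d p r x
  step (!t)

/-- Does the cluster belong to `U_{p,q}`, where `r = d p q` and `b = ε n`: at most `b` of its
points are outside the ball around `p` of radius `r` and at least one is inside? -/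
noncomputable def nearlyInside {P : Type} (d : P → P → ℝ) (p : P) (r b : ℝ) (C : Cluster P) :
    Timed Bool := do
  let o ← countT (outBall d p r) C.pts
  let i ← countT (inBall d p r) C.pts
  let t ← le (o : ℝ) b
  let s ← lt 0 (i : ℝ)
  step (t && s)

def unionT {P : Type} : List (Cluster P) → Timed (List P)
  | [] => step []
  | C :: l => do
    let r ← unionT l
    appendT C.pts r

/-- The trees of the given clusters. -/
def treesT {P : Type} : List (Cluster P) → Timed (Forest P)
  | [] => step .nil
  | C :: l => do
    let F ← treesT l
    match C.children with
    | .nil => step (.leaf C.pts F)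
    | .leaf pts G => step (.node (.leaf pts G) F)
    | .node ch G => step (.node (.node ch G) F)

/-- The number of points `q₁` outside the ball that must be removed for the margin condition: those
for which `d p₁ p₂ < d p₁ q₁` fails for some `p₁, p₂` in the ball. -/
noncomputable def marginViolations {P : Type} (d : P → P → ℝ) (ball out : List P) : Timed ℕ :=
  countT (fun q₁ => existsT (fun p₁ => existsT (fun p₂ => do
    let x ← step (d p₁ p₂)
    let y ← step (d p₁ q₁)
    le y x) ball) ball) out

/-- Processing of one pair `(p, q)`: if the ball around `p` of radius `d p q` satisfies the
approximate closure condition with respect to the current clustering `cl` and `|U_{p,q}| > 1`, then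
the clusters in `U_{p,q}` are merged.  Here `μ` is the given minimum cluster size
and `b = ε n`. -/
noncomputable def linkageStep {P : Type} (S : List P) (d : P → P → ℝ) (μ b : ℝ)
    (cl : List (Cluster P)) (pq : ℝ × P × P) : Timed (List (Cluster P)) := do
  let p := pq.2.1
  let r := pq.1
  let ball ← filterT (inBall d p r) S
  let out ← filterT (outBall d p r) S
  let U ← filterT (nearlyInside d p r b) cl
  let rest ← filterT (fun C => do
    let t ← nearlyInside d p r b C
    step (!t)) cl
  let pts ← unionT U
  let size ← lengthT pts
  let uncovered ← countT (outBall d p r) pts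
  let violations ← marginViolations d ball out
  let number ← lengthT U
  let threshold ← step (μ - b)
  let t₀ ← le threshold (size : ℝ)
  let t₁ ← le (uncovered : ℝ) b
  let t₂ ← le (violations : ℝ) b
  let t₃ ← step (decide (1 < number))
  if t₀ && t₁ && t₂ && t₃ then do
    let ch ← treesT U
    step (⟨pts, ch⟩ :: rest)
  else step cl

/-- Phase 1: all `d p q` are sorted and processed in ascending order, starting from the clustering
into singletons.  The result is the tree `T`. -/
noncomputable def linkagePhase {P : Type} (S : List P) (d : P → P → ℝ) (μ b : ℝ) :
    Timed (Forest P) := do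
  let pairs ← pairsT S S
  let keyed ← mapT (fun pq => step (d pq.1 pq.2, pq)) pairs
  let sorted ← sortT keyed
  let singletons ← mapT (fun p => step (Cluster.mk [p] .nil)) S
  let cl ← foldlT (linkageStep S d μ b) singletons sorted
  treesT cl

/-! ### Phase 2: cleaning -/

/-- If all trees in the list are leaves, the list of all their points. -/
def onlyLeaves {P : Type} : Forest P → Timed (Option (List P))
  | .nil => step (some [])
  | .leaf pts F => do
    let r ← onlyLeaves F
    match r with
    | none => step none
    | some l => do
      let l' ← appendT pts l
      step (some l')
  | .node _ _ => step none

/-- `T'`: the children of a node that has only single points as children are deleted, so that the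
node becomes a leaf that consists of these points. -/
def collapse {P : Type} : Forest P → Timed (Forest P)
  | .nil => step .nil
  | .leaf pts F => do
    let F' ← collapse F
    step (.leaf pts F')
  | .node ch F => do
    let F' ← collapse F
    let r ← onlyLeaves ch
    match r with
    | some l => step (.leaf l F')
    | none => do
      let ch' ← collapse ch
      step (.node ch' F')

def leavesT {P : Type} : Forest P → Timed (List (List P))
  | .nil => step []
  | .leaf pts F => do
    let r ← leavesT F
    step (pts :: r)
  | .node ch F => do
    let r ← leavesT ch
    let s ← leavesT F
    appendT r s

/-- A median of the distances from `p` to the points in `L`. -/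
noncomputable def medianDist {P : Type} (d : P → P → ℝ) (p : P) (L : List P) : Timed ℝ := do
  let ds ← mapT (fun q => step (d p q, ())) L
  let sorted ← sortT ds
  let m ← lengthT sorted
  let h ← step (m / 2)
  let r ← getT (0, ()) sorted h
  step r.1

/-- The singleton `p` together with the first point of the leaf, among the given
ones, of smallest median distance to `p`.  (Leaves are disjoint, so that point identifies
the leaf.) -/
noncomputable def assignT {P : Type} (d : P → P → ℝ) (leaves : List (List P)) (p : P) :
    Timed (P × P) := do
  let keyed ← mapT (fun L => do
    let m ← medianDist d p L
    step (m, L)) leaves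
  match keyed with
  | [] => step (p, p)
  | a :: l => do
    let best ← argminT a l
    match best.2 with
    | [] => step (p, p)
    | h :: _ => step (p, h)

/-- The singleton leaves are removed, and every other leaf receives the points assigned to it. -/
def reassign {P : Type} [DecidableEq P] (asg : List (P × P)) : Forest P → Timed (Forest P)
  | .nil => step .nil
  | .leaf pts F => do
    let F' ← reassign asg F
    match pts with
    | h :: x :: l => do
      let mine ← filterT (fun a => step (decide (a.2 = h))) asg
      let extra ← mapT (fun a => step a.1) mine
      let pts' ← appendT (h :: x :: l) extra
      step (.leaf pts' F')
    | _ => step F'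
  | .node ch F => do
    let F' ← reassign asg F
    let ch' ← reassign asg ch
    step (.node ch' F')

/-- Phase 2: from the tree `T` to the cleaned tree. -/
noncomputable def cleaningPhase {P : Type} [DecidableEq P] (d : P → P → ℝ) (T : Forest P) :
    Timed (Forest P) := do
  let T' ← collapse T
  let leaves ← leavesT T'
  let large ← filterT (fun L => do
    let m ← lengthT L
    step (decide (1 < m))) leaves
  let small ← filterT (fun L => do
    let m ← lengthT L
    step (decide (m = 1))) leaves
  let singles ← foldlT (fun acc L => appendT L acc) [] small
  let asg ← mapT (assignT d large) singles
  reassign asg T'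

/-! ### Phase 3: dynamic programming -/

/-- A clustering of a set of points as a list of centers with their clusters, preceded by its
cost. -/
abbrev Solution (P : Type) : Type := ℝ × List (P × List P)

/-- The trees in the list are joined to one binary tree: a node with more than two children
is replaced by a chain of binary merges of its children. -/
def binarize {P : Type} : Forest P → Timed (Option (BinTree P))
  | .nil => step none
  | .leaf pts F => do
    let r ← binarize F
    match r with
    | none => step (some (.leaf pts))
    | some t => step (some (.node (.leaf pts) t))
  | .node ch F => do
    let s ← binarize ch
    let r ← binarize F
    match s, r with
    | none, _ => step r
    | some _, none => step s
    | some t', some t => step (some (.node t' t))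

/-- The best solution with the single cluster `pts` and a center in `S`. -/
noncomputable def oneCluster {P : Type} (S : List P) (d : P → P → ℝ) (pts : List P) :
    Timed (Solution P) := do
  let candidates ← mapT (fun x => do
    let s ← sumT (fun y => step (d y x)) pts
    step (s, [(x, pts)])) S
  match candidates with
  | [] => step (0, [])
  | a :: l => argminT a l

/-- The unions of corresponding solutions in the two lists, up to the length of the shorter one. -/
def combineT {P : Type} : List (Solution P) → List (Solution P) → Timed (List (Solution P))
  | a :: l, b :: l' => do
    let cs ← appendT a.2 b.2
    let r ← combineT l l'
    step ((a.1 + b.1, cs) :: r)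
  | _, _ => step []

/-- Let `L` list solutions with `1, 2, …, k` clusters, and let `R` list those with
`j + 1, j + 2, …` clusters of another part, where `rev` lists those with `j, j - 1, …, 1` clusters.
The result lists the best unions with `j + 2, j + 3, …` clusters, each the best one over
all ways to split the number of clusters into two positive parts. -/
noncomputable def splitsT {P : Type} (one : Solution P) (L : List (Solution P)) :
    List (Solution P) → List (Solution P) → Timed (List (Solution P))
  | _, [] => step []
  | rev, b :: R => do
    let candidates ← combineT L (b :: rev)
    let best ← (match candidates with
      | [] => step one
      | a :: l => argminT a l)
    let rest ← splitsT one L (b :: rev) R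
    step (best :: rest)

/-- For every tree node the list of its points and the table of best solutions with
`m = 1, …, k` clusters.  A leaf admits only the solution with one cluster, which
is used for every `m`. -/
noncomputable def tableT {P : Type} (S : List P) (d : P → P → ℝ) (k : ℕ) :
    BinTree P → Timed (List P × List (Solution P))
  | .leaf pts => do
    let one ← oneCluster S d pts
    let tab ← replicateT one k
    step (pts, tab)
  | .node t t' => do
    let r ← tableT S d k t
    let r' ← tableT S d k t'
    let pts ← appendT r.1 r'.1
    let one ← oneCluster S d pts
    let more ← splitsT one r.2 [] r'.2
    let tab ← takeT k (one :: more)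
    step (pts, tab)

/-- Phase 3: the minimum cost pruning with `k` clusters, with its centers. -/
noncomputable def pruningPhase {P : Type} (S : List P) (d : P → P → ℝ) (k : ℕ) (T : Forest P) :
    Timed (List (P × List P)) := do
  let t ← binarize T
  match t with
  | none => step []
  | some t => do
    let r ← tableT S d k t
    let best ← lastT (0, []) r.2
    step best.2

/-! ### The algorithms -/

/-- The approximate closure linkage algorithm for `k`-median on the data set `S` with distance `d`,
minimum cluster size `μ` and parameter `ε`.  The output is a list of
centers with their clusters. -/
noncomputable def closureAlgorithm {P : Type} [DecidableEq P] (S : List P) (d : P → P → ℝ)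
    (k : ℕ) (μ ε : ℝ) : Timed (List (P × List P)) := do
  let n ← lengthT S
  let b ← step (ε * n)
  let T ← linkagePhase S d μ b
  let T' ← cleaningPhase d T
  pruningPhase S d k T'

/-- The sublinear algorithm: it draws the sample `ω`, whose members are treated as `n` different
items (possibly at distance zero), runs the algorithm above on it, and outputs the centers. -/
noncomputable def sampleAlgorithm {n : ℕ} (d : Fin n → Fin n → ℝ) (k : ℕ) (μ ε : ℝ) :
    Timed (List (Fin n)) := do
  let S ← mapT step (List.finRange n)
  let r ← closureAlgorithm S d k μ ε
  mapT (fun a => step a.1) r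

end KMedian

open KMedian

/-! The argument joins a geometric fact about `X`, concentration for the sample, and a deterministic
analysis of the algorithm on a representative sample.

Geometry (`card_bad_le`). For centers `c'`, call a point bad if some foreign center is at most 8
times as far away as its own. Suppose more than `ε * N` points are bad, and choose `M + 1` of them
with `M = ⌊ε * N⌋`. Multiply all distances by 8, except that each point keeps the true distance to
one center: its own, or the competing one if it was chosen. Resilience lets an optimum of the new
distance differ from `f` in at most `M` points, and the clusters are large, so its centers can be
replaced by `c'` at no cost (`sum_swap_nonpos_of_card`, `cost_replace_le`). Sending every chosen
point away from its own center then costs nothing either, and yields an optimum that differs from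
`f` in `M + 1` points, a contradiction. The centers `c'` need not be optimal: if `ε * N ≥ 1`, any
points of the innermost hundredth of the clusters will do. This matters because the sample may miss
the true centers.

Sampling (`one_sub_le_measureReal`). Hoeffding's inequality and a union bound over all `N ^ k`
tuples of centers control cluster sizes, numbers of bad items and average costs. Uniformity over
tuples is needed because both the central items and the output depend on the sample.

Linkage. In a good sample all but `b = 2 * ε * n` items are separated (`Separated`), while every
cluster has more than `5 * b` items. Let `q i` be the good item of cluster `i` farthest from `p i`.
Up to radius `d (p i) (q i)` a ball that meets the good part of cluster `i` contains no good item of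
another cluster, so merges stay inside targets. The pair `(p i, q i)` passes every test and unites
the good part of cluster `i`; later merges act on whole good parts (`LinkageInv`, `IsUpper`).

Cleaning. Non-singleton leaves carry good items of one target only. By the margin condition for
items already in such a leaf, and by the median rule for reassigned ones, a misplaced item is bad
and is closer to many good items of its new cluster than to many of its old one. Averaging shows
that it costs at most `2 * W / (μ - 3 * b)` extra, with `W` the sample cost of `f` and `c`
(`isPlaced_of_sets`). There are at most `b` misplaced items. Restricting centers to the sample costs
a factor 2, and dynamic programming does at least as well as this pruning.

Concentration moves the bound back to `X`, giving `(1 + λ) / (1 - λ)`. The running time is dominated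
by `n ^ 2` pairs with a margin test of order `n ^ 3` each. -/

namespace KMedian

/-! ### Values and step counts of the basic list programs. -/

namespace Timed

variable {α β : Type}

@[simp] theorem val_bind (x : Timed α) (g : α → Timed β) : (x >>= g).val = (g x.val).val := rfl
@[simp] theorem steps_bind (x : Timed α) (g : α → Timed β) :
    (x >>= g).steps = x.steps + (g x.val).steps := rfl
@[simp] theorem val_step (a : α) : (step a).val = a := rfl
@[simp] theorem steps_step (a : α) : (step a).steps = 1 := rfl

@[simp] theorem val_le (a b : ℝ) : (le a b).val = true ↔ a ≤ b := by
  simp [le]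
@[simp] theorem steps_le (a b : ℝ) : (le a b).steps = 1 := rfl
@[simp] theorem val_lt (a b : ℝ) : (lt a b).val = true ↔ a < b := by
  simp [lt]
@[simp] theorem steps_lt (a b : ℝ) : (lt a b).steps = 1 := rfl

@[simp] theorem val_mapT (g : α → Timed β) (l : List α) :
    (mapT g l).val = l.map fun a => (g a).val := by
  induction l <;> simp_all [mapT]

theorem steps_mapT (g : α → Timed β) (l : List α) :
    (mapT g l).steps = (l.map fun a => (g a).steps).sum + l.length + 1 := by
  induction l with
  | nil => simp [mapT]
  | cons a l ih => simp [mapT, ih]; ring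

@[simp] theorem val_foldlT (g : β → α → Timed β) (b : β) (l : List α) :
    (foldlT g b l).val = l.foldl (fun b a => (g b a).val) b := by
  induction l generalizing b <;> simp_all [foldlT]

@[simp] theorem val_filterT (g : α → Timed Bool) (l : List α) :
    (filterT g l).val = l.filter fun a => (g a).val := by
  induction l with
  | nil => simp [filterT]
  | cons a l ih => simp [filterT, ih, List.filter_cons]

theorem steps_filterT (g : α → Timed Bool) (l : List α) :
    (filterT g l).steps = (l.map fun a => (g a).steps).sum + l.length + 1 := by
  induction l with
  | nil => simp [filterT]
  | cons a l ih => simp [filterT, ih]; ring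

@[simp] theorem val_countT (g : α → Timed Bool) (l : List α) :
    (countT g l).val = l.countP fun a => (g a).val := by
  induction l with
  | nil => simp [countT]
  | cons a l ih => simp [countT, ih, List.countP_cons]; split <;> simp

theorem steps_countT (g : α → Timed Bool) (l : List α) :
    (countT g l).steps = (l.map fun a => (g a).steps).sum + l.length + 1 := by
  induction l with
  | nil => simp [countT]
  | cons a l ih => simp [countT, ih]; ring

@[simp] theorem val_existsT (g : α → Timed Bool) (l : List α) :
    (existsT g l).val = true ↔ ∃ a ∈ l, (g a).val = true := by
  induction l <;> simp_all [existsT]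

theorem steps_existsT (g : α → Timed Bool) (l : List α) :
    (existsT g l).steps = (l.map fun a => (g a).steps).sum + l.length + 1 := by
  induction l with
  | nil => simp [existsT]
  | cons a l ih => simp [existsT, ih]; ring

@[simp] theorem val_sumT (g : α → Timed ℝ) (l : List α) :
    (sumT g l).val = (l.map fun a => (g a).val).sum := by
  induction l <;> simp_all [sumT]

theorem steps_sumT (g : α → Timed ℝ) (l : List α) :
    (sumT g l).steps = (l.map fun a => (g a).steps).sum + l.length + 1 := by
  induction l with
  | nil => simp [sumT]
  | cons a l ih => simp [sumT, ih]; ring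

@[simp] theorem val_lengthT (l : List α) : (lengthT l).val = l.length := by
  induction l <;> simp_all [lengthT]

@[simp] theorem steps_lengthT (l : List α) : (lengthT l).steps = l.length + 1 := by
  induction l <;> simp_all [lengthT]

@[simp] theorem val_appendT (l l' : List α) : (appendT l l').val = l ++ l' := by
  induction l <;> simp_all [appendT]

@[simp] theorem steps_appendT (l l' : List α) : (appendT l l').steps = l.length + 1 := by
  induction l <;> simp_all [appendT]

@[simp] theorem val_takeT (m : ℕ) (l : List α) : (takeT m l).val = l.take m := by
  induction l generalizing m <;> cases m <;> simp_all [takeT]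

theorem steps_takeT (m : ℕ) (l : List α) : (takeT m l).steps ≤ m + 1 := by
  induction l generalizing m with
  | nil => cases m <;> simp [takeT]
  | cons a l ih =>
    cases m with
    | zero => simp [takeT]
    | succ m => simpa [takeT] using ih m

@[simp] theorem val_replicateT (a : α) (m : ℕ) : (replicateT a m).val = List.replicate m a := by
  induction m <;> simp_all [replicateT, List.replicate_succ]

@[simp] theorem steps_replicateT (a : α) (m : ℕ) : (replicateT a m).steps = m + 1 := by
  induction m <;> simp_all [replicateT]

@[simp] theorem val_getT (x : α) (l : List α) (i : ℕ) : (getT x l i).val = l.getD i x := by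
  induction l generalizing i <;> cases i <;> simp_all [getT]

theorem steps_getT (x : α) (l : List α) (i : ℕ) : (getT x l i).steps ≤ l.length + 1 := by
  induction l generalizing i with
  | nil => simp [getT]
  | cons a l ih =>
    cases i with
    | zero => simp [getT]
    | succ i => simpa [getT] using ih i

@[simp] theorem val_lastT (x : α) (l : List α) : (lastT x l).val = l.getLastD x := by
  induction l generalizing x with
  | nil => simp [lastT]
  | cons a l ih => rw [List.getLastD_cons, ← ih]; rfl

@[simp] theorem steps_lastT (x : α) (l : List α) : (lastT x l).steps = l.length + 1 := by
  induction l generalizing x <;> simp_all [lastT]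

theorem val_pairsT (l : List α) (l' : List β) : (pairsT l l').val = l ×ˢ l' := by
  induction l with
  | nil => simp [pairsT]
  | cons a l ih => simp [pairsT, ih, List.product_cons]

theorem steps_pairsT (l : List α) (l' : List β) :
    (pairsT l l').steps = l.length * (3 * l'.length + 2) + 1 := by
  induction l with
  | nil => simp [pairsT]
  | cons a l ih => simp [pairsT, ih, steps_mapT]; ring

theorem val_insertT (a : ℝ × α) (l : List (ℝ × α)) :
    (insertT a l).val.Perm (a :: l) := by
  induction l with
  | nil => simp [insertT]
  | cons b l ih =>
    simp only [insertT, val_bind]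
    split
    · simp
    · simp only [val_bind, val_step]
      exact (ih.cons b).trans (List.Perm.swap _ _ _)

theorem pairwise_insertT (a : ℝ × α) (l : List (ℝ × α))
    (h : l.Pairwise fun x y => x.1 ≤ y.1) :
    (insertT a l).val.Pairwise fun x y => x.1 ≤ y.1 := by
  induction l with
  | nil => simp [insertT]
  | cons b l ih =>
    rw [List.pairwise_cons] at h
    simp only [insertT, val_bind]
    split
    · rename_i hab
      rw [val_le] at hab
      simp only [val_step, List.pairwise_cons, List.mem_cons, forall_eq_or_imp]
      exact ⟨⟨hab, fun y hy => hab.trans (h.1 y hy)⟩, h⟩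
    · rename_i hab
      rw [val_le, not_le] at hab
      simp only [val_bind, val_step, List.pairwise_cons]
      refine ⟨fun y hy => ?_, ih h.2⟩
      rcases List.mem_cons.1 ((val_insertT a l).subset hy) with rfl | hy
      exacts [hab.le, h.1 y hy]

theorem steps_insertT (a : ℝ × α) (l : List (ℝ × α)) :
    (insertT a l).steps ≤ 2 * l.length + 1 := by
  induction l with
  | nil => simp [insertT]
  | cons b l ih =>
    simp only [insertT, steps_bind, steps_le, List.length_cons]
    split
    · simp only [steps_step]; omega
    · simp only [steps_bind, steps_step]; omega

theorem val_sortT (l : List (ℝ × α)) : (sortT l).val.Perm l := by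
  induction l with
  | nil => simp [sortT]
  | cons a l ih =>
    simp only [sortT, val_bind]
    exact (val_insertT _ _).trans (ih.cons a)

theorem pairwise_sortT (l : List (ℝ × α)) :
    (sortT l).val.Pairwise fun x y => x.1 ≤ y.1 := by
  induction l with
  | nil => simp [sortT]
  | cons a l ih => exact pairwise_insertT _ _ ih

theorem steps_sortT (l : List (ℝ × α)) :
    (sortT l).steps ≤ (2 * l.length + 1) * l.length + 1 := by
  induction l with
  | nil => simp [sortT]
  | cons a l ih =>
    have h := steps_insertT a (sortT l).val
    rw [(val_sortT l).length_eq] at h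
    simp only [sortT, steps_bind, List.length_cons]
    nlinarith

theorem val_argminT_mem (a : ℝ × α) (l : List (ℝ × α)) : (argminT a l).val ∈ a :: l := by
  induction l generalizing a with
  | nil => simp [argminT]
  | cons b l ih =>
    simp only [argminT, val_bind, val_step]
    rcases List.mem_cons.1 (ih (if (lt b.1 a.1).val then b else a)) with h | h
    · rw [h]
      split <;> simp
    · exact List.mem_cons_of_mem _ (List.mem_cons_of_mem _ h)

theorem val_argminT_le (a : ℝ × α) (l : List (ℝ × α)) :
    ∀ x ∈ a :: l, (argminT a l).val.1 ≤ x.1 := by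
  induction l generalizing a with
  | nil => simp [argminT]
  | cons b l ih =>
    intro x hx
    simp only [argminT, val_bind, val_step]
    have h := ih (if (lt b.1 a.1).val then b else a)
    have h0 := h _ List.mem_cons_self
    by_cases hba : b.1 < a.1
    · simp only [(val_lt b.1 a.1).2 hba, if_true] at h h0 ⊢
      rcases List.mem_cons.1 hx with rfl | hx
      exacts [h0.trans hba.le, h x hx]
    · have hba' : ¬ (lt b.1 a.1).val = true := by rwa [val_lt]
      rw [if_neg hba'] at h h0 ⊢
      simp only [List.mem_cons] at hx h
      rcases hx with rfl | rfl | hx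
      exacts [h0, h0.trans (not_lt.1 hba), h x (Or.inr hx)]

@[simp] theorem steps_argminT (a : ℝ × α) (l : List (ℝ × α)) :
    (argminT a l).steps = 2 * l.length + 1 := by
  induction l generalizing a with
  | nil => simp [argminT]
  | cons b l ih => simp [argminT, ih]; ring

end Timed

end KMedian

/-! ### Perturbation resilience: few points have a foreign center within 8 times the distance to
their own. -/

namespace KMedian

open Finset

/-- Let `s`, `w`, `t` be the sums over `A` of the distances to `e`, `ci`, `ci'`. Optimality of `ci`
on `C` and `#(C \ A) ≤ #A / 6` give `w ≤ 7 / 5 * s`. At most a hundredth of `C` is closer to `ci`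
than `ci'` is, so `#A * dist ci' ci ≤ 600 / 593 * w` and `t ≤ 2.82 * s`. The last term is at most `4
/ 3 * (s + t)`, so `t ≤ 20 / 7 * s` suffices: the constants 7 and 100 leave little slack. -/
theorem sum_swap_nonpos_of_card {X : Type*} [PseudoMetricSpace X] [DecidableEq X]
    {C A : Finset X} (hA : A ⊆ C) {ci ci' e : X} {z : ℕ}
    (h1 : 7 * #(C \ A) ≤ #C) (h2 : 7 * z ≤ #C)
    (hopt : ∑ x ∈ C, dist x ci ≤ ∑ x ∈ C, dist x e)
    (hci : 100 * #{x ∈ C | dist x ci < dist ci' ci} ≤ #C) :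
    ∑ x ∈ A, (dist x ci' - 8 * dist x e) + 8 * (z * dist ci' e) ≤ 0 := by
  have hcard : (#(C \ A) : ℝ) + #A = #C := by exact_mod_cast card_sdiff_add_card_eq_card hA
  have h1' : 7 * (#(C \ A) : ℝ) ≤ #C := by exact_mod_cast h1
  have h2' : 7 * (z : ℝ) ≤ #C := by exact_mod_cast h2
  rw [sum_sub_distrib, ← mul_sum]
  rw [← sum_sdiff hA, ← sum_sdiff hA] at hopt
  set x : ℝ := ((#A : ℕ) : ℝ)
  set s := ∑ x ∈ A, dist x e
  set w := ∑ x ∈ A, dist x ci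
  set sc := ∑ x ∈ A, dist x ci'
  have hu : 0 ≤ dist e ci := dist_nonneg
  have hv : 0 ≤ dist ci' e := dist_nonneg
  have hδ : 0 ≤ dist ci' ci := dist_nonneg
  have e1 : ∑ x ∈ C \ A, dist x e ≤ ∑ x ∈ C \ A, dist x ci + #(C \ A) * dist e ci := by
    rw [← nsmul_eq_mul, ← sum_const, ← sum_add_distrib]
    exact sum_le_sum fun y _ => by linarith [dist_triangle y ci e, dist_comm ci e]
  have e2 : x * dist e ci ≤ s + w := by
    rw [← nsmul_eq_mul, ← sum_const, ← sum_add_distrib]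
    exact sum_le_sum fun y _ => by linarith [dist_triangle e y ci, dist_comm e y]
  have e3 : sc ≤ w + x * dist ci' ci := by
    rw [← nsmul_eq_mul, ← sum_const, ← sum_add_distrib]
    exact sum_le_sum fun y _ => by linarith [dist_triangle y ci ci', dist_comm ci ci']
  have e4 : x * dist ci' e ≤ s + sc := by
    rw [← nsmul_eq_mul, ← sum_const, ← sum_add_distrib]
    exact sum_le_sum fun y _ => by linarith [dist_triangle ci' y e, dist_comm ci' y]
  have e5 : (x - #C / 100) * dist ci' ci ≤ w := by
    have h3 : (#{x ∈ A | ¬ dist x ci < dist ci' ci} : ℝ) * dist ci' ci ≤ w := by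
      rw [← nsmul_eq_mul, ← sum_const]
      refine (sum_le_sum fun y hy => ?_).trans
        (sum_le_sum_of_subset_of_nonneg (filter_subset _ _) fun _ _ _ => dist_nonneg)
      exact not_lt.1 (mem_filter.1 hy).2
    have h4 : (#{x ∈ A | dist x ci < dist ci' ci} : ℝ) +
        #{x ∈ A | ¬ dist x ci < dist ci' ci} = x := by
      rw [← Nat.cast_add, card_filter_add_card_filter_not]
    have h5 : (100 : ℝ) * #{x ∈ A | dist x ci < dist ci' ci} ≤ #C := by
      refine le_trans ?_ (by exact_mod_cast hci :
        (100 : ℝ) * #{x ∈ C | dist x ci < dist ci' ci} ≤ #C)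
      gcongr
    refine le_trans (mul_le_mul_of_nonneg_right ?_ hδ) h3
    linarith
  have e6 : (#(C \ A) : ℝ) * dist e ci ≤ x / 6 * dist e ci :=
    mul_le_mul_of_nonneg_right (by linarith) hu
  have e7 : (z : ℝ) * dist ci' e ≤ x / 6 * dist ci' e :=
    mul_le_mul_of_nonneg_right (by linarith) hv
  have e8 : (x - 7 / 600 * x) * dist ci' ci ≤ (x - #C / 100) * dist ci' ci :=
    mul_le_mul_of_nonneg_right (by linarith) hδ
  nlinarith

section Optimal

variable {X : Type*} [Fintype X] {k : ℕ}

theorem clusterSize_eq_card {Y : Type*} [Fintype Y] (f : Y → Fin k) (i : Fin k) :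
    clusterSize f i = #{y | f y = i} := by
  rw [clusterSize, Nat.card_eq_fintype_card, Fintype.card_subtype]

theorem cost_eq_sum_fiber (d : X → X → ℝ) (f : X → Fin k) (c : Fin k → X) :
    cost d f c = ∑ i, ∑ x with f x = i, d x (c (f x)) :=
  (Finset.sum_fiberwise _ _ _).symm

theorem exists_isOptimal (d : X → X → ℝ) (f : X → Fin k) (c : Fin k → X) :
    ∃ g e, IsOptimal (k := k) d g e := by
  have : Nonempty ((X → Fin k) × (Fin k → X)) := ⟨(f, c)⟩
  obtain ⟨p, hp⟩ := Finite.exists_min fun p : (X → Fin k) × (Fin k → X) => cost d p.1 p.2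
  exact ⟨p.1, p.2, fun g e => hp (g, e)⟩

/-- The points misplaced in the single clusters are disjoint, so closeness becomes one count over
`X`, which can be compared with the integer `⌊ε * N⌋`. -/
theorem epsClose_iff {ε : ℝ} {f g : X → Fin k} :
    EpsClose ε f g ↔
      ∃ σ : Equiv.Perm (Fin k), (#{x | g x ≠ σ (f x)} : ℝ) ≤ ε * Fintype.card X := by
  refine exists_congr fun σ => ?_
  have : #{x | g x ≠ σ (f x)} = ∑ i, Nat.card {x : X // f x = i ∧ g x ≠ σ i} := by
    rw [card_eq_sum_card_fiberwise (f := f) (t := univ) (fun _ _ => mem_coe.2 (mem_univ _))]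
    refine sum_congr rfl fun i _ => ?_
    rw [Nat.card_eq_fintype_card, Fintype.card_subtype, filter_filter]
    congr 1
    ext x
    simp only [mem_filter, mem_univ, true_and]
    constructor
    · rintro ⟨h, rfl⟩
      exact ⟨rfl, h⟩
    · rintro ⟨rfl, h⟩
      exact ⟨h, rfl⟩
  rw [this]
  push_cast
  rfl

theorem IsOptimal.le_center {d : X → X → ℝ} {f : X → Fin k} {c : Fin k → X}
    (h : IsOptimal d f c) (x : X) (j : Fin k) : d x (c (f x)) ≤ d x (c j) := by
  classical
  have := h (Function.update f x j) c
  rw [cost, cost, ← add_sum_erase _ _ (mem_univ x), ← add_sum_erase _ _ (mem_univ x)] at this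
  have h1 : ∑ y ∈ univ.erase x, d y (c (Function.update f x j y)) =
      ∑ y ∈ univ.erase x, d y (c (f y)) :=
    sum_congr rfl fun y hy => by rw [Function.update_of_ne (ne_of_mem_erase hy)]
  rw [h1, Function.update_self] at this
  linarith

theorem IsOptimal.sum_le {d : X → X → ℝ} {f : X → Fin k} {c : Fin k → X}
    (h : IsOptimal d f c) (i : Fin k) (e : X) :
    ∑ x with f x = i, d x (c i) ≤ ∑ x with f x = i, d x e := by
  classical
  have := h f (Function.update c i e)
  rw [cost_eq_sum_fiber, cost_eq_sum_fiber, ← add_sum_erase _ _ (mem_univ i),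
    ← add_sum_erase _ _ (mem_univ i)] at this
  have h1 : ∑ j ∈ univ.erase i, ∑ x with f x = j, d x (Function.update c i e (f x)) =
      ∑ j ∈ univ.erase i, ∑ x with f x = j, d x (c (f x)) := by
    refine sum_congr rfl fun j hj => sum_congr rfl fun x hx => ?_
    rw [(mem_filter.1 hx).2, Function.update_of_ne (ne_of_mem_erase hj)]
  have h2 : ∑ x with f x = i, d x (Function.update c i e (f x)) =
      ∑ x with f x = i, d x e :=
    sum_congr rfl fun x hx => by rw [(mem_filter.1 hx).2, Function.update_self]
  have h3 : ∑ x with f x = i, d x (c (f x)) = ∑ x with f x = i, d x (c i) :=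
    sum_congr rfl fun x hx => by rw [(mem_filter.1 hx).2]
  rw [h1, h2, h3] at this
  linarith

theorem exists_forall_ne_center (hk : k < Fintype.card X) (c : Fin k → X) :
    ∃ x, ∀ i, c i ≠ x := by
  by_contra! h
  have := Fintype.card_le_of_surjective c h
  simp at this
  omega

variable [MetricSpace X]

theorem cost_dist_pos (hk : k < Fintype.card X) (f : X → Fin k) (c : Fin k → X) :
    0 < cost dist f c := by
  obtain ⟨x, hx⟩ := exists_forall_ne_center hk c
  refine sum_pos' (fun _ _ => dist_nonneg) ⟨x, mem_univ _, dist_pos.2 (hx _).symm⟩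

/-- A repeated center could be moved to a point that is not a center, which saves a positive amount.
When `ε * N < 1` this excludes bad points that form a cluster alone. -/
theorem IsOptimal.injective (hk : k < Fintype.card X) {f : X → Fin k} {c : Fin k → X}
    (h : IsOptimal dist f c) : Function.Injective c := by
  classical
  intro i j hij
  by_contra hne
  obtain ⟨x, hx⟩ := exists_forall_ne_center hk c
  -- Cluster `i` is handed to `j`, which has the same center; the freed index `i` serves `x`.
  let f' : X → Fin k := fun y => if y = x then i else if f y = i then j else f y
  have hlt : cost dist f' (Function.update c i x) < cost dist f c := by
    refine sum_lt_sum (fun y _ => ?_) ⟨x, mem_univ _, ?_⟩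
    · by_cases hy : y = x
      · simp [f', hy]
      · by_cases hy' : f y = i
        · simp [f', hy, hy', Function.update_of_ne (Ne.symm hne), hij]
        · simp [f', hy, hy']
    · simpa [f'] using (hx _).symm
  exact hlt.not_ge (h _ _)

/-- If every center that changes is locally no worse for the perturbed distance that
charges `x` the true distance only for the center `c' (m x)`, then `c'` is as good as `e`. -/
theorem cost_replace_le [DecidableEq X] (f g m : X → Fin k) (e c' : Fin k → X) (d' : X → X → ℝ)
    (hd' : ∀ x y, d' x y = if y = c' (m x) then dist x y else 8 * dist x y)
    (H : ∀ i, e i ≠ c' i → ∑ x with g x = i,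
      (if f x = i ∧ m x = i then dist x (c' i) - 8 * dist x (e i)
        else if c' (m x) = e i then 0 else 8 * (dist x (c' i) - dist x (e i))) ≤ 0) :
    cost d' (fun x => if e (g x) = c' (m x) ∧ e (g x) ≠ c' (g x) then m x else g x) c' ≤
      cost d' g e := by
  rw [cost, cost, ← sub_nonpos, ← sum_sub_distrib, ← sum_fiberwise univ g]
  refine sum_nonpos fun i _ => ?_
  by_cases hi : e i = c' i
  · refine (sum_congr rfl fun x hx => ?_).le.trans sum_const_zero.le
    rw [(mem_filter.1 hx).2]
    simp [hi]
  · refine le_trans (sum_le_sum fun x hx => ?_) (H i hi)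
    have hx : g x = i := (mem_filter.1 hx).2
    have h0 : 0 ≤ dist x (c' i) := dist_nonneg
    simp only [hx, hd']
    by_cases h1 : f x = i ∧ m x = i
    · simp [h1, hi]
    · simp only [h1, if_false]
      by_cases h2 : c' (m x) = e i
      · simp [h2, hi]
      · simp only [h2, Ne.symm h2, if_false, false_and]
        split_ifs <;> linarith

/-- Perturbation resilience for perturbed centers: all but `ε |X|` points are much
closer to the center of their own cluster than to any other center. -/
theorem card_bad_le {α ε : ℝ} {f : X → Fin k} {c c' : Fin k → X}
    (hk : k < Fintype.card X) (hopt : IsOptimal dist f c) (hPR : PerturbationResilient α ε f)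
    (hα : 8 ≤ α) (hε : 0 ≤ ε)
    (hsize : ∀ i, 20 * (ε * Fintype.card X) < #{x | f x = i})
    (hc' : (ε * Fintype.card X < 1 ∧ c' = c) ∨ (1 ≤ ε * Fintype.card X ∧
      ∀ i, 100 * #{x | f x = i ∧ dist x (c i) < dist (c' i) (c i)} ≤ #{x | f x = i})) :
    (#{x | ∃ j, j ≠ f x ∧ dist x (c' j) ≤ 8 * dist x (c' (f x))} : ℝ) ≤
      ε * Fintype.card X := by
  classical
  by_contra! hcon
  set L : ℝ := ε * Fintype.card X with hL
  have hL0 : 0 ≤ L := by positivity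
  -- Counts are integers, so resilience allows `M` misplaced points, and `M + 1` bad points suffice
  -- for a contradiction. Taking no more of them keeps the perturbation small.
  set M : ℕ := ⌊L⌋₊ with hM
  have hML : (M : ℝ) ≤ L := Nat.floor_le hL0
  have hbad : M + 1 ≤ #{x | ∃ j, j ≠ f x ∧ dist x (c' j) ≤ 8 * dist x (c' (f x))} := by
    have := (Nat.floor_lt hL0).2 hcon
    omega
  obtain ⟨Bh, hBh, hBcard⟩ := exists_subset_card_eq hbad
  have hBh' : ∀ x, ∃ j, x ∈ Bh → j ≠ f x ∧ dist x (c' j) ≤ 8 * dist x (c' (f x)) := by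
    intro x
    by_cases hx : x ∈ Bh
    · obtain ⟨j, hj⟩ := (mem_filter.1 (hBh hx)).2
      exact ⟨j, fun _ => hj⟩
    · exact ⟨f x, fun h => absurd h hx⟩
  choose j hj using hBh'
  -- The index of the only center that `x` sees at its true distance: the competitor for a chosen
  -- bad point, its own otherwise.
  let m : X → Fin k := fun x => if x ∈ Bh then j x else f x
  have hmB : ∀ x ∈ Bh, m x = j x := fun x hx => if_pos hx
  have hmn : ∀ x ∉ Bh, m x = f x := fun x hx => if_neg hx
  let d' : X → X → ℝ := fun x y => if y = c' (m x) then dist x y else 8 * dist x y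
  have hd' : ∀ x y, d' x y = if y = c' (m x) then dist x y else 8 * dist x y := fun _ _ => rfl
  have hd1 : ∀ x y, dist x y ≤ d' x y ∧ d' x y ≤ α * dist x y := by
    intro x y
    have := dist_nonneg (x := x) (y := y)
    simp only [d']
    split_ifs <;> constructor <;> nlinarith
  have hfloor : ∀ n : ℕ, (n : ℝ) ≤ L → n ≤ M := fun n hn => Nat.le_floor hn
  obtain ⟨g₀, e₀, hge₀⟩ := exists_isOptimal d' f c
  obtain ⟨σ, hσ⟩ := epsClose_iff.1 (hPR d' hd1 g₀ e₀ hge₀)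
  -- The indices of the optimum are permuted so that it agrees with `f` under the identity matching.
  obtain ⟨g, e, hge, hgf⟩ : ∃ g e, IsOptimal d' g e ∧ #{x | f x ≠ g x} ≤ M := by
    refine ⟨fun x => σ.symm (g₀ x), fun i => e₀ (σ i), fun f' c'' => ?_, ?_⟩
    · simpa [cost] using hge₀ f' c''
    · have hset : ({x | f x ≠ σ.symm (g₀ x)} : Finset X) = ({x | g₀ x ≠ σ (f x)} : Finset X) := by
        ext x
        simp [Equiv.eq_symm_apply, eq_comm]
      rw [hset]
      exact hfloor _ hσ
  -- The exceptions are among the at most `M` points where `f` and `g` differ and the `M + 1` points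
  -- of `Bh`.
  have hnm : ∀ i, #{x ∈ ({x | f x = i} : Finset X) | ¬(g x = i ∧ m x = i)} ≤ 2 * M + 1 := by
    intro i
    refine (card_le_card (t := ({x | f x ≠ g x} : Finset X) ∪ Bh) fun x hx => ?_).trans
      ((card_union_le _ _).trans (by omega))
    simp only [mem_filter, mem_univ, true_and] at hx
    by_cases hxB : x ∈ Bh
    · exact mem_union_right _ hxB
    · refine mem_union_left _ ?_
      rw [hmn x hxB] at hx
      simp only [mem_filter, mem_univ, true_and]
      intro h
      exact hx.2 ⟨h ▸ hx.1, hx.1⟩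
  have hnm' : ∀ i, #{x ∈ ({x | g x = i} : Finset X) | ¬(f x = i ∧ m x = i)} ≤ 2 * M + 1 := by
    intro i
    refine (card_le_card (t := ({x | f x ≠ g x} : Finset X) ∪ Bh) fun x hx => ?_).trans
      ((card_union_le _ _).trans (by omega))
    simp only [mem_filter, mem_univ, true_and] at hx
    by_cases hxB : x ∈ Bh
    · exact mem_union_right _ hxB
    · refine mem_union_left _ ?_
      rw [hmn x hxB] at hx
      simp only [mem_filter, mem_univ, true_and]
      intro h
      exact hx.2 ⟨h ▸ hx.1, h ▸ hx.1⟩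
  have key := cost_replace_le f g m e c' d' hd' (by
    intro i hi
    rcases hc' with ⟨hlt, rfl⟩ | ⟨hge1, hclose⟩
    -- Here closeness forces `g = f`, and one bad point `p₀` is perturbed; optimality of `c' = c`
    -- replaces the counting.
    · have hM0 : M = 0 := by rw [hM]; exact Nat.floor_eq_zero.2 hlt
      have hfg : g = f := by
        rw [hM0, Nat.le_zero, card_eq_zero, filter_eq_empty_iff] at hgf
        funext x
        have := hgf (mem_univ x)
        simpa [eq_comm] using this
      subst hfg
      rw [hM0, zero_add, card_eq_one] at hBcard
      obtain ⟨p₀, rfl⟩ := hBcard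
      -- If `e i` is the center discounted for `p₀`, each term is nonpositive: `p₀` may contribute
      -- zero, and for the other points their own center is nearest. Otherwise every term is at most
      -- 8 times the change in true distance, and these changes sum to at most zero.
      by_cases hep : c' (m p₀) = e i
      · refine sum_nonpos fun x hx => ?_
        have hx := (mem_filter.1 hx).2
        have h1 := hopt.le_center x (m p₀)
        rw [hx, hep] at h1
        have := dist_nonneg (x := x) (y := e i)
        split_ifs with h2 h3
        · linarith
        · rfl
        · exfalso
          by_cases hxp : x = p₀
          · exact h3 (hxp ▸ hep)
          · exact h2 ⟨hx, (hmn x (by simpa using hxp)).trans hx⟩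
      · refine (sum_le_sum (g := fun x => 8 * (dist x (c' i) - dist x (e i)))
          fun x hx => ?_).trans ?_
        · have hx := (mem_filter.1 hx).2
          have := dist_nonneg (x := x) (y := c' i)
          split_ifs with h2 h3
          · linarith
          · exfalso
            by_cases hxp : x = p₀
            · exact hep (hxp ▸ h3)
            · exact h2 ⟨hx, (hmn x (by simpa using hxp)).trans hx⟩
          · rfl
        · rw [← mul_sum, sum_sub_distrib]
          linarith [hopt.sum_le i (e i)]
    · have hM1 : 1 ≤ M := Nat.le_floor (by simpa using hge1)
      -- Lost and foreign points number at most `2 * M + 1` each, and `7 * (2 * M + 1) ≤ 20 * M + 1`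
      -- because `M ≥ 1`.
      have hbig : 20 * M < #{x | f x = i} := by
        have := hsize i
        have h' : (20 * M : ℝ) < #{x | f x = i} := by linarith
        exact_mod_cast h'
      rw [← sum_filter_add_sum_filter_not _ fun x => f x = i ∧ m x = i]
      have hz := hnm' i
      have hAeq : ({x ∈ ({x | g x = i} : Finset X) | f x = i ∧ m x = i} : Finset X) =
          {x ∈ ({x | f x = i} : Finset X) | g x = i ∧ m x = i} := by
        ext x
        simp only [mem_filter, mem_univ, true_and]
        tauto
      refine le_trans (add_le_add (le_of_eq (sum_congr hAeq
        (g := fun x => dist x (c' i) - 8 * dist x (e i)) fun x hx => ?_))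
        (sum_le_card_nsmul _ _ (8 * dist (c' i) (e i)) fun x hx => ?_))
        (le_trans (le_of_eq ?_) (sum_swap_nonpos_of_card
          (A := {x ∈ ({x | f x = i} : Finset X) | g x = i ∧ m x = i})
          (filter_subset _ _) (C := ({x | f x = i} : Finset X)) (ci := c i) (ci' := c' i) (e := e i)
          (z := #{x ∈ ({x | g x = i} : Finset X) | ¬(f x = i ∧ m x = i)})
          ?_ (by omega) (hopt.sum_le i (e i)) ?_))
      · simp only [mem_filter, mem_univ, true_and] at hx
        rw [if_pos ⟨hx.1, hx.2.2⟩]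
      · simp only [mem_filter, mem_univ, true_and] at hx
        rw [if_neg hx.2]
        have := dist_nonneg (x := c' i) (y := e i)
        split_ifs
        · linarith
        · linarith [dist_triangle x (e i) (c' i), dist_comm (e i) (c' i)]
      · rw [nsmul_eq_mul]; ring
      · rw [← filter_not]
        have := hnm i
        omega
      · rw [filter_filter]
        exact hclose i)
  -- A point that `e` served through its discounted center under another index is given the index of
  -- that center, so its cost is unchanged.
  set h : X → Fin k := fun x => if e (g x) = c' (m x) ∧ e (g x) ≠ c' (g x) then m x else g x
    with hh
  -- Chosen points still at their own center move to the competitor, whose true distance is at most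
  -- 8 times the other one; so `h'` with `c'` is optimal too.
  let h' : X → Fin k := fun x => if x ∈ Bh ∧ h x = f x then m x else h x
  have hcost : cost d' h' c' ≤ cost d' h c' := by
    refine sum_le_sum fun x _ => ?_
    simp only [h']
    split_ifs with hx
    · have h1 := (hj x hx.1).2
      rw [← hmB x hx.1] at h1
      rw [hx.2, hd', if_pos rfl, hd']
      split_ifs with h2
      · rw [h2]
      · exact h1
    · rfl
  obtain ⟨τ, hτ⟩ := epsClose_iff.1
    (hPR d' hd1 h' c' fun f' c'' => hcost.trans (key.trans (hge f' c'')))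
  have hτ' := hfloor _ hτ
  -- The size needed to identify `τ (f x)`: at most `2 * M + 1` points of the cluster are
  -- exceptional for `g` and `m`, and at most `M` disagree with `τ`.
  have hsz : ∀ x ∈ Bh, 3 * M + 1 < #{y | f y = f x} := by
    intro x hx
    rcases hc' with ⟨hlt, rfl⟩ | ⟨hge1, -⟩
    · have hM0 : M = 0 := by rw [hM]; exact Nat.floor_eq_zero.2 hlt
      rw [hM0]
      by_contra! hle
      have hxs : ({y | f y = f x} : Finset X) = {x} := by
        refine (eq_of_subset_of_card_le ?_ ?_).symm
        · simp
        · simpa using hle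
      have h1 := hopt.sum_le (f x) x
      rw [hxs] at h1
      simp only [sum_singleton, dist_self] at h1
      have h2 := hj x hx
      have h3 : dist x (c' (f x)) = 0 := le_antisymm h1 dist_nonneg
      have h4 : dist x (c' (j x)) = 0 :=
        le_antisymm (by simpa [h3] using h2.2) dist_nonneg
      exact h2.1 (hopt.injective hk ((dist_eq_zero.1 h4).symm.trans (dist_eq_zero.1 h3)))
    · have hM1 : 1 ≤ M := Nat.le_floor (by simpa using hge1)
      have := hsize (f x)
      have h' : (20 * M : ℝ) < #{y | f y = f x} := by linarith
      have h'' : 20 * M < #{y | f y = f x} := by exact_mod_cast h'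
      omega
  -- Some `y` in the cluster keeps its label under `h'` and also obeys `τ`. Hence `τ` fixes that
  -- label, and every chosen point, having lost it, counts as misplaced.
  have hfix : ∀ x ∈ Bh, τ (f x) = f x := by
    intro x hx
    by_contra hne
    have hcov : ({y | f y = f x} : Finset X) ⊆
        {y ∈ ({y | f y = f x} : Finset X) | ¬(g y = f x ∧ m y = f x)} ∪
          ({y | h' y ≠ τ (f y)} : Finset X) := by
      intro y hy
      have hy' : f y = f x := (mem_filter.1 hy).2
      simp only [mem_union, mem_filter, mem_univ, true_and, hy']
      by_contra! hcon'
      obtain ⟨hc1, hc2⟩ := hcon'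
      have hgm := hc1
      have hyB : y ∉ Bh := fun hyB => (hj y hyB).1 (by rw [← hmB y hyB, hgm.2, hy'])
      apply hne
      rw [← hc2]
      simp [h', hyB, hh, hgm.1, hgm.2]
    have := (card_le_card hcov).trans (card_union_le _ _)
    have h1 := hsz x hx
    have h2 := hnm (f x)
    omega
  have : Bh ⊆ ({x | h' x ≠ τ (f x)} : Finset X) := by
    intro x hx
    simp only [mem_filter, mem_univ, true_and, hfix x hx, h', hx]
    split_ifs with h1
    · rw [hmB x hx]
      exact (hj x hx).1
    · exact h1
  have := card_le_card this
  omega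

end Optimal

end KMedian

/-! ### Concentration of the sample, uniformly over all tuples of centers. -/

namespace KMedian

open Finset ProbabilityTheory

section Sampling

variable {X : Type*} [Fintype X] [Nonempty X] [MeasurableSpace X] [DiscreteMeasurableSpace X]

instance (n : ℕ) : IsProbabilityMeasure (sampleLaw X n) := by
  unfold sampleLaw; infer_instance

theorem integral_sampleLaw_eval {n : ℕ} (u : X → ℝ) (s : Fin n) :
    ∫ ω, u (ω s) ∂(sampleLaw X n) = (∑ x, u x) / Fintype.card X := by
  rw [sampleLaw]
  have h := (measurePreserving_eval
    (fun _ : Fin n => (PMF.uniformOfFintype X).toMeasure) s).map_eq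
  have h2 := integral_map (μ := Measure.pi fun _ : Fin n => (PMF.uniformOfFintype X).toMeasure)
    (φ := Function.eval s) (measurable_pi_apply s).aemeasurable (f := u)
    (measurable_of_finite u).aestronglyMeasurable
  rw [h] at h2
  simp only [Function.eval] at h2
  rw [← h2, PMF.integral_eq_sum]
  simp [div_eq_inv_mul, mul_sum]

/-- Hoeffding's inequality for a function of independent uniform points. -/
theorem measureReal_sum_ge_le {n : ℕ} {u : X → ℝ} {D t : ℝ} (h0 : ∀ x, 0 ≤ u x)
    (hD : ∀ x, u x ≤ D) (hD0 : 0 < D) (ht : 0 ≤ t) :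
    (sampleLaw X n).real {ω | n * ((∑ x, u x) / Fintype.card X + t) ≤ ∑ s, u (ω s)} ≤
      Real.exp (-(2 * n * (t / D) ^ 2)) := by
  have hindep : iIndepFun (fun (s : Fin n) ω => u (ω s) - (∑ x, u x) / Fintype.card X)
      (sampleLaw X n) :=
    iIndepFun_pi (X := fun (_ : Fin n) x => u x - (∑ x, u x) / Fintype.card X)
      fun _ => (measurable_of_finite _).aemeasurable
  have hsub : ∀ s ∈ (univ : Finset (Fin n)), HasSubgaussianMGF
      (fun ω => u (ω s) - (∑ x, u x) / Fintype.card X) ((‖D - 0‖₊ / 2) ^ 2)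
      (sampleLaw X n) := by
    intro s _
    have := hasSubgaussianMGF_of_mem_Icc (μ := sampleLaw X n) (X := fun ω => u (ω s))
      (a := 0) (b := D) ((measurable_of_finite u).comp (measurable_pi_apply s)).aemeasurable
      (Filter.Eventually.of_forall fun ω => ⟨h0 _, hD _⟩)
    rwa [integral_sampleLaw_eval] at this
  have key := HasSubgaussianMGF.measure_sum_ge_le_of_iIndepFun hindep hsub
    (ε := n * t) (by positivity)
  convert key using 2
  · ext ω
    simp only [Set.mem_ofPred_eq, sum_sub_distrib, sum_const, card_univ, Fintype.card_fin,
      nsmul_eq_mul]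
    constructor <;> intro h <;> linarith
  · simp only [sub_zero, sum_const, card_univ, Fintype.card_fin, nsmul_eq_mul]
    push_cast
    rw [Real.norm_of_nonneg hD0.le]
    rcases Nat.eq_zero_or_pos n with rfl | hn
    · simp
    · have : (0 : ℝ) < n := by exact_mod_cast hn
      field_simp

/-- The upper tail for `D - u`, which has the same range. -/
theorem measureReal_sum_le_le {n : ℕ} {u : X → ℝ} {D t : ℝ} (h0 : ∀ x, 0 ≤ u x)
    (hD : ∀ x, u x ≤ D) (hD0 : 0 < D) (ht : 0 ≤ t) :
    (sampleLaw X n).real {ω | ∑ s, u (ω s) ≤ n * ((∑ x, u x) / Fintype.card X - t)} ≤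
      Real.exp (-(2 * n * (t / D) ^ 2)) := by
  have key := measureReal_sum_ge_le (n := n) (u := fun x => D - u x) (D := D) (t := t)
    (fun x => sub_nonneg.2 (hD x)) (fun x => by linarith [h0 x]) hD0 ht
  convert key using 2
  ext ω
  have hN : (0 : ℝ) < Fintype.card X := by exact_mod_cast Fintype.card_pos
  simp only [Set.mem_ofPred_eq, sum_sub_distrib, sum_const, card_univ, Fintype.card_fin,
    nsmul_eq_mul, sub_div]
  rw [mul_div_cancel_left₀ _ hN.ne']
  constructor <;> intro h <;> linarith

theorem measureReal_card_le_le [DecidableEq X] {n : ℕ} (T : Finset X) {t : ℝ} (ht : 0 ≤ t) :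
    (sampleLaw X n).real {ω | (#{s | ω s ∈ T} : ℝ) ≤ n * ((#T : ℝ) / Fintype.card X - t)} ≤
      Real.exp (-(2 * n * t ^ 2)) := by
  have key := measureReal_sum_le_le (n := n) (u := fun x => if x ∈ T then 1 else 0)
    (D := 1) (t := t) (fun x => by split_ifs <;> norm_num) (fun x => by split_ifs <;> norm_num)
    one_pos ht
  simpa using key

theorem measureReal_card_ge_le [DecidableEq X] {n : ℕ} (T : Finset X) {t : ℝ} (ht : 0 ≤ t) :
    (sampleLaw X n).real {ω | n * ((#T : ℝ) / Fintype.card X + t) ≤ (#{s | ω s ∈ T} : ℝ)} ≤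
      Real.exp (-(2 * n * t ^ 2)) := by
  have key := measureReal_sum_ge_le (n := n) (u := fun x => if x ∈ T then 1 else 0)
    (D := 1) (t := t) (fun x => by split_ifs <;> norm_num) (fun x => by split_ifs <;> norm_num)
    one_pos ht
  simpa using key

theorem measureReal_iUnion_le_card_mul {Ω ι : Type*} [MeasurableSpace Ω] [Fintype ι]
    (P : Measure Ω) (E : ι → Set Ω) {p : ℝ} (h : ∀ i, P.real (E i) ≤ p) :
    P.real (⋃ i, E i) ≤ Fintype.card ι * p := by
  refine (measureReal_iUnion_fintype_le E).trans ?_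
  refine (sum_le_card_nsmul _ _ p fun i _ => h i).trans ?_
  simp

/-- With probability at least `1 - δ` all relevant empirical averages are close to their means. -/
theorem one_sub_le_measureReal [DecidableEq X] {n k : ℕ} {ε l ζ D δ : ℝ} {C T : Fin k → Finset X}
    {B : (Fin k → X) → Finset X} {φ : (Fin k → X) → X → ℝ} {ψ : X → ℝ}
    (hk0 : 0 < k) (hk : k < Fintype.card X) (hε : 0 < ε) (hl : 0 < l) (hζ : 0 < ζ) (hD : 0 < D)
    (hδ0 : 0 < δ) (hδ1 : δ < 1)
    (hφ0 : ∀ c x, 0 ≤ φ c x) (hφD : ∀ c x, φ c x ≤ D)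
    (hψ0 : ∀ x, 0 ≤ ψ x) (hψD : ∀ x, ψ x ≤ D)
    (hn1 : 4 * k * Real.log (Fintype.card X / δ) ≤ n * ε ^ 2 / 50)
    (hn2 : 4 * k * Real.log (Fintype.card X / δ) ≤ 2 * n * (l * ζ / D) ^ 2) :
    1 - δ ≤ (sampleLaw X n).real {ω |
      (∀ i, n * ((#(C i) : ℝ) / Fintype.card X - 10 * ε) < #{s | ω s ∈ C i}) ∧
      (∀ i, n * ((#(T i) : ℝ) / Fintype.card X - ε / 10) < #{s | ω s ∈ T i}) ∧
      (∀ c, (#{s | ω s ∈ B c} : ℝ) < n * ((#(B c) : ℝ) / Fintype.card X + ε)) ∧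
      (∀ c, n * ((∑ x, φ c x) / Fintype.card X - l * ζ) < ∑ s, φ c (ω s)) ∧
      ∑ s, ψ (ω s) < n * ((∑ x, ψ x) / Fintype.card X + l * ζ)} := by
  set N : ℝ := (Fintype.card X : ℝ) with hN
  have hN2 : 2 ≤ N := by
    have : 2 ≤ Fintype.card X := by omega
    rw [hN]; exact_mod_cast this
  have hn0 : (0 : ℝ) ≤ n := Nat.cast_nonneg n
  set L := Real.log (N / δ)
  set p := Real.exp (-(4 * k * L)) with hp
  have hp0 : 0 < p := Real.exp_pos _
  set A₁ : Fin k → Set (Fin n → X) := fun i =>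
    {ω | (#{s | ω s ∈ C i} : ℝ) ≤ n * ((#(C i) : ℝ) / N - 10 * ε)} with hA₁
  set A₂ : Fin k → Set (Fin n → X) := fun i =>
    {ω | (#{s | ω s ∈ T i} : ℝ) ≤ n * ((#(T i) : ℝ) / N - ε / 10)} with hA₂
  set A₃ : (Fin k → X) → Set (Fin n → X) := fun c =>
    {ω | n * ((#(B c) : ℝ) / N + ε) ≤ (#{s | ω s ∈ B c} : ℝ)} with hA₃
  set A₄ : (Fin k → X) → Set (Fin n → X) := fun c =>
    {ω | ∑ s, φ c (ω s) ≤ n * ((∑ x, φ c x) / N - l * ζ)} with hA₄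
  set A₅ : Set (Fin n → X) := {ω | n * ((∑ x, ψ x) / N + l * ζ) ≤ ∑ s, ψ (ω s)} with hA₅
  -- Among the frequency deviations `10 * ε`, `ε / 10` and `ε` the smallest decides: `2 * n * (ε /
  -- 10) ^ 2 = n * ε ^ 2 / 50`.
  have h₁ : ∀ i, (sampleLaw X n).real (A₁ i) ≤ p := fun i =>
    (measureReal_card_le_le (C i) (by positivity)).trans
      (Real.exp_le_exp.2 (by nlinarith [mul_nonneg hn0 (sq_nonneg ε)]))
  have h₂ : ∀ i, (sampleLaw X n).real (A₂ i) ≤ p := fun i =>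
    (measureReal_card_le_le (T i) (by positivity)).trans
      (Real.exp_le_exp.2 (by nlinarith [mul_nonneg hn0 (sq_nonneg ε)]))
  have h₃ : ∀ c, (sampleLaw X n).real (A₃ c) ≤ p := fun c =>
    (measureReal_card_ge_le (B c) hε.le).trans
      (Real.exp_le_exp.2 (by nlinarith [mul_nonneg hn0 (sq_nonneg ε)]))
  have h₄ : ∀ c, (sampleLaw X n).real (A₄ c) ≤ p := fun c =>
    (measureReal_sum_le_le (hφ0 c) (hφD c) hD (by positivity)).trans
      (Real.exp_le_exp.2 (by linarith))
  have h₅ : (sampleLaw X n).real A₅ ≤ p :=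
    (measureReal_sum_ge_le hψ0 hψD hD (by positivity)).trans (Real.exp_le_exp.2 (by linarith))
  have hkN : (k : ℝ) ≤ N ^ k := by
    have h1 : k ≤ Fintype.card X ^ k := hk.le.trans (Nat.le_self_pow hk0.ne' _)
    rw [hN]; exact_mod_cast h1
  have hNk : 1 ≤ N ^ k := one_le_pow₀ (by linarith)
  have e₁ : (sampleLaw X n).real (⋃ i, A₁ i) ≤ N ^ k * p :=
    (measureReal_iUnion_le_card_mul _ _ h₁).trans (by
      rw [Fintype.card_fin]; exact mul_le_mul_of_nonneg_right hkN hp0.le)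
  have e₂ : (sampleLaw X n).real (⋃ i, A₂ i) ≤ N ^ k * p :=
    (measureReal_iUnion_le_card_mul _ _ h₂).trans (by
      rw [Fintype.card_fin]; exact mul_le_mul_of_nonneg_right hkN hp0.le)
  have e₃ : (sampleLaw X n).real (⋃ i, A₃ i) ≤ N ^ k * p :=
    (measureReal_iUnion_le_card_mul _ _ h₃).trans (by simp [hN])
  have e₄ : (sampleLaw X n).real (⋃ i, A₄ i) ≤ N ^ k * p :=
    (measureReal_iUnion_le_card_mul _ _ h₄).trans (by simp [hN])
  have e₅ : (sampleLaw X n).real A₅ ≤ N ^ k * p :=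
    h₅.trans (le_mul_of_one_le_left hp0.le hNk)
  -- There are five families of at most `N ^ k` events, and `p = (δ / N) ^ (4 * k)`; after
  -- cancelling `N ^ k` the remaining `N ^ (3 * k) ≥ 8` absorbs the 5.
  have hpδ : 5 * (N ^ k * p) ≤ δ := by
    have hx : p = (δ / N) ^ (4 * k) := by
      rw [hp, ← mul_neg, ← Real.log_inv, inv_div]
      have : (4 * (k : ℝ)) = ((4 * k : ℕ) : ℝ) := by push_cast; ring
      rw [this, ← Real.log_pow, Real.exp_log (by positivity)]
    rw [hx, div_pow]
    have hk1 : N ^ (4 * k) = N ^ k * N ^ (3 * k) := by rw [← pow_add]; congr 1; ring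
    have hδk : δ ^ (4 * k) ≤ δ := pow_le_of_le_one hδ0.le hδ1.le (by omega)
    have h8 : 8 ≤ N ^ (3 * k) := by
      calc (8 : ℝ) = 2 ^ 3 := by norm_num
        _ ≤ N ^ 3 := by gcongr
        _ ≤ N ^ (3 * k) := pow_le_pow_right₀ (by linarith) (by omega)
    rw [hk1]
    have hNk0 : 0 < N ^ k := by positivity
    have hN3 : 0 < N ^ (3 * k) := by positivity
    have : 5 * (N ^ k * (δ ^ (4 * k) / (N ^ k * N ^ (3 * k)))) =
        5 * δ ^ (4 * k) / N ^ (3 * k) := by field_simp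
    rw [this, div_le_iff₀ hN3]
    nlinarith
  set G : Set (Fin n → X) := {ω | _} with hG
  have hcover : (Set.univ : Set (Fin n → X)) ⊆
      G ∪ ((⋃ i, A₁ i) ∪ ((⋃ i, A₂ i) ∪ ((⋃ i, A₃ i) ∪ ((⋃ i, A₄ i) ∪ A₅)))) := by
    intro ω _
    by_contra hcon
    simp only [Set.mem_union, Set.mem_iUnion, not_or, not_exists, hA₁, hA₂, hA₃, hA₄, hA₅,
      Set.mem_ofPred_eq, not_le] at hcon
    obtain ⟨h0, h1, h2, h3, h4, h5⟩ := hcon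
    exact h0 ⟨h1, h2, h3, h4, h5⟩
  have htot := measureReal_mono (μ := sampleLaw X n) hcover
  rw [probReal_univ] at htot
  have u1 := measureReal_union_le (μ := sampleLaw X n) G
    ((⋃ i, A₁ i) ∪ ((⋃ i, A₂ i) ∪ ((⋃ i, A₃ i) ∪ ((⋃ i, A₄ i) ∪ A₅))))
  have u2 := measureReal_union_le (μ := sampleLaw X n) (⋃ i, A₁ i)
    ((⋃ i, A₂ i) ∪ ((⋃ i, A₃ i) ∪ ((⋃ i, A₄ i) ∪ A₅)))
  have u3 := measureReal_union_le (μ := sampleLaw X n) (⋃ i, A₂ i)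
    ((⋃ i, A₃ i) ∪ ((⋃ i, A₄ i) ∪ A₅))
  have u4 := measureReal_union_le (μ := sampleLaw X n) (⋃ i, A₃ i) ((⋃ i, A₄ i) ∪ A₅)
  have u5 := measureReal_union_le (μ := sampleLaw X n) (⋃ i, A₄ i) A₅
  linarith

end Sampling

end KMedian

namespace KMedian

open Finset Timed

/-! ### Values of the programs of the linkage phase -/

namespace Forest

variable {P : Type}

/-- The points of all leaves. -/
def points : Forest P → List P
  | nil => []
  | leaf pts F => pts ++ F.points
  | node ch F => ch.points ++ F.points

/-- The tree of a cluster, followed by the trees in `F`. -/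
def consCluster (C : Cluster P) (F : Forest P) : Forest P :=
  match C.children with
  | .nil => .leaf C.pts F
  | .leaf pts G => .node (.leaf pts G) F
  | .node ch G => .node (.node ch G) F

theorem consCluster_of_ne_nil {C : Cluster P} {F : Forest P} (h : C.children ≠ .nil) :
    consCluster C F = .node C.children F := by
  unfold consCluster
  split <;> simp_all

end Forest

section Values

variable {P : Type} {d : P → P → ℝ} {p : P} {r b μ : ℝ}

@[simp] theorem val_inBall (x : P) : (inBall d p r x).val = true ↔ d x p ≤ r := by
  simp [inBall]

@[simp] theorem val_outBall (x : P) : (outBall d p r x).val = true ↔ r < d x p := by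
  have := val_inBall (d := d) (p := p) (r := r) x
  rw [outBall, val_bind, val_step, Bool.not_eq_true', ← Bool.not_eq_true, this, not_le]

theorem val_nearlyInside (C : Cluster P) : (nearlyInside d p r b C).val = true ↔
    ((C.pts.countP fun x => (outBall d p r x).val : ℕ) : ℝ) ≤ b ∧ ∃ x ∈ C.pts, d x p ≤ r := by
  simp [nearlyInside, List.countP_pos_iff]

theorem val_unionT (l : List (Cluster P)) : (unionT l).val = l.flatMap Cluster.pts := by
  induction l <;> simp_all [unionT]

theorem val_treesT (l : List (Cluster P)) :
    (treesT l).val = l.foldr Forest.consCluster .nil := by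
  induction l with
  | nil => simp [treesT]
  | cons C l ih =>
    simp only [treesT, val_bind, ih, List.foldr_cons, Forest.consCluster]
    split <;> simp_all

theorem val_marginViolations (ball out : List P) : (marginViolations d ball out).val =
    out.countP fun y => (existsT (fun p₁ => existsT (fun p₂ => do
      let x ← step (d p₁ p₂)
      let y ← step (d p₁ y)
      le y x) ball) ball).val := by
  simp [marginViolations]

theorem val_linkageStep (S : List P) (cl : List (Cluster P)) (q : P) :
    (linkageStep S d μ b cl (r, p, q)).val =
      let U := cl.filter fun C => (nearlyInside d p r b C).val
      let pts := U.flatMap Cluster.pts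
      open Classical in
      if μ - b ≤ pts.length ∧ ((pts.countP fun x => (outBall d p r x).val : ℕ) : ℝ) ≤ b ∧
          ((marginViolations d (S.filter fun x => (inBall d p r x).val)
            (S.filter fun x => (outBall d p r x).val)).val : ℝ) ≤ b ∧ 1 < U.length then
        ⟨pts, U.foldr Forest.consCluster .nil⟩ ::
          cl.filter fun C => !(nearlyInside d p r b C).val
      else cl := by
  simp only [linkageStep, val_bind, val_filterT, val_unionT, val_lengthT, val_countT, val_step]
  simp only [Bool.and_eq_true, val_le, decide_eq_true_eq, and_assoc]
  split_ifs
  · simp only [val_bind, val_step, val_treesT]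
  · rfl

end Values

/-! ### Geometry of a sample -/

/-- The distance of two sampled items. -/
abbrev itemDist {X P : Type*} [MetricSpace X] (ω : P → X) : P → P → ℝ :=
  fun s t => dist (ω s) (ω t)

/-- A sample `ω` with clusters `f` in which all but `b` items (those in `G`) are much closer to
the item `p i` of their own cluster than to the items `p j` of the other clusters; `q i` is an
item of `G` in cluster `i` at maximal distance to `p i`. -/
structure Separated {X P : Type*} [MetricSpace X] [Fintype P] [DecidableEq P] {k : ℕ}
    (ω : P → X) (f : P → Fin k) (p q : Fin k → P) (G : Finset P) (b μ : ℝ) : Prop where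
  sep : ∀ x ∈ G, ∀ j, j ≠ f x → 8 * dist (ω x) (ω (p (f x))) < dist (ω x) (ω (p j))
  card_compl : (#Gᶜ : ℝ) ≤ b
  size : ∀ i, μ ≤ #{x | f x = i}
  one_le : 1 ≤ b
  lt : 5 * b < μ
  mem : ∀ i, q i ∈ G
  label : ∀ i, f (q i) = i
  le : ∀ x ∈ G, dist (ω (p (f x))) (ω x) ≤ dist (ω (p (f x))) (ω (q (f x)))

namespace Separated

variable {X P : Type*} [MetricSpace X] [Fintype P] [DecidableEq P] {k : ℕ}
    {ω : P → X} {f : P → Fin k} {p q : Fin k → P} {G : Finset P} {b μ : ℝ}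

/-- Write `R` for the distance from `p i` to `q i`. As `q i` is good, the centers `p i` and `p (f
y)` are more than `7 * R` apart; as `y` is good, its distance to `p i` is at least `8 / 9` of that.
-/
theorem three_mul_lt (h : Separated ω f p q G b μ) {i : Fin k} {y : P} (hy : y ∈ G)
    (hyi : f y ≠ i) : 3 * dist (ω (p i)) (ω (q i)) < dist (ω (p i)) (ω y) := by
  have h1 := h.sep _ (h.mem i) (f y) (by rw [h.label]; exact hyi)
  rw [h.label] at h1
  have h2 := h.sep y hy i (Ne.symm hyi)
  have h3 := dist_triangle (ω (q i)) (ω (p i)) (ω (p (f y)))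
  have h4 := dist_triangle (ω (p i)) (ω y) (ω (p (f y)))
  rw [dist_comm (ω y) (ω (p i))] at h2
  rw [dist_comm (ω (q i)) (ω (p i))] at h1 h3
  have := dist_nonneg (x := ω (p i)) (y := ω (q i))
  linarith

/-- Through `g` and the center of the ball, `y` is within `R + 2 * r ≤ 3 * R` of `p i`, where `R` is
the distance from `p i` to `q i`. The ball may be centered anywhere, even at a bad item. -/
theorem label_eq_of_ball (h : Separated ω f p q G b μ) {i : Fin k} {x g y : P} {r : ℝ}
    (hr : r ≤ dist (ω (p i)) (ω (q i))) (hg : g ∈ G) (hgi : f g = i) (hgx : dist (ω g) (ω x) ≤ r)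
    (hy : y ∈ G) (hyx : dist (ω y) (ω x) ≤ r) : f y = i := by
  by_contra hyi
  have h1 := h.three_mul_lt hy hyi
  have h2 := h.le g hg
  rw [hgi] at h2
  have h3 := dist_triangle (ω (p i)) (ω g) (ω y)
  have h4 := dist_triangle (ω g) (ω x) (ω y)
  rw [dist_comm (ω x)] at h4
  linarith

/-- A good item is within a seventh of the distance `Δ` between the two centers from its own one.
Hence items of one cluster are within `2 / 7 * Δ`, and items of the two clusters more than `5 / 7 *
Δ` apart. -/
theorem dist_lt_dist (h : Separated ω f p q G b μ) {x g y : P} (hx : x ∈ G) (hg : g ∈ G)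
    (hy : y ∈ G) (hgx : f g = f x) (hyx : f y ≠ f x) :
    dist (ω x) (ω g) < dist (ω x) (ω y) := by
  have h1 := h.sep x hx (f y) hyx
  have h2 := h.sep g hg (f y) (by rwa [hgx])
  have h3 := h.sep y hy (f x) hyx.symm
  rw [hgx] at h2
  have t1 := dist_triangle (ω x) (ω (p (f x))) (ω g)
  have t2 := dist_triangle (ω x) (ω y) (ω (p (f y)))
  have t3 := dist_triangle (ω y) (ω (p (f y))) (ω (p (f x)))
  have t4 := dist_triangle (ω (p (f y))) (ω (p (f x))) (ω x)
  have t5 := dist_triangle (ω g) (ω (p (f x))) (ω (p (f y)))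
  have t6 := dist_triangle (ω x) (ω (p (f x))) (ω (p (f y)))
  have t7 := dist_triangle (ω y) (ω x) (ω (p (f x)))
  have t8 := dist_triangle (ω (p (f x))) (ω y) (ω (p (f y)))
  rw [dist_comm (ω (p (f x))) (ω g)] at t1
  rw [dist_comm (ω y) (ω x)] at t7
  rw [dist_comm (ω (p (f x))) (ω y)] at t8
  have := dist_nonneg (x := ω x) (y := ω (p (f x)))
  linarith

theorem card_sub_le (h : Separated ω f p q G b μ) (A : Finset P) :
    (#A : ℝ) - b ≤ #(A ∩ G) := by
  have h1 : #A ≤ #(A ∩ G) + #Gᶜ := by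
    rw [← card_inter_add_card_sdiff A G]
    gcongr
    intro x hx
    simp only [mem_sdiff, mem_compl] at hx ⊢
    exact hx.2
  have h2 : (#A : ℝ) ≤ #(A ∩ G) + #Gᶜ := by exact_mod_cast h1
  linarith [h.card_compl]

theorem card_le_of_disjoint (h : Separated ω f p q G b μ) {A : Finset P} (hA : ∀ x ∈ A, x ∉ G) :
    (#A : ℝ) ≤ b := by
  refine le_trans ?_ h.card_compl
  exact_mod_cast card_le_card fun x hx => mem_compl.2 (hA x hx)

theorem le_card_good (h : Separated ω f p q G b μ) (i : Fin k) :
    μ - b ≤ #{x ∈ G | f x = i} := by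
  have h1 := h.card_sub_le {x | f x = i}
  have h2 := h.size i
  have h3 : ({x | f x = i} : Finset P) ∩ G = {x ∈ G | f x = i} := by
    ext; simp [and_comm]
  rw [h3] at h1
  linarith

end Separated

end KMedian

namespace KMedian

open Finset Timed

/-! ### The tree built by the linkage phase -/

theorem countP_le_card {P : Type*} [DecidableEq P] {l : List P} (hl : l.Nodup) {t : P → Bool}
    {A : Finset P} (h : ∀ x ∈ l, t x = true → x ∈ A) : l.countP t ≤ #A := by
  rw [List.countP_eq_length_filter, ← List.toFinset_card_of_nodup (hl.filter _)]
  refine card_le_card fun x hx => ?_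
  simp only [List.mem_toFinset, List.mem_filter] at hx
  exact h x hx.1 hx.2

theorem card_le_length {P : Type*} [DecidableEq P] {l : List P} {A : Finset P}
    (h : ∀ x ∈ A, x ∈ l) : #A ≤ l.length :=
  (card_le_card fun x hx => List.mem_toFinset.2 (h x hx)).trans (List.toFinset_card_le l)

theorem eq_of_mem_of_nodup_flatMap {α β : Type*} {l : List α} {g : α → List β}
    (h : (l.flatMap g).Nodup) {a a' : α} (ha : a ∈ l) (ha' : a' ∈ l) {x : β} (hx : x ∈ g a)
    (hx' : x ∈ g a') : a = a' := by
  by_contra hne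
  have hsymm : Std.Symm (Function.onFun List.Disjoint g) := ⟨fun _ _ h => h.symm⟩
  exact (List.nodup_flatMap.1 h).2.forall ha ha' hne hx hx'

variable {X : Type*} {P : Type} [MetricSpace X] {k : ℕ}

/-- The properties of the list of points of a smallest cluster that is formed inside
the target cluster `i`. -/
structure IsCoreLeaf (ω : P → X) (f : P → Fin k) (G : Finset P) (b μ : ℝ) (i : Fin k)
    (L : List P) : Prop where
  label : ∀ x ∈ L, x ∈ G → f x = i
  size : μ - b ≤ L.length
  nodup : L.Nodup
  margin : ∃ E : Finset P, (#E : ℝ) ≤ b ∧ ∀ x ∈ L, ∀ g ∈ L, ∀ y ∈ G, f y ≠ i → y ∉ E →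
    itemDist ω x g < itemDist ω x y

/-- If all trees in `F` are leaves, then their points form a smallest cluster inside the target
cluster `i`. -/
def IsCore (ω : P → X) (f : P → Fin k) (G : Finset P) (b μ : ℝ) (i : Fin k) (F : Forest P) :
    Prop :=
  ∀ l, (onlyLeaves F).val = some l → IsCoreLeaf ω f G b μ i l

/-- The trees in the forest have only single points as leaves and were formed inside the target
cluster `i`. -/
inductive IsPure (ω : P → X) (f : P → Fin k) (G : Finset P) (b μ : ℝ) (i : Fin k) :
    Forest P → Prop
  | nil : IsPure ω f G b μ i .nil
  | leaf {x : P} {F : Forest P} : (x ∈ G → f x = i) → IsPure ω f G b μ i F →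
      IsPure ω f G b μ i (.leaf [x] F)
  | node {ch F : Forest P} : IsPure ω f G b μ i ch → IsCore ω f G b μ i ch →
      IsPure ω f G b μ i F → IsPure ω f G b μ i (.node ch F)

/-- Every tree in the forest is a single point outside `G`, or was formed inside a target
cluster all of whose points in `G` it contains, or consists of such trees. -/
inductive IsUpper (ω : P → X) (f : P → Fin k) (G : Finset P) (b μ : ℝ) : Forest P → Prop
  | nil : IsUpper ω f G b μ .nil
  | leaf {x : P} {F : Forest P} : x ∉ G → IsUpper ω f G b μ F → IsUpper ω f G b μ (.leaf [x] F)
  | body {ch F : Forest P} (i : Fin k) : IsPure ω f G b μ i ch → IsCore ω f G b μ i ch →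
      (∀ g ∈ G, f g = i → g ∈ ch.points) → IsUpper ω f G b μ F → IsUpper ω f G b μ (.node ch F)
  | node {ch F : Forest P} : IsUpper ω f G b μ ch → (onlyLeaves ch).val = none →
      IsUpper ω f G b μ F → IsUpper ω f G b μ (.node ch F)

/-- A cluster of a single point. -/
def IsSingle (C : Cluster P) : Prop := ∃ x, C = ⟨[x], .nil⟩

/-- A merged cluster: its points are those of its tree. -/
structure IsMerged (b μ : ℝ) (C : Cluster P) : Prop where
  pts_eq : C.pts = C.children.points
  size : μ - b ≤ C.pts.length
  ne_nil : C.children ≠ .nil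

structure IsPureCluster (ω : P → X) (f : P → Fin k) (G : Finset P) (b μ : ℝ) (i : Fin k)
    (C : Cluster P) : Prop extends IsMerged b μ C where
  pure : IsPure ω f G b μ i C.children
  core : IsCore ω f G b μ i C.children

/-- The last field keeps the node internal under `collapse`, so no leaf of the cleaned tree mixes
several targets. -/
structure IsUpperCluster (ω : P → X) (f : P → Fin k) (G : Finset P) (b μ : ℝ)
    (C : Cluster P) : Prop extends IsMerged b μ C where
  upper : IsUpper ω f G b μ C.children
  not_onlyLeaves : (onlyLeaves C.children).val = none

/-- The invariant of the linkage phase while pairs at distance at most `r` are processed. -/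
structure LinkageInv (ω : P → X) (f : P → Fin k) (p q : Fin k → P) (G : Finset P) (b μ : ℝ)
    (S : List P) (r : ℝ) (cl : List (Cluster P)) : Prop where
  perm : (cl.flatMap Cluster.pts).Perm S
  shape : ∀ C ∈ cl, IsSingle C ∨ (∃ i, IsPureCluster ω f G b μ i C) ∨ IsUpperCluster ω f G b μ C
  pure : ∀ i, r ≤ itemDist ω (p i) (q i) → ∀ C ∈ cl, (∃ g ∈ C.pts, g ∈ G ∧ f g = i) →
    IsSingle C ∨ IsPureCluster ω f G b μ i C

/-- Some cluster contains all points in `G` of the target cluster `i`. -/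
def IsDone (f : P → Fin k) (G : Finset P) (i : Fin k) (cl : List (Cluster P)) : Prop :=
  ∃ C ∈ cl, ∀ g ∈ G, f g = i → g ∈ C.pts

variable {ω : P → X} {f : P → Fin k} {p q : Fin k → P} {G : Finset P} {b μ : ℝ} {S : List P}

theorem IsPure.label {i : Fin k} {F : Forest P} (h : IsPure ω f G b μ i F) :
    ∀ x ∈ F.points, x ∈ G → f x = i := by
  induction h with
  | nil => simp [Forest.points]
  | leaf hx _ ih =>
    intro y hy hyG
    simp only [Forest.points, List.mem_append, List.mem_singleton] at hy
    rcases hy with rfl | hy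
    exacts [hx hyG, ih y hy hyG]
  | node _ _ _ ih1 ih2 =>
    intro y hy hyG
    simp only [Forest.points, List.mem_append] at hy
    rcases hy with hy | hy
    exacts [ih1 y hy hyG, ih2 y hy hyG]

theorem IsPureCluster.label {i : Fin k} {C : Cluster P} (h : IsPureCluster ω f G b μ i C) :
    ∀ x ∈ C.pts, x ∈ G → f x = i := by
  rw [h.pts_eq]
  exact h.pure.label

theorem foldr_consCluster_points {U : List (Cluster P)}
    (h : ∀ C ∈ U, IsSingle C ∨ IsMerged b μ C) :
    (U.foldr Forest.consCluster .nil).points = U.flatMap Cluster.pts := by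
  induction U with
  | nil => rfl
  | cons C U ih =>
    simp only [List.mem_cons, forall_eq_or_imp] at h
    simp only [List.foldr_cons, List.flatMap_cons]
    rcases h.1 with ⟨x, rfl⟩ | hC
    · simp [Forest.consCluster, Forest.points, ih h.2]
    · rw [Forest.consCluster_of_ne_nil hC.ne_nil, Forest.points, ih h.2, ← hC.pts_eq]

theorem foldr_consCluster_ne_nil {U : List (Cluster P)} (h : U ≠ []) :
    U.foldr Forest.consCluster .nil ≠ .nil := by
  cases U with
  | nil => exact absurd rfl h
  | cons C U =>
    simp only [List.foldr_cons, Forest.consCluster]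
    split <;> simp

/-- Merged clusters enter the tree as internal nodes, so a forest of leaves comes from singletons
alone. -/
theorem onlyLeaves_foldr_consCluster {U : List (Cluster P)}
    (h : ∀ C ∈ U, IsSingle C ∨ IsMerged b μ C) {l : List P}
    (hl : (onlyLeaves (U.foldr Forest.consCluster .nil)).val = some l) :
    (∀ C ∈ U, IsSingle C) ∧ l = U.flatMap Cluster.pts := by
  induction U generalizing l with
  | nil => simpa [onlyLeaves, eq_comm] using hl
  | cons C U ih =>
    simp only [List.mem_cons, forall_eq_or_imp] at h ⊢
    rw [List.foldr_cons] at hl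
    rcases h.1 with ⟨x, rfl⟩ | hC
    · simp only [Forest.consCluster, onlyLeaves, val_bind] at hl
      cases hr : (onlyLeaves (U.foldr Forest.consCluster .nil)).val with
      | none => simp [hr] at hl
      | some l' =>
        obtain ⟨h1, h2⟩ := ih h.2 hr
        simp [hr] at hl
        exact ⟨⟨⟨x, rfl⟩, h1⟩, by simp [← hl, h2]⟩
    · rw [Forest.consCluster_of_ne_nil hC.ne_nil] at hl
      simp [onlyLeaves] at hl

theorem isPure_foldr_consCluster {i : Fin k} {U : List (Cluster P)}
    (h : ∀ C ∈ U, (IsSingle C ∧ ∀ x ∈ C.pts, x ∈ G → f x = i) ∨ IsPureCluster ω f G b μ i C) :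
    IsPure ω f G b μ i (U.foldr Forest.consCluster .nil) := by
  induction U with
  | nil => exact .nil
  | cons C U ih =>
    simp only [List.mem_cons, forall_eq_or_imp] at h
    rw [List.foldr_cons]
    rcases h.1 with ⟨⟨x, rfl⟩, hx⟩ | hC
    · exact .leaf (hx x (by simp)) (ih h.2)
    · rw [Forest.consCluster_of_ne_nil hC.ne_nil]
      exact .node hC.pure hC.core (ih h.2)

namespace LinkageInv

theorem mono {r r' : ℝ} {cl : List (Cluster P)} (h : LinkageInv ω f p q G b μ S r cl)
    (hr : r ≤ r') : LinkageInv ω f p q G b μ S r' cl :=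
  ⟨h.perm, h.shape, fun i hi => h.pure i (hr.trans hi)⟩

theorem single_or_merged {r : ℝ} {cl : List (Cluster P)}
    (h : LinkageInv ω f p q G b μ S r cl) {C : Cluster P} (hC : C ∈ cl) :
    IsSingle C ∨ IsMerged b μ C := by
  rcases h.shape C hC with h1 | ⟨i, h1⟩ | h1
  exacts [Or.inl h1, Or.inr h1.toIsMerged, Or.inr h1.toIsMerged]

theorem nodup {r : ℝ} {cl : List (Cluster P)} (h : LinkageInv ω f p q G b μ S r cl)
    (hS : S.Nodup) : (cl.flatMap Cluster.pts).Nodup :=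
  h.perm.nodup_iff.2 hS

theorem nodup_pts {r : ℝ} {cl : List (Cluster P)} (h : LinkageInv ω f p q G b μ S r cl)
    (hS : S.Nodup) {C : Cluster P} (hC : C ∈ cl) : C.pts.Nodup :=
  (List.nodup_flatMap.1 (h.nodup hS)).1 C hC

end LinkageInv

theorem flatMap_filter_perm (cl : List (Cluster P)) (t : Cluster P → Bool) :
    ((cl.filter t).flatMap Cluster.pts ++
      (cl.filter fun C => !t C).flatMap Cluster.pts).Perm (cl.flatMap Cluster.pts) := by
  rw [← List.flatMap_append]
  exact (List.filter_append_perm t cl).flatMap_right _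

variable [DecidableEq P]

/-- The violators found by the program serve as the exceptional set of the margin condition. -/
theorem marginViolations_spec {r : ℝ} {p₀ : P} (hmem : ∀ x, x ∈ S)
    (h : ((marginViolations (itemDist ω) (S.filter fun x => (inBall (itemDist ω) p₀ r x).val)
      (S.filter fun x => (outBall (itemDist ω) p₀ r x).val)).val : ℝ) ≤ b) :
    ∃ E : Finset P, (#E : ℝ) ≤ b ∧ ∀ y, r < itemDist ω y p₀ → y ∉ E → ∀ p₁ p₂,
      itemDist ω p₁ p₀ ≤ r → itemDist ω p₂ p₀ ≤ r → itemDist ω p₁ p₂ < itemDist ω p₁ y := by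
  rw [val_marginViolations, List.countP_eq_length_filter] at h
  refine ⟨_, le_trans (by exact_mod_cast List.toFinset_card_le _) h, ?_⟩
  intro y hy hyE p₁ p₂ h1 h2
  simp only [List.mem_toFinset, List.mem_filter, val_existsT, val_bind, val_step, val_le,
    val_inBall, val_outBall, hmem, true_and, not_and, not_exists, not_le] at hyE
  exact hyE hy p₁ h1 p₂ h2

theorem marginViolations_le {r : ℝ} {p₀ : P} (hS : S.Nodup) {A : Finset P}
    (h : ∀ y p₁ p₂, r < itemDist ω y p₀ → itemDist ω p₁ p₀ ≤ r → itemDist ω p₂ p₀ ≤ r →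
      itemDist ω p₁ y ≤ itemDist ω p₁ p₂ → y ∈ A) :
    (marginViolations (itemDist ω) (S.filter fun x => (inBall (itemDist ω) p₀ r x).val)
      (S.filter fun x => (outBall (itemDist ω) p₀ r x).val)).val ≤ #A := by
  rw [val_marginViolations]
  refine countP_le_card (hS.filter _) fun y hy ht => ?_
  simp only [List.mem_filter, val_existsT, val_bind, val_step, val_le,
    val_inBall, val_outBall] at hy ht
  obtain ⟨p₁, ⟨-, h1⟩, p₂, ⟨-, h2⟩, h3⟩ := ht
  exact h y p₁ p₂ hy.2 h1 h2 h3

variable [Fintype P]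

/-- A merged cluster with at most `b` points outside a ball has a point of `G` in the ball. -/
theorem Separated.exists_good_of_merged (h : Separated ω f p q G b μ) {C : Cluster P}
    (hC : IsMerged b μ C) (hnd : C.pts.Nodup) {t : P → Bool}
    (ht : ((C.pts.countP t : ℕ) : ℝ) ≤ b) : ∃ g ∈ C.pts, g ∈ G ∧ t g = false := by
  by_contra! hcon
  have h1 : C.pts.length ≤ C.pts.countP t + C.pts.countP (fun x => !t x) := by
    have := List.length_eq_countP_add_countP (l := C.pts) (p := t)
    simp only [Bool.not_eq_true, Bool.decide_eq_false] at this
    exact this.le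
  have h2 : C.pts.countP (fun x => !t x) ≤ #Gᶜ := by
    refine countP_le_card hnd fun x hx hxt => mem_compl.2 fun hxG => ?_
    exact hcon x hx hxG (by simpa using hxt)
  have h3 : (C.pts.length : ℝ) ≤ C.pts.countP t + #Gᶜ := by exact_mod_cast h1.trans (by omega)
  linarith [hC.size, h.lt, h.card_compl, h.one_le]

/-- If every target met by `V` is complete, a cluster with a good item holds the whole good part of
that target, at least `μ - b > 1` items. So it is no singleton, and a pure one is a full body. -/
theorem Separated.isUpper_foldr_consCluster (h : Separated ω f p q G b μ)
    {cl V : List (Cluster P)} {r : ℝ} (hS : S.Nodup) (hcl : LinkageInv ω f p q G b μ S r cl)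
    (hV : ∀ C ∈ V, C ∈ cl) (hdone : ∀ i, (∃ C ∈ V, ∃ g ∈ C.pts, g ∈ G ∧ f g = i) →
      IsDone f G i cl) : IsUpper ω f G b μ (V.foldr Forest.consCluster .nil) ∧
      ∀ C ∈ V, IsSingle C → ∀ x ∈ C.pts, x ∉ G := by
  have hsing : ∀ C ∈ V, IsSingle C → ∀ x ∈ C.pts, x ∉ G := by
    intro C hC ⟨x', hx'⟩ x hx hxG
    obtain ⟨C₀, hC₀, hall⟩ := hdone (f x) ⟨C, hC, x, hx, hxG, rfl⟩
    have := eq_of_mem_of_nodup_flatMap (hcl.nodup hS) hC₀ (hV C hC) (hall x hxG rfl) hx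
    subst this
    have h1 := card_le_length (A := {y ∈ G | f y = f x}) (l := C₀.pts)
      fun y hy => hall y (mem_filter.1 hy).1 (mem_filter.1 hy).2
    rw [hx'] at h1
    have h2 : (#{y ∈ G | f y = f x} : ℝ) ≤ 1 := by exact_mod_cast h1
    linarith [h.le_card_good (f x), h.lt, h.one_le]
  refine ⟨?_, hsing⟩
  induction V with
  | nil => exact .nil
  | cons C V ih =>
    simp only [List.mem_cons, forall_eq_or_imp] at hV hsing hdone
    specialize ih hV.2 (fun i hi => hdone i (by
      obtain ⟨C', hC', hg⟩ := hi
      exact ⟨C', Or.inr hC', hg⟩)) hsing.2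
    rw [List.foldr_cons]
    rcases hcl.shape C hV.1 with hC | ⟨i, hC⟩ | hC
    · have h1 := hsing.1 hC
      obtain ⟨x, rfl⟩ := hC
      exact .leaf (h1 x (by simp)) ih
    · rw [Forest.consCluster_of_ne_nil hC.ne_nil]
      refine .body i hC.pure hC.core ?_ ih
      obtain ⟨g, hg, hgG, -⟩ := h.exists_good_of_merged hC.toIsMerged
        (hcl.nodup_pts hS hV.1) (t := fun _ => false) (by simpa using by linarith [h.one_le])
      obtain ⟨C₀, hC₀, hall⟩ := hdone i ⟨C, Or.inl rfl, g, hg, hgG, hC.label g hg hgG⟩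
      have := eq_of_mem_of_nodup_flatMap (hcl.nodup hS) hC₀ hV.1
        (hall g hgG (hC.label g hg hgG)) hg
      rw [← hC.pts_eq, ← this]
      exact hall
    · rw [Forest.consCluster_of_ne_nil hC.ne_nil]
      exact .node hC.upper hC.not_onlyLeaves ih

/-- A single pair is processed. -/
theorem Separated.linkageStep (h : Separated ω f p q G b μ) {cl : List (Cluster P)} {r₀ r : ℝ}
    {p₀ q₀ : P} (hS : S.Nodup) (hmem : ∀ x, x ∈ S) (hcl : LinkageInv ω f p q G b μ S r₀ cl)
    (hr : r₀ ≤ r) (hdone : ∀ i, itemDist ω (p i) (q i) < r → IsDone f G i cl) :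
    LinkageInv ω f p q G b μ S r (KMedian.linkageStep S (itemDist ω) μ b cl (r, p₀, q₀)).val ∧
      (∀ i, IsDone f G i cl →
        IsDone f G i (KMedian.linkageStep S (itemDist ω) μ b cl (r, p₀, q₀)).val) ∧
      ∀ i, r = itemDist ω (p i) (q i) → p₀ = p i →
        IsDone f G i (KMedian.linkageStep S (itemDist ω) μ b cl (r, p₀, q₀)).val := by
  classical
  replace hcl := hcl.mono hr
  rw [val_linkageStep]
  set U := cl.filter fun C => (nearlyInside (itemDist ω) p₀ r b C).val with hU
  have hUmem : ∀ C, C ∈ U ↔ C ∈ cl ∧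
      ((C.pts.countP fun x => (outBall (itemDist ω) p₀ r x).val : ℕ) : ℝ) ≤ b ∧
        ∃ x ∈ C.pts, itemDist ω x p₀ ≤ r := fun C => by
    rw [hU, List.mem_filter, val_nearlyInside]
  have hUcl : ∀ C ∈ U, C ∈ cl := fun C hC => ((hUmem C).1 hC).1
  have hball : ∀ C ∈ U, IsMerged b μ C → ∃ g ∈ C.pts, g ∈ G ∧ itemDist ω g p₀ ≤ r := by
    intro C hC hm
    obtain ⟨h1, h2, -⟩ := (hUmem C).1 hC
    obtain ⟨g, hg, hgG, hgt⟩ := h.exists_good_of_merged hm (hcl.nodup_pts hS h1) h2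
    refine ⟨g, hg, hgG, ?_⟩
    rw [← Bool.not_eq_true, val_outBall, not_lt] at hgt
    exact hgt
  have hsingle : ∀ C ∈ U, IsSingle C → ∀ x ∈ C.pts, itemDist ω x p₀ ≤ r := by
    rintro C hC ⟨y, rfl⟩ x hx
    obtain ⟨-, -, z, hz, hzr⟩ := (hUmem _).1 hC
    simp only [List.mem_singleton] at hx hz
    rwa [hx, ← hz]
  have hUnd : (U.flatMap Cluster.pts).Nodup :=
    ((flatMap_filter_perm cl _).nodup_iff.2 (hcl.nodup hS)).of_append_left
  have hsm : ∀ C ∈ U, IsSingle C ∨ IsMerged b μ C :=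
    fun C hC => hcl.single_or_merged (hUcl C hC)
  -- processing `(p i, q i)` makes cluster `i` complete
  have hentry : ∀ i, r = itemDist ω (p i) (q i) → p₀ = p i →
      (∀ C ∈ cl, (∃ g ∈ C.pts, g ∈ G ∧ f g = i) → C ∈ U) ∧
      μ - b ≤ (U.flatMap Cluster.pts).length ∧
      (((U.flatMap Cluster.pts).countP fun x => (outBall (itemDist ω) p₀ r x).val : ℕ) : ℝ) ≤ b ∧
      ((marginViolations (itemDist ω) (S.filter fun x => (inBall (itemDist ω) p₀ r x).val)
            (S.filter fun x => (outBall (itemDist ω) p₀ r x).val)).val : ℝ) ≤ b := by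
    intro i hri hp₀
    -- The ball contains the good part of cluster `i` by the choice of `q i`, while all other good
    -- items are more than three radii away.
    have hin : ∀ g ∈ G, f g = i → itemDist ω g p₀ ≤ r := by
      intro g hg hgi
      have := h.le g hg
      rw [hgi] at this
      rw [hri, hp₀]
      simpa [itemDist, dist_comm] using this
    have hout : ∀ y ∈ G, f y ≠ i → 3 * r < itemDist ω y p₀ := by
      intro y hy hyi
      have := h.three_mul_lt hy hyi
      rw [hri, hp₀]
      simpa [itemDist, dist_comm (ω y)] using this
    have hr0 : 0 ≤ r := hri ▸ dist_nonneg
    have hpureOut : ∀ C ∈ cl, (∃ g ∈ C.pts, g ∈ G ∧ f g = i) → ∀ x ∈ C.pts,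
        r < itemDist ω x p₀ → x ∉ G := by
      intro C hC hg x hx hxr hxG
      refine hxr.not_ge (hin x hxG ?_)
      rcases hcl.pure i hri.le C hC hg with ⟨y, rfl⟩ | hp
      · obtain ⟨g, hg, -, hgi⟩ := hg
        simp only [List.mem_singleton] at hg hx
        rw [hx, ← hg, hgi]
      · exact hp.label x hx hxG
    -- What sticks out of the ball is bad, hence at most `b` items; so every cluster that meets the
    -- good part of target `i` is selected.
    have hA : ∀ C ∈ cl, (∃ g ∈ C.pts, g ∈ G ∧ f g = i) → C ∈ U := by
      intro C hC hg
      refine (hUmem C).2 ⟨hC, le_trans ?_ h.card_compl, ?_⟩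
      · exact_mod_cast countP_le_card (hcl.nodup_pts hS hC) fun x hx hxt =>
          mem_compl.2 (hpureOut C hC hg x hx ((val_outBall x).1 hxt))
      · obtain ⟨g, hg, hgG, hgi⟩ := hg
        exact ⟨g, hg, hin g hgG hgi⟩
    refine ⟨hA, ?_, ?_, ?_⟩
    · refine (h.le_card_good i).trans ?_
      exact_mod_cast card_le_length fun g hg => by
        obtain ⟨hgG, hgi⟩ := mem_filter.1 hg
        obtain ⟨C, hC, hgC⟩ := List.mem_flatMap.1 (hcl.perm.mem_iff.2 (hmem g))
        exact List.mem_flatMap.2 ⟨C, hA C hC ⟨g, hgC, hgG, hgi⟩, hgC⟩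
    · refine le_trans ?_ h.card_compl
      refine Nat.cast_le.2 (countP_le_card hUnd fun x hx hxt => mem_compl.2 ?_)
      rw [val_outBall] at hxt
      obtain ⟨C, hC, hxC⟩ := List.mem_flatMap.1 hx
      rcases hsm C hC with hC' | hC'
      · exact absurd (hsingle C hC hC' x hxC) hxt.not_ge
      · obtain ⟨g, hg, hgG, hgr⟩ := hball C hC hC'
        refine hpureOut C (hUcl C hC) ⟨g, hg, hgG, ?_⟩ x hxC hxt
        by_contra hgi
        linarith [hout g hgG hgi]
    -- Two items of the ball are at most `2 * r` apart, and a good item outside is more than `3 * r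
    -- - r` from either. So only bad items violate the margin.
    · refine le_trans (Nat.cast_le.2 (marginViolations_le hS (A := Gᶜ) ?_)) h.card_compl
      intro y p₁ p₂ hy h1 h2 h3
      rw [mem_compl]
      intro hyG
      have hyi : f y ≠ i := fun hyi => hy.not_ge (hin y hyG hyi)
      have h4 := hout y hyG hyi
      have h5 := dist_triangle (ω y) (ω p₁) (ω p₀)
      have h6 := dist_triangle (ω p₁) (ω p₀) (ω p₂)
      rw [dist_comm (ω p₀) (ω p₂)] at h6
      rw [dist_comm (ω y) (ω p₁)] at h5
      simp only [itemDist] at *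
      linarith
  dsimp only
  split_ifs with hcond
  swap
  -- If `(p i, q i)` causes no merge, only `|U| > 1` can have failed; then a single cluster holds
  -- the good part already.
  · refine ⟨hcl, fun i hi => hi, fun i hri hp₀ => ?_⟩
    obtain ⟨h1, h2, h3, h4⟩ := hentry i hri hp₀
    have hlen : ¬ 1 < U.length := fun hlt => hcond ⟨h2, h3, h4, hlt⟩
    obtain ⟨C, hC, hgC⟩ := List.mem_flatMap.1 (hcl.perm.mem_iff.2 (hmem (q i)))
    refine ⟨C, hC, fun g hg hgi => ?_⟩
    obtain ⟨C', hC', hgC'⟩ := List.mem_flatMap.1 (hcl.perm.mem_iff.2 (hmem g))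
    have m1 := h1 C hC ⟨q i, hgC, h.mem i, h.label i⟩
    have m2 := h1 C' hC' ⟨g, hgC', hg, hgi⟩
    obtain ⟨C₁, hC₁⟩ : ∃ C₁, U = [C₁] := by
      rw [← List.length_eq_one_iff]
      have := List.length_pos_of_mem m1
      omega
    rw [hC₁, List.mem_singleton] at m1 m2
    rwa [m1, ← m2]
  · obtain ⟨c1, c2, c3, c4⟩ := hcond
    set C' : Cluster P := ⟨U.flatMap Cluster.pts, U.foldr Forest.consCluster .nil⟩ with hC'
    set rest := cl.filter fun C => !(nearlyInside (itemDist ω) p₀ r b C).val with hrest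
    have hrestcl : ∀ C ∈ rest, C ∈ cl := fun C hC => (List.mem_filter.1 hC).1
    have hmerged : IsMerged b μ C' :=
      ⟨(foldr_consCluster_points hsm).symm, c1,
        foldr_consCluster_ne_nil (by rintro h0; simp [h0] at c4)⟩
    have hmono : ∀ i, IsDone f G i cl → IsDone f G i (C' :: rest) := by
      rintro i ⟨C, hC, hall⟩
      by_cases hCU : C ∈ U
      · exact ⟨C', List.mem_cons_self, fun g hg hgi =>
          List.mem_flatMap.2 ⟨C, hCU, hall g hg hgi⟩⟩
      · refine ⟨C, List.mem_cons_of_mem _ (List.mem_filter.2 ⟨hC, ?_⟩), hall⟩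
        rw [hU, List.mem_filter] at hCU
        simpa [hC] using hCU
    have hdone' : ∀ i, r = itemDist ω (p i) (q i) → p₀ = p i → IsDone f G i (C' :: rest) := by
      intro i hri hp₀
      refine ⟨C', List.mem_cons_self, fun g hg hgi => ?_⟩
      obtain ⟨C, hC, hgC⟩ := List.mem_flatMap.1 (hcl.perm.mem_iff.2 (hmem g))
      exact List.mem_flatMap.2 ⟨C, (hentry i hri hp₀).1 C hC ⟨g, hgC, hg, hgi⟩, hgC⟩
    -- The new cluster is either pure for a target whose radius is not yet exceeded, or its good
    -- items all belong to targets whose radius is exceeded.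
    suffices hsh : (∃ i, r ≤ itemDist ω (p i) (q i) ∧ IsPureCluster ω f G b μ i C') ∨
        (IsUpperCluster ω f G b μ C' ∧
          ∀ g ∈ C'.pts, g ∈ G → ¬ r ≤ itemDist ω (p (f g)) (q (f g))) by
      refine ⟨⟨?_, ?_, ?_⟩, hmono, hdone'⟩
      · exact (flatMap_filter_perm cl _).trans hcl.perm
      · intro C hC
        rcases List.mem_cons.1 hC with rfl | hC
        · rcases hsh with ⟨i, -, hi⟩ | ⟨hi, -⟩
          exacts [Or.inr (Or.inl ⟨i, hi⟩), Or.inr (Or.inr hi)]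
        · exact hcl.shape C (hrestcl C hC)
      · intro i hi C hC hg
        rcases List.mem_cons.1 hC with rfl | hC
        · obtain ⟨g, hg, hgG, rfl⟩ := hg
          rcases hsh with ⟨j, -, hj⟩ | ⟨-, hj⟩
          · rw [hj.label g hg hgG]
            exact Or.inr hj
          · exact absurd hi (hj g hg hgG)
        · exact hcl.pure i hi C (hrestcl C hC) hg
    by_cases hcase : ∃ g ∈ C'.pts, g ∈ G ∧ r ≤ itemDist ω (p (f g)) (q (f g))
    · left
      obtain ⟨g, hg, hgG, hgr⟩ := hcase
      refine ⟨f g, hgr, hmerged, ?_, ?_⟩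
      -- Even if `g` lies outside the ball, its cluster is pure and has a good item `g'` of the same
      -- target inside. This fixes the label of all good items in the ball.
      all_goals
        obtain ⟨g', hg'G, hg'i, hg'r⟩ :
            ∃ g', g' ∈ G ∧ f g' = f g ∧ itemDist ω g' p₀ ≤ r := by
          obtain ⟨C, hC, hgC⟩ := List.mem_flatMap.1 hg
          rcases hcl.pure (f g) hgr C (hUcl C hC) ⟨g, hgC, hgG, rfl⟩ with hs | hp
          · exact ⟨g, hgG, rfl, hsingle C hC hs g hgC⟩
          · obtain ⟨g', hg', hg'G, hg'r⟩ := hball C hC hp.toIsMerged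
            exact ⟨g', hg'G, hp.label g' hg' hg'G, hg'r⟩
        have hlab : ∀ y ∈ G, itemDist ω y p₀ ≤ r → f y = f g := fun y hy hyr =>
          h.label_eq_of_ball hgr hg'G hg'i hg'r hy hyr
        have hUall : ∀ C ∈ U, (IsSingle C ∧ ∀ x ∈ C.pts, x ∈ G → f x = f g) ∨
            IsPureCluster ω f G b μ (f g) C := by
          intro C hC
          rcases hsm C hC with hs | hm
          · exact Or.inl ⟨hs, fun x hx hxG => hlab x hxG (hsingle C hC hs x hx)⟩
          · obtain ⟨g₁, hg₁, hg₁G, hg₁r⟩ := hball C hC hm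
            have hg₁i := hlab g₁ hg₁G hg₁r
            rcases hcl.pure (f g) hgr C (hUcl C hC) ⟨g₁, hg₁, hg₁G, hg₁i⟩ with hs | hp
            · exact Or.inl ⟨hs, fun x hx hxG => hlab x hxG (hsingle C hC hs x hx)⟩
            · exact Or.inr hp
      · exact isPure_foldr_consCluster hUall
      -- In a merge of singletons every item, good or bad, lies in the ball, so the margin condition
      -- just tested applies to all of them.
      · intro l hl
        obtain ⟨hs, rfl⟩ := onlyLeaves_foldr_consCluster hsm hl
        have hlb : ∀ x ∈ U.flatMap Cluster.pts, itemDist ω x p₀ ≤ r := by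
          intro x hx
          obtain ⟨C, hC, hxC⟩ := List.mem_flatMap.1 hx
          exact hsingle C hC (hs C hC) x hxC
        refine ⟨fun x hx hxG => hlab x hxG (hlb x hx), c1, hUnd, ?_⟩
        obtain ⟨E, hE, hEm⟩ := marginViolations_spec hmem c3
        refine ⟨E, hE, fun x hx g₁ hg₁ y hy hyi hyE => ?_⟩
        refine hEm y ?_ hyE x g₁ (hlb x hx) (hlb g₁ hg₁)
        by_contra! hle
        exact hyi (hlab y hy hle)
    · right
      push Not at hcase
      have hdn : ∀ i, (∃ C ∈ U, ∃ g ∈ C.pts, g ∈ G ∧ f g = i) → IsDone f G i cl := by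
        rintro i ⟨C, hC, g, hg, hgG, rfl⟩
        exact hdone _ (hcase g (List.mem_flatMap.2 ⟨C, hC, hg⟩) hgG)
      obtain ⟨hup, hbad⟩ := h.isUpper_foldr_consCluster hS hcl hUcl hdn
      refine ⟨⟨hmerged, hup, ?_⟩, fun g hg hgG => (hcase g hg hgG).not_ge⟩
      -- A merge of singletons over completed targets would have bad items only: at most `b`, fewer
      -- than the required `μ - b`.
      rw [Option.eq_none_iff_forall_ne_some]
      intro l hl
      obtain ⟨hs, -⟩ := onlyLeaves_foldr_consCluster hsm hl
      have hb : ∀ x ∈ (U.flatMap Cluster.pts).toFinset, x ∉ G := by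
        intro x hx
        obtain ⟨C, hC, hxC⟩ := List.mem_flatMap.1 (List.mem_toFinset.1 hx)
        exact hbad C hC (hs C hC) x hxC
      have := h.card_le_of_disjoint hb
      rw [List.toFinset_card_of_nodup hUnd] at this
      linarith [h.lt, h.one_le]

/-- In ascending order a pending pair `(p i, q i)` has at least the current radius. Hence targets of
smaller radius are complete, as a single step requires. -/
theorem Separated.foldl_linkageStep (h : Separated ω f p q G b μ) (hS : S.Nodup)
    (hmem : ∀ x, x ∈ S) (l : List (ℝ × P × P)) (hl : l.Pairwise fun x y => x.1 ≤ y.1)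
    {cl : List (Cluster P)} {r₀ : ℝ} (hcl : LinkageInv ω f p q G b μ S r₀ cl)
    (hr : ∀ x ∈ l, r₀ ≤ x.1)
    (hdone : ∀ i, IsDone f G i cl ∨ (itemDist ω (p i) (q i), p i, q i) ∈ l) :
    ∃ r, LinkageInv ω f p q G b μ S r
      (l.foldl (fun cl pq => (KMedian.linkageStep S (itemDist ω) μ b cl pq).val) cl) ∧
      ∀ i, IsDone f G i
        (l.foldl (fun cl pq => (KMedian.linkageStep S (itemDist ω) μ b cl pq).val) cl) := by
  induction l generalizing cl r₀ with
  | nil => exact ⟨r₀, hcl, fun i => by simpa using hdone i⟩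
  | cons a l ih =>
    obtain ⟨r, p₀, q₀⟩ := a
    rw [List.pairwise_cons] at hl
    obtain ⟨h1, h2, h3⟩ := h.linkageStep (p₀ := p₀) (q₀ := q₀) hS hmem hcl
      (hr _ List.mem_cons_self) (r := r) fun i hi => by
        rcases hdone i with hd | hd
        · exact hd
        · rcases List.mem_cons.1 hd with hd | hd
          · simp only [Prod.mk.injEq] at hd
            exact absurd hd.1 hi.ne
          · exact absurd (hl.1 _ hd) hi.not_ge
    refine ih hl.2 h1 (fun x hx => hl.1 x hx) fun i => ?_
    rcases hdone i with hd | hd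
    · exact Or.inl (h2 i hd)
    · rcases List.mem_cons.1 hd with hd | hd
      · simp only [Prod.mk.injEq] at hd
        exact Or.inl (h3 i hd.1.symm hd.2.1.symm)
      · exact Or.inr hd

/-- The tree built by the linkage phase. -/
theorem Separated.linkagePhase (h : Separated ω f p q G b μ) (hS : S.Nodup)
    (hmem : ∀ x, x ∈ S) :
    IsUpper ω f G b μ (KMedian.linkagePhase S (itemDist ω) μ b).val ∧
      (KMedian.linkagePhase S (itemDist ω) μ b).val.points.Perm S := by
  simp only [KMedian.linkagePhase, val_bind, val_pairsT, val_mapT, val_step, val_foldlT,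
    val_treesT]
  set l := (sortT ((S ×ˢ S).map fun pq => (itemDist ω pq.1 pq.2, pq))).val with hl
  have hlp := val_sortT ((S ×ˢ S).map fun pq => (itemDist ω pq.1 pq.2, pq))
  rw [← hl] at hlp
  obtain ⟨r, hinv, hdone⟩ := h.foldl_linkageStep hS hmem l (pairwise_sortT _)
    (cl := S.map fun p => Cluster.mk [p] .nil) (r₀ := 0)
    ⟨by simp [List.flatMap_map], fun C hC => by
      obtain ⟨x, -, rfl⟩ := List.mem_map.1 hC
      exact Or.inl ⟨x, rfl⟩, fun i _ C hC _ => by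
      obtain ⟨x, -, rfl⟩ := List.mem_map.1 hC
      exact Or.inl ⟨x, rfl⟩⟩
    (fun x hx => by
      obtain ⟨y, -, rfl⟩ := List.mem_map.1 (hlp.subset hx)
      exact dist_nonneg)
    (fun i => Or.inr (hlp.symm.subset (List.mem_map.2 ⟨(p i, q i), by
      simp [hmem], rfl⟩)))
  refine ⟨(h.isUpper_foldr_consCluster hS hinv (fun C hC => hC) fun i _ => hdone i).1, ?_⟩
  rw [foldr_consCluster_points fun C hC => hinv.single_or_merged hC]
  exact hinv.perm

end KMedian

namespace KMedian

open Finset Timed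

/-! ### Medians -/

section Median

variable {P : Type} {d : P → P → ℝ}

/-- In a sorted list the entries up to index `h` are at most the entry there, and those from `h` on
are at least that entry. -/
theorem countP_le_getElem {α : Type} {s : List (ℝ × α)} (hs : s.Pairwise fun x y => x.1 ≤ y.1)
    {h : ℕ} (hh : h < s.length) :
    h + 1 ≤ s.countP (fun x => decide (x.1 ≤ s[h].1)) ∧
      s.length - h ≤ s.countP (fun x => decide (s[h].1 ≤ x.1)) := by
  have hsplit : s = s.take h ++ s[h] :: s.drop (h + 1) := by
    rw [← List.drop_eq_getElem_cons hh, List.take_append_drop]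
  have hs' := hs
  rw [hsplit, List.pairwise_append, List.pairwise_cons] at hs'
  obtain ⟨-, ⟨h1, -⟩, h2⟩ := hs'
  constructor
  · have : (s.take h ++ [s[h]]).countP (fun x => decide (x.1 ≤ s[h].1)) = h + 1 := by
      rw [List.countP_eq_length.2]
      · simp [hh]
      · intro a ha
        rw [List.mem_append, List.mem_singleton] at ha
        rcases ha with ha | rfl
        · simpa using h2 a ha _ List.mem_cons_self
        · simp
    rw [← this]
    refine List.Sublist.countP_le ?_
    conv_rhs => rw [hsplit]
    exact List.Sublist.append_left (List.singleton_sublist.2 List.mem_cons_self) _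
  · have : (s[h] :: s.drop (h + 1)).countP (fun x => decide (s[h].1 ≤ x.1)) = s.length - h := by
      rw [List.countP_eq_length.2]
      · simp
      · intro a ha
        rcases List.mem_cons.1 ha with rfl | ha
        · simp
        · simpa using h1 a ha
    rw [← this]
    refine List.Sublist.countP_le ?_
    conv_rhs => rw [hsplit]
    exact List.sublist_append_right _ _

/-- The index is `h = m / 2` rounded down, for which both `h + 1` and `m - h` are at least half of
`m`. -/
theorem medianDist_spec (p : P) {L : List P} (hL : L ≠ []) :
    L.length ≤ 2 * L.countP (fun x => decide (d p x ≤ (medianDist d p L).val)) ∧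
      L.length ≤ 2 * L.countP (fun x => decide ((medianDist d p L).val ≤ d p x)) := by
  set s := (sortT (L.map fun q => (d p q, ()))).val with hs
  have hperm := val_sortT (L.map fun q => (d p q, ()))
  rw [← hs] at hperm
  have hlen : s.length = L.length := by simpa using hperm.length_eq
  have hpos := List.length_pos_iff.2 hL
  have hlt : s.length / 2 < s.length := by omega
  have hval : (medianDist d p L).val = s[s.length / 2].1 := by
    simp only [medianDist, val_bind, val_mapT, val_step, val_lengthT, val_getT, ← hs]
    rw [List.getD_eq_getElem _ _ hlt]
  obtain ⟨h1, h2⟩ := countP_le_getElem (pairwise_sortT _) hlt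
  rw [← hval] at h1 h2
  have e1 := hperm.countP_eq fun x => decide (x.1 ≤ (medianDist d p L).val)
  have e2 := hperm.countP_eq fun x => decide ((medianDist d p L).val ≤ x.1)
  rw [List.countP_map] at e1 e2
  rw [← hs, e1] at h1
  rw [← hs, e2] at h2
  simp only [Function.comp_def] at h1 h2
  constructor <;> omega

theorem assignT_spec {leaves : List (List P)} (hne : leaves ≠ []) (hL : ∀ L ∈ leaves, L ≠ [])
    (p : P) : ∃ L ∈ leaves, ∃ h, L.head? = some h ∧ (assignT d leaves p).val = (p, h) ∧
      ∀ L' ∈ leaves, (medianDist d p L).val ≤ (medianDist d p L').val := by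
  obtain ⟨L₀, l, rfl⟩ := List.exists_cons_of_ne_nil hne
  simp only [assignT, val_bind, val_mapT, val_step, List.map_cons]
  set keyed := l.map fun L => ((medianDist d p L).val, L) with hkeyed
  set best := (argminT ((medianDist d p L₀).val, L₀) keyed).val with hbest
  have h1 : best ∈ (((medianDist d p L₀).val, L₀) :: keyed) := val_argminT_mem _ _
  have h2 : ∀ x ∈ (((medianDist d p L₀).val, L₀) :: keyed), best.1 ≤ x.1 := val_argminT_le _ _
  have hcons : ((medianDist d p L₀).val, L₀) :: keyed =
      (L₀ :: l).map fun L => ((medianDist d p L).val, L) := by simp [hkeyed]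
  rw [hcons] at h1 h2
  obtain ⟨L, hLmem, hLb⟩ := List.mem_map.1 h1
  obtain ⟨h, t, rfl⟩ := List.exists_cons_of_ne_nil (hL L hLmem)
  refine ⟨h :: t, hLmem, h, rfl, ?_, fun L' hL' => ?_⟩
  · rw [← hLb]
    rfl
  · have := h2 _ (List.mem_map.2 ⟨L', hL', rfl⟩)
    rw [← hLb] at this
    exact this

end Median

/-! ### Values of the programs of the cleaning phase -/

namespace Forest

variable {P : Type}

/-- The lists of points of the leaves. -/
def leaves : Forest P → List (List P)
  | nil => []
  | leaf pts F => pts :: F.leaves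
  | node ch F => ch.leaves ++ F.leaves

theorem flatten_leaves (F : Forest P) : F.leaves.flatten = F.points := by
  induction F with
  | nil => rfl
  | leaf pts F ih => simp [leaves, points, ih]
  | node ch F ih1 ih2 => simp [leaves, points, ih1, ih2]

end Forest

section Values

variable {P : Type}

theorem val_leavesT (F : Forest P) : (leavesT F).val = F.leaves := by
  induction F with
  | nil => rfl
  | leaf pts F ih => simp [leavesT, Forest.leaves, ih]
  | node ch F ih1 ih2 => simp [leavesT, Forest.leaves, ih1, ih2]

theorem onlyLeaves_eq_some {F : Forest P} {l : List P} (h : (onlyLeaves F).val = some l) :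
    l = F.points := by
  induction F generalizing l with
  | nil => simpa [onlyLeaves, Forest.points, eq_comm] using h
  | leaf pts F ih =>
    simp only [onlyLeaves, val_bind] at h
    cases hr : (onlyLeaves F).val with
    | none => simp [hr] at h
    | some l' =>
      simp [hr] at h
      simp [Forest.points, ← h, ih hr]
  | node ch F => simp [onlyLeaves] at h

@[simp] theorem val_collapse_leaf (pts : List P) (F : Forest P) :
    (collapse (.leaf pts F)).val = .leaf pts (collapse F).val := rfl

theorem val_collapse_node_some {ch F : Forest P} {l : List P}
    (h : (onlyLeaves ch).val = some l) :
    (collapse (.node ch F)).val = .leaf l (collapse F).val := by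
  simp [collapse, h]

theorem val_collapse_node_none {ch F : Forest P} (h : (onlyLeaves ch).val = none) :
    (collapse (.node ch F)).val = .node (collapse ch).val (collapse F).val := by
  simp [collapse, h]

theorem points_collapse (F : Forest P) : (collapse F).val.points = F.points := by
  induction F with
  | nil => rfl
  | leaf pts F ih => simp [Forest.points, ih]
  | node ch F ih1 ih2 =>
    cases h : (onlyLeaves ch).val with
    | none => simp [val_collapse_node_none h, Forest.points, ih1, ih2]
    | some l => simp [val_collapse_node_some h, Forest.points, ih2, onlyLeaves_eq_some h]

variable [DecidableEq P]

/-- The points of a leaf together with those assigned to its first point. -/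
def extendLeaf (asg : List (P × P)) (L : List P) : List P :=
  L ++ (asg.filter fun a => decide (L.head? = some a.2)).map Prod.fst

theorem val_reassign_leaf_large (asg : List (P × P)) {pts : List P} (F : Forest P)
    (h : 1 < pts.length) : (reassign asg (.leaf pts F)).val =
      .leaf (extendLeaf asg pts) (reassign asg F).val := by
  match pts with
  | [] => simp at h
  | [_] => simp at h
  | a :: x :: l =>
    simp only [reassign, val_bind, val_filterT, val_step, val_mapT, val_appendT, extendLeaf,
      List.head?_cons, Option.some.injEq]
    congr 5
    ext
    simp [eq_comm]

theorem val_reassign_leaf_small (asg : List (P × P)) {pts : List P} (F : Forest P)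
    (h : ¬ 1 < pts.length) : (reassign asg (.leaf pts F)).val = (reassign asg F).val := by
  match pts with
  | [] => simp [reassign]
  | [_] => simp [reassign]
  | a :: x :: l => simp at h

@[simp] theorem val_reassign_node (asg : List (P × P)) (ch F : Forest P) :
    (reassign asg (.node ch F)).val = .node (reassign asg ch).val (reassign asg F).val := rfl

theorem leaves_reassign (asg : List (P × P)) (F : Forest P) :
    (reassign asg F).val.leaves =
      (F.leaves.filter fun L => decide (1 < L.length)).map (extendLeaf asg) := by
  induction F with
  | nil => rfl
  | leaf pts F ih =>
    by_cases h : 1 < pts.length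
    · simp [val_reassign_leaf_large asg F h, Forest.leaves, h, ih]
    · simp [val_reassign_leaf_small asg F h, Forest.leaves, h, ih]
  | node ch F ih1 ih2 => simp [Forest.leaves, ih1, ih2]

/-- The points that are not in a large leaf, paired with the first point of their new leaf. -/
noncomputable def assignment (d : P → P → ℝ) (T : Forest P) : List (P × P) :=
  ((T.leaves.filter fun L => decide (L.length = 1)).foldl (fun acc L => L ++ acc) []).map
    fun p => (assignT d (T.leaves.filter fun L => decide (1 < L.length)) p).val

theorem val_cleaningPhase (d : P → P → ℝ) (T : Forest P) : (cleaningPhase d T).val =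
    (reassign (assignment d (collapse T).val) (collapse T).val).val := by
  simp [cleaningPhase, assignment, val_leavesT]

theorem foldl_append_perm {α : Type} (l : List (List α)) (a : List α) :
    (l.foldl (fun acc L => L ++ acc) a).Perm (a ++ l.flatten) := by
  induction l generalizing a with
  | nil => simp
  | cons L l ih =>
    rw [List.foldl_cons, List.flatten_cons, ← List.append_assoc]
    exact (ih _).trans (List.perm_append_comm.append_right _)

/-- Disjoint leaves have different heads, so every assignment is collected at exactly one leaf:
nothing is lost or duplicated. -/
theorem flatMap_filter_head?_perm {large : List (List P)} {asg : List (P × P)}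
    (hnd : large.flatten.Nodup) (h : ∀ a ∈ asg, ∃ L ∈ large, L.head? = some a.2) :
    (large.flatMap fun L => asg.filter fun a => decide (L.head? = some a.2)).Perm asg := by
  induction large generalizing asg with
  | nil =>
    cases asg with
    | nil => simp
    | cons a asg => simpa using h a List.mem_cons_self
  | cons L large ih =>
    rw [List.flatten_cons, List.nodup_append'] at hnd
    rw [List.flatMap_cons]
    have h1 : (large.flatMap fun L' => asg.filter fun a => decide (L'.head? = some a.2)) =
        large.flatMap fun L' => (asg.filter fun a => !decide (L.head? = some a.2)).filter
          fun a => decide (L'.head? = some a.2) := by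
      refine List.flatMap_congr fun L' hL' => ?_
      rw [List.filter_filter]
      refine List.filter_congr fun a _ => ?_
      by_cases hL : L'.head? = some a.2
      · have : L.head? ≠ some a.2 := fun hL2 => hnd.2.2 (List.mem_of_mem_head? hL2)
          (List.mem_flatten.2 ⟨L', hL', List.mem_of_mem_head? hL⟩)
        simp [hL, this]
      · simp [hL]
    rw [h1]
    refine ((ih hnd.2.1 fun a ha => ?_).append_left _).trans (List.filter_append_perm _ _)
    obtain ⟨ha, hLa⟩ := List.mem_filter.1 ha
    obtain ⟨L', hL', hL'a⟩ := h a ha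
    rcases List.mem_cons.1 hL' with rfl | hL'
    · simp [hL'a] at hLa
    · exact ⟨L', hL', hL'a⟩

theorem flatten_map_extendLeaf_perm {large : List (List P)} {asg : List (P × P)}
    (hnd : large.flatten.Nodup) (h : ∀ a ∈ asg, ∃ L ∈ large, L.head? = some a.2) :
    (large.map (extendLeaf asg)).flatten.Perm (large.flatten ++ asg.map Prod.fst) := by
  have h1 := (flatMap_filter_head?_perm hnd h).map Prod.fst
  rw [List.map_flatMap] at h1
  refine List.Perm.trans ?_ (h1.append_left _)
  rw [← List.flatMap_def]
  have := List.flatMap_append_perm large id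
    fun L => (asg.filter fun a => decide (L.head? = some a.2)).map Prod.fst
  rw [List.flatMap_id] at this
  exact this.symm

end Values

/-! ### Prunings -/

namespace BinTree

variable {P : Type}

/-- The points of all leaves. -/
def points : BinTree P → List P
  | leaf pts => pts
  | node l r => l.points ++ r.points

/-- The lists of points of a pruning of a binary tree. -/
inductive IsPruning : BinTree P → List (List P) → Prop
  | root (t : BinTree P) : IsPruning t [t.points]
  | node {l r : BinTree P} {a b : List (List P)} : IsPruning l a → IsPruning r b →
      IsPruning (.node l r) (a ++ b)

theorem IsPruning.flatten_eq {t : BinTree P} {a : List (List P)} (h : IsPruning t a) :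
    a.flatten = t.points := by
  induction h with
  | root t => simp
  | node _ _ ih1 ih2 => simp [points, ih1, ih2]

end BinTree

section Binarize

variable {P : Type}

/-- Removing single items can leave internal nodes without leaves. `binarize` drops such nodes, and
the absence of a result means that no leaf exists. -/
theorem binarize_spec (F : Forest P) :
    (∀ t, (binarize F).val = some t → t.points = F.points) ∧
      ((binarize F).val = none → F.leaves = []) := by
  induction F with
  | nil => simp [binarize, Forest.leaves]
  | leaf pts F ih =>
    simp only [binarize, val_bind]
    cases h : (binarize F).val with
    | none =>
      have := ih.2 h
      have h2 := F.flatten_leaves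
      rw [this] at h2
      simp only [val_step, Option.some.injEq, forall_eq', Forest.points, BinTree.points, ← h2]
      simp
    | some t =>
      have := ih.1 t h
      simp [Forest.points, BinTree.points, this]
  | node ch F ih1 ih2 =>
    simp only [binarize, val_bind]
    cases h1 : (binarize ch).val with
    | none =>
      have e1 := ih1.2 h1
      have e2 := ch.flatten_leaves
      rw [e1] at e2
      simp only [val_step, Forest.points, Forest.leaves, ← e2, e1]
      simpa using ih2
    | some t =>
      have e1 := ih1.1 t h1
      cases h2 : (binarize F).val with
      | none =>
        have e3 := ih2.2 h2
        have e4 := F.flatten_leaves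
        rw [e3] at e4
        simp [Forest.points, ← e4, e1]
      | some t' => simp [Forest.points, BinTree.points, e1, ih2.1 t' h2]

end Binarize

end KMedian

namespace KMedian

open Finset Timed

/-! ### The clusters after cleaning -/

variable {X : Type*} {P : Type} [MetricSpace X] {k : ℕ}

variable {ω : P → X} {f : P → Fin k} {p q : Fin k → P} {G : Finset P} {b μ : ℝ} {S : List P}
  {c : Fin k → X}

theorem IsPure.leaves_collapse {i : Fin k} {F : Forest P} (h : IsPure ω f G b μ i F) :
    ∀ L ∈ (collapse F).val.leaves, (∃ x, L = [x]) ∨ IsCoreLeaf ω f G b μ i L := by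
  induction h with
  | nil => simp [collapse, Forest.leaves]
  | leaf _ _ ih =>
    simp only [val_collapse_leaf, Forest.leaves, List.mem_cons, forall_eq_or_imp]
    exact ⟨Or.inl ⟨_, rfl⟩, ih⟩
  | @node ch F _ hcore _ ih1 ih2 =>
    cases ho : (onlyLeaves ch).val with
    | none =>
      simp only [val_collapse_node_none ho, Forest.leaves, List.mem_append]
      rintro L (hL | hL)
      exacts [ih1 L hL, ih2 L hL]
    | some l =>
      simp only [val_collapse_node_some ho, Forest.leaves, List.mem_cons, forall_eq_or_imp]
      exact ⟨Or.inr (hcore l ho), ih2⟩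

/-- A forest with an internal node has a lowest one; its children are single items, so cleaning
turns it into a core leaf. -/
theorem IsPure.exists_coreLeaf {i : Fin k} {F : Forest P} (h : IsPure ω f G b μ i F)
    (ho : (onlyLeaves F).val = none) :
    ∃ L ∈ (collapse F).val.leaves, IsCoreLeaf ω f G b μ i L := by
  induction h with
  | nil => simp [onlyLeaves] at ho
  | @leaf x F _ _ ih =>
    simp only [onlyLeaves, val_bind] at ho
    cases h1 : (onlyLeaves F).val with
    | some l => simp [h1] at ho
    | none =>
      obtain ⟨L, hL, hc⟩ := ih h1
      exact ⟨L, by simp [Forest.leaves, hL], hc⟩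
  | @node ch F _ hcore _ ih1 ih2 =>
    cases h1 : (onlyLeaves ch).val with
    | none =>
      obtain ⟨L, hL, hc⟩ := ih1 h1
      exact ⟨L, by simp [val_collapse_node_none h1, Forest.leaves, hL], hc⟩
    | some l => exact ⟨l, by simp [val_collapse_node_some h1, Forest.leaves], hcore l h1⟩

theorem IsPure.exists_coreLeaf_node {i : Fin k} {ch F : Forest P} (h : IsPure ω f G b μ i ch)
    (hcore : IsCore ω f G b μ i ch) :
    ∃ L ∈ (collapse (.node ch F)).val.leaves, IsCoreLeaf ω f G b μ i L := by
  cases h1 : (onlyLeaves ch).val with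
  | none =>
    obtain ⟨L, hL, hc⟩ := h.exists_coreLeaf h1
    exact ⟨L, by simp [val_collapse_node_none h1, Forest.leaves, hL], hc⟩
  | some l => exact ⟨l, by simp [val_collapse_node_some h1, Forest.leaves], hcore l h1⟩

theorem IsUpper.leaves_collapse {F : Forest P} (h : IsUpper ω f G b μ F) :
    ∀ L ∈ (collapse F).val.leaves, (∃ x, L = [x]) ∨ ∃ i, IsCoreLeaf ω f G b μ i L := by
  induction h with
  | nil => simp [collapse, Forest.leaves]
  | leaf _ _ ih =>
    simp only [val_collapse_leaf, Forest.leaves, List.mem_cons, forall_eq_or_imp]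
    exact ⟨Or.inl ⟨_, rfl⟩, ih⟩
  | @body ch F i hp hcore _ _ ih =>
    cases ho : (onlyLeaves ch).val with
    | none =>
      simp only [val_collapse_node_none ho, Forest.leaves, List.mem_append]
      rintro L (hL | hL)
      exacts [(hp.leaves_collapse L hL).imp_right fun h => ⟨i, h⟩, ih L hL]
    | some l =>
      simp only [val_collapse_node_some ho, Forest.leaves, List.mem_cons, forall_eq_or_imp]
      exact ⟨Or.inr ⟨i, hcore l ho⟩, ih⟩
  | @node ch F _ ho _ ih1 ih2 =>
    simp only [val_collapse_node_none ho, Forest.leaves, List.mem_append]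
    rintro L (hL | hL)
    exacts [ih1 L hL, ih2 L hL]

theorem IsUpper.exists_coreLeaf {F : Forest P} (h : IsUpper ω f G b μ F) {g : P}
    (hg : g ∈ F.points) (hgG : g ∈ G) :
    ∃ L ∈ (collapse F).val.leaves, IsCoreLeaf ω f G b μ (f g) L := by
  induction h with
  | nil => simp [Forest.points] at hg
  | leaf hx _ ih =>
    simp only [Forest.points, List.mem_append, List.mem_singleton] at hg
    rcases hg with rfl | hg
    · exact absurd hgG hx
    · obtain ⟨L, hL, hc⟩ := ih hg
      exact ⟨L, by simp [Forest.leaves, hL], hc⟩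
  | @body ch F i hp hcore _ _ ih =>
    simp only [Forest.points, List.mem_append] at hg
    rcases hg with hg | hg
    · rw [hp.label g hg hgG]
      exact hp.exists_coreLeaf_node hcore
    · obtain ⟨L, hL, hc⟩ := ih hg
      refine ⟨L, ?_, hc⟩
      cases ho : (onlyLeaves ch).val with
      | none => simp [val_collapse_node_none ho, Forest.leaves, hL]
      | some l => simp [val_collapse_node_some ho, Forest.leaves, hL]
  | @node ch F _ ho _ ih1 ih2 =>
    simp only [Forest.points, List.mem_append] at hg
    rcases hg with hg | hg
    · obtain ⟨L, hL, hc⟩ := ih1 hg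
      exact ⟨L, by simp [val_collapse_node_none ho, Forest.leaves, hL], hc⟩
    · obtain ⟨L, hL, hc⟩ := ih2 hg
      exact ⟨L, by simp [val_collapse_node_none ho, Forest.leaves, hL], hc⟩

/-- Good parts of targets are never divided between trees; this keeps the labels of the final parts
distinct. -/
theorem IsUpper.complete {F : Forest P} (h : IsUpper ω f G b μ F) {g g' : P}
    (hg : g ∈ F.points) (hgG : g ∈ G) (hg'G : g' ∈ G) (hgg' : f g' = f g) : g' ∈ F.points := by
  induction h with
  | nil => simp [Forest.points] at hg
  | leaf hx _ ih =>
    simp only [Forest.points, List.mem_append, List.mem_singleton] at hg ⊢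
    rcases hg with rfl | hg
    exacts [absurd hgG hx, Or.inr (ih hg)]
  | body i hp _ hall _ ih =>
    simp only [Forest.points, List.mem_append] at hg ⊢
    rcases hg with hg | hg
    exacts [Or.inl (hall g' hg'G (hgg'.trans (hp.label g hg hgG))), Or.inr (ih hg)]
  | node _ _ _ ih1 ih2 =>
    simp only [Forest.points, List.mem_append] at hg ⊢
    rcases hg with hg | hg
    exacts [Or.inl (ih1 hg), Or.inr (ih2 hg)]

variable [Fintype P]

/-- In cluster `i` the item `y` costs at most an average share more than in its own cluster. -/
def IsPlaced (ω : P → X) (f : P → Fin k) (G : Finset P) (b μ : ℝ) (c : Fin k → X) (i : Fin k)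
    (y : P) : Prop :=
  f y = i ∨ y ∉ G ∧ dist (ω y) (c i) ≤
    dist (ω y) (c (f y)) + 2 * (∑ x, dist (ω x) (c (f x))) / (μ - 3 * b)

/-- The item of `Y` nearest to the center costs at most the average over `Y`. -/
theorem exists_dist_mul_le {i : Fin k} {Y : Finset P} (hY : ∀ y ∈ Y, f y = i) {K : ℝ}
    (hK0 : 0 < K) (hK : K ≤ #Y) :
    ∃ y ∈ Y, K * dist (ω y) (c i) ≤ ∑ x with f x = i, dist (ω x) (c (f x)) := by
  have hne : Y.Nonempty := by
    rw [← card_pos]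
    exact_mod_cast hK0.trans_le hK
  obtain ⟨y, hy, hmin⟩ := exists_min_image Y (fun y => dist (ω y) (c i)) hne
  refine ⟨y, hy, ?_⟩
  calc K * dist (ω y) (c i) ≤ #Y * dist (ω y) (c i) :=
        mul_le_mul_of_nonneg_right hK dist_nonneg
    _ ≤ ∑ x ∈ Y, dist (ω x) (c i) := by
        rw [← nsmul_eq_mul]
        exact card_nsmul_le_sum _ _ _ hmin
    _ = ∑ x ∈ Y, dist (ω x) (c (f x)) := sum_congr rfl fun x hx => by rw [hY x hx]
    _ ≤ _ := sum_le_sum_of_subset_of_nonneg (fun x hx => by simp [hY x hx])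
        fun _ _ _ => dist_nonneg

variable [DecidableEq P]

namespace Separated

/-- Choose cheap `y ∈ Y` and `z ∈ Z` by averaging. The path from `x` through `y` to `c i` is no
longer than the distance from `x` to `z` plus that from `y` to `c i`; going from `x` to `z` through
`c (f x)` bounds the excess. Clusters `i` and `f x` are disjoint, so the two averages together are
at most `W` divided by `(μ - 3 * b) / 2`. -/
theorem isPlaced_of_sets (h : Separated ω f p q G b μ) {i : Fin k} {x : P} (hx : x ∉ G)
    {Y Z : Finset P} (hY : ∀ y ∈ Y, f y = i) (hZ : ∀ z ∈ Z, f z = f x)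
    (hYc : (μ - 3 * b) / 2 ≤ #Y) (hZc : (μ - 3 * b) / 2 ≤ #Z)
    (hYZ : ∀ y ∈ Y, ∀ z ∈ Z, itemDist ω x y ≤ itemDist ω x z) :
    IsPlaced ω f G b μ c i x := by
  by_cases hi : f x = i
  · exact Or.inl hi
  have hK : 0 < (μ - 3 * b) / 2 := by linarith [h.lt, h.one_le]
  obtain ⟨y, hy, hyd⟩ := exists_dist_mul_le (ω := ω) (c := c) hY hK hYc
  obtain ⟨z, hz, hzd⟩ := exists_dist_mul_le (ω := ω) (c := c) hZ hK hZc
  refine Or.inr ⟨hx, ?_⟩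
  have hsum : ∑ x with f x = i, dist (ω x) (c (f x)) +
      ∑ y with f y = f x, dist (ω y) (c (f y)) ≤ ∑ x, dist (ω x) (c (f x)) := by
    rw [← sum_union]
    · exact sum_le_sum_of_subset_of_nonneg (subset_univ _) fun _ _ _ => dist_nonneg
    · rw [disjoint_filter]
      rintro w - rfl h2
      exact hi h2.symm
  set W := ∑ x, dist (ω x) (c (f x))
  have key : dist (ω y) (c i) + dist (ω z) (c (f x)) ≤ 2 * W / (μ - 3 * b) := by
    rw [le_div_iff₀ (by linarith)]
    nlinarith
  have t1 := dist_triangle (ω x) (ω y) (c i)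
  have t2 := hYZ y hy z hz
  have t3 := dist_triangle (ω x) (c (f x)) (ω z)
  rw [dist_comm (c (f x))] at t3
  simp only [itemDist] at t2
  linarith

/-- The margin condition puts every leaf item nearer to `x` than each good item of cluster `f x`
outside `E`; at least `μ - 2 * b` good items remain on either side. -/
theorem isPlaced_of_mem_coreLeaf (h : Separated ω f p q G b μ) {i : Fin k} {L : List P}
    (hL : IsCoreLeaf ω f G b μ i L) {x : P} (hx : x ∈ L) : IsPlaced ω f G b μ c i x := by
  by_cases hi : f x = i
  · exact Or.inl hi
  have hxG : x ∉ G := fun hxG => hi (hL.label x hx hxG)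
  obtain ⟨E, hE, hm⟩ := hL.margin
  refine h.isPlaced_of_sets hxG (Y := L.toFinset ∩ G) (Z := {y ∈ G | f y = f x} \ E)
    (fun y hy => ?_) (fun z hz => ?_) ?_ ?_ (fun y hy z hz => ?_)
  · rw [mem_inter, List.mem_toFinset] at hy
    exact hL.label y hy.1 hy.2
  · simp only [mem_sdiff, mem_filter] at hz
    exact hz.1.2
  · have := h.card_sub_le L.toFinset
    rw [List.toFinset_card_of_nodup hL.nodup] at this
    linarith [hL.size, h.lt, h.one_le]
  · have h1 := h.le_card_good (f x)
    have h2 : (#{y ∈ G | f y = f x} : ℝ) ≤ #({y ∈ G | f y = f x} \ E) + #E := by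
      exact_mod_cast card_le_card_sdiff_add_card
    linarith [h.lt, h.one_le]
  · rw [mem_inter, List.mem_toFinset] at hy
    simp only [mem_sdiff, mem_filter] at hz
    exact (hm x hx y hy.1 z hz.1.1 (by rw [hz.1.2]; exact hi) hz.2).le

/-- Half of at least `μ - b` items, less `b` bad ones: the origin of `(μ - 3 * b) / 2`. -/
theorem half_le_card (h : Separated ω f p q G b μ) {i : Fin k} {L : List P}
    (hL : IsCoreLeaf ω f G b μ i L) {t : P → Bool} (ht : L.length ≤ 2 * L.countP t) :
    (μ - 3 * b) / 2 ≤ #({x ∈ L.toFinset | t x = true} ∩ G) := by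
  have h1 := h.card_sub_le {x ∈ L.toFinset | t x = true}
  have h2 : L.countP t ≤ #{x ∈ L.toFinset | t x = true} :=
    countP_le_card hL.nodup fun x hx hxt => mem_filter.2 ⟨List.mem_toFinset.2 hx, hxt⟩
  have h3 : (L.length : ℝ) ≤ 2 * #{x ∈ L.toFinset | t x = true} := by
    exact_mod_cast ht.trans (by omega)
  linarith [hL.size]

/-- The near half of `L` is no farther from `x` than the far half of `L'`. For a good `x` this
contradicts separation unless the labels agree; for a bad one averaging applies. -/
theorem isPlaced_of_median_le (h : Separated ω f p q G b μ) {i : Fin k} {x : P} {L L' : List P}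
    (hL : IsCoreLeaf ω f G b μ i L) (hL' : IsCoreLeaf ω f G b μ (f x) L')
    (hle : (medianDist (itemDist ω) x L).val ≤ (medianDist (itemDist ω) x L').val) :
    IsPlaced ω f G b μ c i x := by
  have hne : ∀ {i : Fin k} {L : List P}, IsCoreLeaf ω f G b μ i L → L ≠ [] := by
    rintro i L hL rfl
    have := hL.size
    simp only [List.length_nil, Nat.cast_zero] at this
    linarith [h.lt, h.one_le]
  have h1 := h.half_le_card hL (medianDist_spec (d := itemDist ω) x (hne hL)).1
  have h2 := h.half_le_card hL' (medianDist_spec (d := itemDist ω) x (hne hL')).2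
  have hK : 0 < (μ - 3 * b) / 2 := by linarith [h.lt, h.one_le]
  set Y := {y ∈ L.toFinset | decide (itemDist ω x y ≤ (medianDist (itemDist ω) x L).val) = true}
    ∩ G with hYdef
  set Z := {y ∈ L'.toFinset | decide ((medianDist (itemDist ω) x L').val ≤ itemDist ω x y) = true}
    ∩ G with hZdef
  have hY : ∀ y ∈ Y, y ∈ G ∧ f y = i ∧ itemDist ω x y ≤ (medianDist (itemDist ω) x L).val := by
    intro y hy
    simp only [hYdef, mem_inter, mem_filter, List.mem_toFinset, decide_eq_true_eq] at hy
    exact ⟨hy.2, hL.label y hy.1.1 hy.2, hy.1.2⟩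
  have hZ : ∀ y ∈ Z, y ∈ G ∧ f y = f x ∧
      (medianDist (itemDist ω) x L').val ≤ itemDist ω x y := by
    intro y hy
    simp only [hZdef, mem_inter, mem_filter, List.mem_toFinset, decide_eq_true_eq] at hy
    exact ⟨hy.2, hL'.label y hy.1.1 hy.2, hy.1.2⟩
  have hYZ : ∀ y ∈ Y, ∀ z ∈ Z, itemDist ω x y ≤ itemDist ω x z := fun y hy z hz =>
    (hY y hy).2.2.trans (hle.trans (hZ z hz).2.2)
  by_cases hi : f x = i
  · exact Or.inl hi
  by_cases hxG : x ∈ G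
  · exfalso
    have hYne : Y.Nonempty := by
      rw [← card_pos]; exact_mod_cast hK.trans_le h1
    have hZne : Z.Nonempty := by
      rw [← card_pos]; exact_mod_cast hK.trans_le h2
    obtain ⟨y, hy⟩ := hYne
    obtain ⟨z, hz⟩ := hZne
    have := h.dist_lt_dist hxG (hZ z hz).1 (hY y hy).1 (hZ z hz).2.1
      (by rw [(hY y hy).2.1]; exact Ne.symm hi)
    exact this.not_ge (hYZ y hy z hz)
  · exact h.isPlaced_of_sets hxG (fun y hy => (hY y hy).2.1) (fun z hz => (hZ z hz).2.1) h1 h2 hYZ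

theorem one_lt_length (h : Separated ω f p q G b μ) {i : Fin k} {L : List P}
    (hL : IsCoreLeaf ω f G b μ i L) : 1 < L.length := by
  have : (1 : ℝ) < L.length := by linarith [hL.size, h.lt, h.one_le]
  exact_mod_cast this

end Separated

/-- The parts of a pruning of the trees in a forest, with the target clusters they
correspond to. -/
structure IsBodyList (ω : P → X) (f : P → Fin k) (G : Finset P) (b μ : ℝ) (asg : List (P × P))
    (F : Forest P) (bodies : List (Fin k × List P)) : Prop where
  prune : (∃ t, (binarize (reassign asg (collapse F).val).val).val = some t ∧
    t.IsPruning (bodies.map Prod.snd)) ∨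
      (binarize (reassign asg (collapse F).val).val).val = none ∧ bodies = []
  label : ∀ i, i ∈ bodies.map Prod.fst ↔ ∃ g ∈ F.points, g ∈ G ∧ f g = i
  nodup : (bodies.map Prod.fst).Nodup
  core : ∀ a ∈ bodies, a.2 ≠ [] ∧ ∀ y ∈ a.2, ∃ L ∈ (collapse F).val.leaves,
    IsCoreLeaf ω f G b μ a.1 L ∧ y ∈ extendLeaf asg L

/-- Each body contributes its whole subtree as one part, single bad items disappear, and upper nodes
concatenate the parts of their children. -/
theorem IsUpper.exists_bodyList (h : Separated ω f p q G b μ) {F : Forest P}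
    (hF : IsUpper ω f G b μ F) (hnd : F.points.Nodup) (asg : List (P × P)) :
    ∃ bodies, IsBodyList ω f G b μ asg F bodies := by
  induction hF with
  | nil => exact ⟨[], Or.inr ⟨rfl, rfl⟩, by simp [Forest.points], by simp, by simp⟩
  | @leaf x F hx _ ih =>
    simp only [Forest.points, List.singleton_append, List.nodup_cons] at hnd
    obtain ⟨bodies, h1, h2, h3, h4⟩ := ih hnd.2
    refine ⟨bodies, ?_, fun i => (h2 i).trans ?_, h3, ?_⟩
    · rw [val_collapse_leaf, val_reassign_leaf_small _ _ (by simp)]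
      exact h1
    · simp only [Forest.points, List.singleton_append, List.mem_cons, exists_eq_or_imp, hx,
        false_and, false_or]
    · rintro a ha
      refine ⟨(h4 a ha).1, fun y hy => ?_⟩
      obtain ⟨L, hL, hc⟩ := (h4 a ha).2 y hy
      exact ⟨L, by simp [Forest.leaves, hL], hc⟩
  | @body ch F i hp hcore hall hF' ih =>
    simp only [Forest.points, List.nodup_append'] at hnd
    obtain ⟨bodies, h1, h2, h3, h4⟩ := ih hnd.2.1
    -- the tree of this body
    obtain ⟨t, ht, htb⟩ : ∃ t : BinTree P,
        (t.points ≠ [] ∧ ∀ y ∈ t.points, ∃ L ∈ (collapse (.node ch F)).val.leaves,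
          IsCoreLeaf ω f G b μ i L ∧ y ∈ extendLeaf asg L) ∧
        (binarize (reassign asg (collapse (.node ch F)).val).val).val =
          match (binarize (reassign asg (collapse F).val).val).val with
          | none => some t
          | some t' => some (.node t t') := by
      cases ho : (onlyLeaves ch).val with
      | some l =>
        have hl := hcore l ho
        have hlen := h.one_lt_length hl
        refine ⟨.leaf (extendLeaf asg l), ⟨?_, fun y hy => ⟨l, ?_, hl, hy⟩⟩, ?_⟩
        · have : l ≠ [] := by rintro rfl; simp at hlen
          simp [BinTree.points, extendLeaf, this]
        · simp [val_collapse_node_some ho, Forest.leaves]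
        · rw [val_collapse_node_some ho, val_reassign_leaf_large _ _ hlen]
          simp only [binarize, val_bind]
          cases (binarize (reassign asg (collapse F).val).val).val <;> rfl
      | none =>
        -- A core leaf survives the removal of single items, so the subtree of the body is not
        -- empty.
        obtain ⟨L, hL, hLc⟩ := hp.exists_coreLeaf ho
        have hleaf : extendLeaf asg L ∈ (reassign asg (collapse ch).val).val.leaves := by
          rw [leaves_reassign]
          exact List.mem_map.2 ⟨L, List.mem_filter.2 ⟨hL, by simpa using h.one_lt_length hLc⟩, rfl⟩
        cases hb : (binarize (reassign asg (collapse ch).val).val).val with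
        | none =>
          rw [(binarize_spec _).2 hb] at hleaf
          simp at hleaf
        | some t =>
          have hpts := (binarize_spec _).1 t hb
          rw [← Forest.flatten_leaves] at hpts
          refine ⟨t, ⟨?_, fun y hy => ?_⟩, ?_⟩
          · rw [hpts]
            obtain ⟨x, hx⟩ : ∃ x, x ∈ L := List.exists_mem_of_length_pos
              (by have := h.one_lt_length hLc; omega)
            exact List.ne_nil_of_mem (List.mem_flatten.2 ⟨_, hleaf,
              List.mem_append_left _ hx⟩)
          · rw [hpts] at hy
            obtain ⟨L', hL', hy⟩ := List.mem_flatten.1 hy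
            rw [leaves_reassign] at hL'
            obtain ⟨L'', hL'', rfl⟩ := List.mem_map.1 hL'
            obtain ⟨hm, hlen⟩ := List.mem_filter.1 hL''
            refine ⟨L'', by simp [val_collapse_node_none ho, Forest.leaves, hm], ?_, hy⟩
            rcases hp.leaves_collapse L'' hm with ⟨x, rfl⟩ | hc
            · simp at hlen
            · exact hc
          · rw [val_collapse_node_none ho, val_reassign_node]
            simp only [binarize, val_bind, hb]
            cases (binarize (reassign asg (collapse F).val).val).val <;> rfl
    have hmono : ∀ L ∈ (collapse F).val.leaves, L ∈ (collapse (.node ch F)).val.leaves := by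
      intro L hL
      cases ho : (onlyLeaves ch).val with
      | none => simp [val_collapse_node_none ho, Forest.leaves, hL]
      | some l => simp [val_collapse_node_some ho, Forest.leaves, hL]
    have hqi : q i ∈ ch.points := hall _ (h.mem i) (h.label i)
    refine ⟨(i, t.points) :: bodies, Or.inl ?_, fun j => ?_, ?_, ?_⟩
    · rcases h1 with ⟨t', ht', hpr⟩ | ⟨hn, rfl⟩
      · refine ⟨_, htb.trans (by rw [ht']), ?_⟩
        exact .node (.root t) hpr
      · exact ⟨_, htb.trans (by rw [hn]), .root t⟩
    · simp only [List.map_cons, List.mem_cons, h2, Forest.points, List.mem_append]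
      constructor
      · rintro (rfl | ⟨g, hg, hgG, rfl⟩)
        · exact ⟨q j, Or.inl hqi, h.mem j, h.label j⟩
        · exact ⟨g, Or.inr hg, hgG, rfl⟩
      · rintro ⟨g, hg | hg, hgG, rfl⟩
        · exact Or.inl (hp.label g hg hgG)
        · exact Or.inr ⟨g, hg, hgG, rfl⟩
    -- A second body with label `i` would share good items with `ch`, which already holds all of
    -- them.
    · rw [List.map_cons, List.nodup_cons]
      refine ⟨fun hi => ?_, h3⟩
      obtain ⟨g, hg, hgG, hgi⟩ := (h2 i).1 hi
      exact hnd.2.2 (hall g hgG hgi) hg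
    · intro a ha
      rcases List.mem_cons.1 ha with rfl | ha
      · exact ht
      · refine ⟨(h4 a ha).1, fun y hy => ?_⟩
        obtain ⟨L, hL, hc⟩ := (h4 a ha).2 y hy
        exact ⟨L, hmono L hL, hc⟩
  | @node ch F hch ho hF' ih1 ih2 =>
    simp only [Forest.points, List.nodup_append'] at hnd
    obtain ⟨bodies₁, a1, a2, a3, a4⟩ := ih1 hnd.1
    obtain ⟨bodies₂, b1, b2, b3, b4⟩ := ih2 hnd.2.1
    refine ⟨bodies₁ ++ bodies₂, ?_, fun j => ?_, ?_, ?_⟩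
    · rw [val_collapse_node_none ho, val_reassign_node]
      simp only [binarize, val_bind, List.map_append]
      rcases a1 with ⟨t, ht, hpr⟩ | ⟨hn, rfl⟩
      · rcases b1 with ⟨t', ht', hpr'⟩ | ⟨hn', rfl⟩
        · exact Or.inl ⟨.node t t', by rw [ht, ht']; rfl, .node hpr hpr'⟩
        · exact Or.inl ⟨t, by rw [ht, hn']; rfl, by simpa using hpr⟩
      · rcases b1 with ⟨t', ht', hpr'⟩ | ⟨hn', rfl⟩
        · exact Or.inl ⟨t', by rw [hn, ht']; rfl, by simpa using hpr'⟩
        · exact Or.inr ⟨by rw [hn, hn']; rfl, rfl⟩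
    · simp only [List.map_append, List.mem_append, a2, b2, Forest.points]
      constructor
      · rintro (⟨g, hg, hh⟩ | ⟨g, hg, hh⟩)
        exacts [⟨g, Or.inl hg, hh⟩, ⟨g, Or.inr hg, hh⟩]
      · rintro ⟨g, hg | hg, hh⟩
        exacts [Or.inl ⟨g, hg, hh⟩, Or.inr ⟨g, hg, hh⟩]
    · rw [List.map_append, List.nodup_append']
      refine ⟨a3, b3, fun i hi hi' => ?_⟩
      obtain ⟨g, hg, hgG, rfl⟩ := (a2 _).1 hi
      obtain ⟨g', hg', hg'G, hgg'⟩ := (b2 _).1 hi'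
      exact hnd.2.2 (hch.complete hg hgG hg'G hgg') hg'
    · intro a ha
      rcases List.mem_append.1 ha with ha | ha
      · refine ⟨(a4 a ha).1, fun y hy => ?_⟩
        obtain ⟨L, hL, hc⟩ := (a4 a ha).2 y hy
        exact ⟨L, by simp [val_collapse_node_none ho, Forest.leaves, hL], hc⟩
      · refine ⟨(b4 a ha).1, fun y hy => ?_⟩
        obtain ⟨L, hL, hc⟩ := (b4 a ha).2 y hy
        exact ⟨L, by simp [val_collapse_node_none ho, Forest.leaves, hL], hc⟩

/-- After cleaning, the tree has a pruning that nearly agrees with the target clustering. -/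
theorem Separated.cleaningPhase (h : Separated ω f p q G b μ) (hS : S.Nodup)
    (hmem : ∀ x, x ∈ S) (hk : 0 < k) {T : Forest P} (hT : IsUpper ω f G b μ T)
    (hperm : T.points.Perm S) (c : Fin k → X) :
    ∃ t, (binarize (KMedian.cleaningPhase (itemDist ω) T).val).val = some t ∧ t.points.Perm S ∧
      ∃ bodies : List (Fin k × List P), t.IsPruning (bodies.map Prod.snd) ∧
        (bodies.map Prod.fst).Perm (List.finRange k) ∧
        ∀ a ∈ bodies, a.2 ≠ [] ∧ ∀ y ∈ a.2, IsPlaced ω f G b μ c a.1 y := by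
  rw [val_cleaningPhase]
  set T' := (collapse T).val with hT'
  have hnd : T.points.Nodup := hperm.nodup_iff.2 hS
  have hTmem : ∀ x, x ∈ T.points := fun x => hperm.mem_iff.2 (hmem x)
  have hpts : T'.leaves.flatten = T.points := by
    rw [Forest.flatten_leaves, hT', points_collapse]
  set large := T'.leaves.filter fun L => decide (1 < L.length) with hlarge
  set small := T'.leaves.filter fun L => decide (L.length = 1) with hsmall
  set asg := assignment (itemDist ω) T' with hasg
  have hcore : ∀ i, ∃ L ∈ large, IsCoreLeaf ω f G b μ i L := by
    intro i
    obtain ⟨L, hL, hc⟩ := hT.exists_coreLeaf (hTmem (q i)) (h.mem i)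
    rw [h.label] at hc
    exact ⟨L, List.mem_filter.2 ⟨hL, by simpa using h.one_lt_length hc⟩, hc⟩
  have hlargene : ∀ L ∈ large, L ≠ [] := by
    rintro L hL rfl
    simpa using (List.mem_filter.1 hL).2
  have hne : large ≠ [] := by
    obtain ⟨L, hL, -⟩ := hcore ⟨0, hk⟩
    exact List.ne_nil_of_mem hL
  have hlargend : large.flatten.Nodup := by
    refine (List.filter_sublist.flatten).nodup (l₂ := T'.leaves.flatten) ?_
    rw [hpts]
    exact hnd
  have hasg1 : ∀ a ∈ asg, ∃ L ∈ large, L.head? = some a.2 ∧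
      ∀ L' ∈ large, (medianDist (itemDist ω) a.1 L).val ≤ (medianDist (itemDist ω) a.1 L').val := by
    intro a ha
    rw [hasg, assignment] at ha
    obtain ⟨x, -, rfl⟩ := List.mem_map.1 ha
    obtain ⟨L, hL, hd, hhd, hv, hm⟩ := assignT_spec (d := itemDist ω) hne hlargene x
    rw [← hlarge, hv]
    exact ⟨L, hL, hhd, hm⟩
  have hfst : asg.map Prod.fst = small.foldl (fun acc L => L ++ acc) [] := by
    rw [hasg, assignment, List.map_map]
    refine (List.map_congr_left fun x _ => ?_).trans (List.map_id _)
    obtain ⟨L, hL, hd, hhd, hv, hm⟩ := assignT_spec (d := itemDist ω) hne hlargene x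
    simp only [Function.comp_apply, ← hlarge, hv, id]
  have hpos : ∀ L ∈ T'.leaves, L ≠ [] := by
    intro L hL
    rcases hT.leaves_collapse L hL with ⟨x, rfl⟩ | ⟨i, hc⟩
    · simp
    · rintro rfl
      simpa using h.one_lt_length hc
  have hRperm : (reassign asg T').val.points.Perm S := by
    rw [← Forest.flatten_leaves, leaves_reassign]
    refine (flatten_map_extendLeaf_perm hlargend fun a ha => ?_).trans ?_
    · obtain ⟨L, hL, hh, -⟩ := hasg1 a ha
      exact ⟨L, hL, hh⟩
    · rw [hfst]
      refine ((foldl_append_perm _ _).append_left _).trans ?_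
      rw [List.nil_append, ← List.flatten_append]
      refine List.Perm.trans ?_ ((hpts ▸ List.Perm.refl _ : T'.leaves.flatten.Perm T.points).trans
        hperm)
      refine List.Perm.flatten ?_
      -- No leaf is empty, so length one is the complement of length greater than one.
      have hs : small = T'.leaves.filter fun L => !decide (1 < L.length) := by
        refine List.filter_congr fun L hL => ?_
        have := List.length_pos_iff.2 (hpos L hL)
        by_cases h1 : L.length = 1
        · simp [h1]
        · have : 1 < L.length := by omega
          simp [h1, this]
      rw [hs]
      exact List.filter_append_perm _ _
  obtain ⟨bodies, h1, h2, h3, h4⟩ := hT.exists_bodyList h hnd asg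
  rw [← hT'] at h1 h4
  have hall : ∀ i, i ∈ bodies.map Prod.fst := fun i =>
    (h2 i).2 ⟨q i, hTmem _, h.mem i, h.label i⟩
  have hbne : bodies ≠ [] := by
    rintro rfl
    simpa using hall ⟨0, hk⟩
  rcases h1 with ⟨t, ht, hpr⟩ | ⟨-, hb⟩
  swap
  · exact absurd hb hbne
  refine ⟨t, ht, ?_, bodies, hpr, ?_, fun a ha => ⟨(h4 a ha).1, fun y hy => ?_⟩⟩
  · rw [(binarize_spec _).1 t ht]
    exact hRperm
  · exact (List.perm_ext_iff_of_nodup h3 (List.nodup_finRange k)).2 fun i => by simp [hall i]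
  · obtain ⟨L, hL, hc, hyL⟩ := (h4 a ha).2 y hy
    rcases List.mem_append.1 hyL with hyL | hyL
    · exact h.isPlaced_of_mem_coreLeaf hc hyL
    · obtain ⟨z, hz, rfl⟩ := List.mem_map.1 hyL
      obtain ⟨hz, hzL⟩ := List.mem_filter.1 hz
      obtain ⟨L₀, hL₀, hL₀h, hm⟩ := hasg1 z hz
      have hLl : L ∈ large := List.mem_filter.2 ⟨hL, by simpa using h.one_lt_length hc⟩
      -- Large leaves are disjoint, so the recorded head identifies the leaf of smallest median.
      have hLL : L₀ = L := by
        rw [← List.flatMap_id] at hlargend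
        exact eq_of_mem_of_nodup_flatMap hlargend hL₀ hLl (List.mem_of_mem_head? hL₀h)
          (List.mem_of_mem_head? (by simpa using hzL))
      obtain ⟨L', hL', hc'⟩ := hcore (f z.1)
      exact h.isPlaced_of_median_le hc hc' (hLL ▸ hm L' hL')

end KMedian

namespace KMedian

open Finset Timed

/-! ### Dynamic programming -/

section Table

variable {P : Type} {S : List P} {d : P → P → ℝ}

/-- The cost of the best single cluster. -/
noncomputable def oneCost (S : List P) (d : P → P → ℝ) (pts : List P) : ℝ :=
  (oneCluster S d pts).val.1

/-- The cost of a list of clusters with centers. -/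
def clusterCost (d : P → P → ℝ) (cs : List (P × List P)) : ℝ :=
  (cs.map fun a => (a.2.map fun y => d y a.1).sum).sum

/-- A solution for the points `pts` with at most `m` clusters. -/
structure IsSolution (d : P → P → ℝ) (pts : List P) (m : ℕ) (s : Solution P) : Prop where
  cost_eq : s.1 = clusterCost d s.2
  perm : (s.2.map Prod.snd).flatten.Perm pts
  ne_nil : s.2 ≠ []
  length_le : s.2.length ≤ m

theorem oneCluster_spec (hS : S ≠ []) (pts : List P) :
    (∃ x, (oneCluster S d pts).val = ((pts.map fun y => d y x).sum, [(x, pts)])) ∧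
      ∀ x ∈ S, oneCost S d pts ≤ (pts.map fun y => d y x).sum := by
  obtain ⟨x₀, l, rfl⟩ := List.exists_cons_of_ne_nil hS
  simp only [oneCost, oneCluster, val_bind, val_mapT, val_sumT, val_step, List.map_cons]
  set g : P → Solution P := fun x => ((pts.map fun y => d y x).sum, [(x, pts)]) with hg
  have h1 := val_argminT_mem (g x₀) (l.map g)
  have h2 := val_argminT_le (g x₀) (l.map g)
  rw [← List.map_cons] at h1 h2
  refine ⟨?_, fun x hx => h2 (g x) (List.mem_map_of_mem hx)⟩
  obtain ⟨x, -, hx⟩ := List.mem_map.1 h1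
  exact ⟨x, hx.symm⟩

theorem isSolution_oneCluster (hS : S ≠ []) (pts : List P) {m : ℕ} (hm : 1 ≤ m) :
    IsSolution d pts m (oneCluster S d pts).val := by
  obtain ⟨x, hx⟩ := (oneCluster_spec (d := d) hS pts).1
  rw [hx]
  exact ⟨by simp [clusterCost], by simp, by simp, by simpa using hm⟩

theorem val_combineT (L R : List (Solution P)) : (combineT L R).val =
    List.zipWith (fun a b => (a.1 + b.1, a.2 ++ b.2)) L R := by
  induction L generalizing R with
  | nil => simp [combineT]
  | cons a L ih =>
    cases R with
    | nil => simp [combineT]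
    | cons b R => simp [combineT, ih]

/-- The entries of `R` already passed are kept in reverse, so zipping with `L` pairs exactly the
entries whose cluster numbers add up to the required total. -/
theorem splitsT_spec (one : Solution P) {L : List (Solution P)} (hL : L ≠ [])
    (rev R : List (Solution P)) {i : ℕ} (hi : i < R.length) :
    ∃ s, (splitsT one L rev R).val[i]? = some s ∧
      s ∈ (combineT L ((R.take (i + 1)).reverse ++ rev)).val ∧
      ∀ x ∈ (combineT L ((R.take (i + 1)).reverse ++ rev)).val, s.1 ≤ x.1 := by
  induction R generalizing rev i with
  | nil => simp at hi
  | cons b R ih =>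
    cases i with
    | succ i =>
      obtain ⟨s, h1, h2⟩ := ih (b :: rev) (i := i) (by simpa using hi)
      refine ⟨s, ?_, by simpa using h2⟩
      simpa [splitsT] using h1
    | zero =>
      have hne : (combineT L (b :: rev)).val ≠ [] := by
        obtain ⟨a, l, rfl⟩ := List.exists_cons_of_ne_nil hL
        simp [val_combineT]
      obtain ⟨a, l, hal⟩ := List.exists_cons_of_ne_nil hne
      refine ⟨(argminT a l).val, by simp [splitsT, hal], ?_⟩
      simp only [zero_add, List.take_succ_cons, List.take_zero, List.reverse_singleton,
        List.singleton_append, hal]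
      exact ⟨val_argminT_mem _ _, val_argminT_le _ _⟩

theorem length_splitsT (one : Solution P) (L rev R : List (Solution P)) :
    (splitsT one L rev R).val.length = R.length := by
  induction R generalizing rev with
  | nil => simp [splitsT]
  | cons b R ih => simp [splitsT, ih]

theorem combineT_getElem? (L R : List (Solution P)) (j : ℕ) {a b : Solution P}
    (ha : L[j]? = some a) (hb : R[j]? = some b) :
    (a.1 + b.1, a.2 ++ b.2) ∈ (combineT L R).val := by
  rw [val_combineT]
  refine List.mem_of_getElem? (i := j) ?_
  simp [List.getElem?_zipWith, ha, hb]

theorem mem_combineT {L R : List (Solution P)} {s : Solution P} (hs : s ∈ (combineT L R).val) :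
    ∃ (j : ℕ) (a b : Solution P), L[j]? = some a ∧ R[j]? = some b ∧
      s = (a.1 + b.1, a.2 ++ b.2) := by
  rw [val_combineT] at hs
  obtain ⟨j, hj⟩ := List.mem_iff_getElem?.1 hs
  rw [List.getElem?_zipWith] at hj
  cases ha : L[j]? with
  | none => simp [ha] at hj
  | some a =>
    cases hb : R[j]? with
    | none => simp [ha, hb] at hj
    | some b => exact ⟨j, a, b, ha, hb, by simpa [ha, hb, eq_comm] using hj⟩

theorem getElem?_reverse_take {α : Type} {R : List α} {i j : ℕ} (hi : i < R.length) (hj : j ≤ i) :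
    (R.take (i + 1)).reverse[j]? = R[i - j]? := by
  rw [List.getElem?_reverse (by simp; omega), List.getElem?_take, if_pos (by simp)]
  congr 1
  simp
  omega

theorem BinTree.IsPruning.ne_nil {t : BinTree P} {a : List (List P)} (h : t.IsPruning a) :
    a ≠ [] := by
  induction h with
  | root t => simp
  | node _ _ ih _ => simp [ih]

/-- The table of a tree lists optimal prunings. -/
theorem tableT_spec (hS : S ≠ []) {k : ℕ} (t : BinTree P) :
    (tableT S d k t).val.1 = t.points ∧ (tableT S d k t).val.2.length = k ∧
      ∀ m < k, ∃ s, (tableT S d k t).val.2[m]? = some s ∧ IsSolution d t.points (m + 1) s ∧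
        ∀ parts, t.IsPruning parts → parts.length = m + 1 →
          s.1 ≤ (parts.map (oneCost S d)).sum := by
  induction t with
  | leaf pts =>
    refine ⟨rfl, by simp [tableT], fun m hm => ⟨(oneCluster S d pts).val, ?_, ?_, ?_⟩⟩
    · simp [tableT, hm]
    · exact isSolution_oneCluster hS _ (by omega)
    · intro parts hp _
      cases hp
      simp [oneCost, BinTree.points]
  | node l r ihl ihr =>
    obtain ⟨l1, l2, l3⟩ := ihl
    obtain ⟨r1, r2, r3⟩ := ihr
    set L := (tableT S d k l).val.2
    set R := (tableT S d k r).val.2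
    set one := (oneCluster S d (l.points ++ r.points)).val with hone
    have htab : (tableT S d k (.node l r)).val.2 =
        (one :: (splitsT one L [] R).val).take k := by
      simp [tableT, l1, r1, hone, L, R]
    have hpts : (tableT S d k (.node l r)).val.1 = (BinTree.node l r).points := by
      simp [tableT, l1, r1, BinTree.points]
    refine ⟨hpts, ?_, fun m hm => ?_⟩
    · rw [htab]
      simp [length_splitsT, r2]
    · rw [htab]
      cases m with
      | zero =>
        refine ⟨one, by simp [hm], isSolution_oneCluster hS _ (by omega), ?_⟩
        intro parts hp hlen
        cases hp with
        -- A pruning that goes below the root has at least two parts, so only the root gives one.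
        | root => simp [oneCost, BinTree.points, hone]
        | node ha hb =>
          have := List.length_pos_iff.2 ha.ne_nil
          have := List.length_pos_iff.2 hb.ne_nil
          simp only [List.length_append] at hlen
          omega
      | succ i =>
        have hLne : L ≠ [] := by
          rw [← List.length_pos_iff, l2]
          omega
        have hiR : i < R.length := by omega
        obtain ⟨s, s1, s2, s3⟩ := splitsT_spec one hLne [] R hiR
        rw [List.append_nil] at s2 s3
        refine ⟨s, by simpa [List.getElem?_take, hm] using s1, ?_, ?_⟩
        · obtain ⟨j, a, b, ha, hb, rfl⟩ := mem_combineT s2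
          -- Table indices are one less than cluster numbers: `(j + 1) + (i - j + 1) = i + 2`.
          have hj : j ≤ i := by
            have := (List.getElem?_eq_some_iff.1 hb).1
            simp only [List.length_reverse, List.length_take] at this
            omega
          rw [getElem?_reverse_take hiR hj] at hb
          have hjk : j < k := by omega
          obtain ⟨a', ha', sa, -⟩ := l3 j hjk
          obtain ⟨b', hb', sb, -⟩ := r3 (i - j) (by omega)
          obtain rfl : a' = a := by rw [ha] at ha'; exact (Option.some.inj ha').symm
          obtain rfl : b' = b := by rw [hb] at hb'; exact (Option.some.inj hb').symm
          refine ⟨?_, ?_, ?_, ?_⟩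
          · simp [clusterCost, sa.cost_eq, sb.cost_eq]
          · simpa [BinTree.points] using sa.perm.append sb.perm
          · simp [sa.ne_nil]
          · have := sa.length_le
            have := sb.length_le
            simp only [List.length_append]
            omega
        · intro parts hp hlen
          cases hp with
          | root => simp at hlen
          | @node _ _ a b ha hb =>
            have la := List.length_pos_iff.2 ha.ne_nil
            have lb := List.length_pos_iff.2 hb.ne_nil
            simp only [List.length_append] at hlen
            obtain ⟨sa, sa1, -, sa3⟩ := l3 (a.length - 1) (by omega)
            obtain ⟨sb, sb1, -, sb3⟩ := r3 (b.length - 1) (by omega)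
            have hmem := combineT_getElem? L ((R.take (i + 1)).reverse) (a.length - 1) sa1
              (b := sb) (by
                rw [getElem?_reverse_take hiR (by omega), ← sb1]
                congr 1
                omega)
            have h1 := s3 _ hmem
            have h2 := sa3 a ha (by omega)
            have h3 := sb3 b hb (by omega)
            rw [List.map_append, List.sum_append]
            simp only at h1
            linarith

theorem pruningPhase_spec (hS : S ≠ []) {k : ℕ} (hk : 0 < k) {F : Forest P} {t : BinTree P}
    (ht : (binarize F).val = some t) {parts : List (List P)} (hp : t.IsPruning parts)
    (hlen : parts.length = k) :
    ∃ s : Solution P, (pruningPhase S d k F).val = s.2 ∧ IsSolution d t.points k s ∧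
      s.1 ≤ (parts.map (oneCost S d)).sum := by
  obtain ⟨-, h2, h3⟩ := tableT_spec (d := d) hS (k := k) t
  obtain ⟨s, s1, s2, s3⟩ := h3 (k - 1) (by omega)
  refine ⟨s, ?_, ?_, s3 parts hp (by omega)⟩
  · simp only [pruningPhase, val_bind, ht, val_lastT]
    rw [List.getLastD_eq_getLast?, List.getLast?_eq_getElem?, h2, s1]
    rfl
  · rwa [Nat.sub_add_cancel hk] at s2

end Table

/-! ### The cost of the output -/

/-- The item nearest to `c` is, for each `y`, no farther from `c` than `y` is. This is the price of
choosing centers in the sample. -/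
theorem sum_map_dist_le_two_mul {X P : Type*} [PseudoMetricSpace X] {ω : P → X} {l : List P}
    (hl : l ≠ []) (c : X) :
    ∃ x ∈ l, (l.map fun y => dist (ω y) (ω x)).sum ≤
      2 * (l.map fun y => dist (ω y) c).sum := by
  classical
  obtain ⟨x, hx, hmin⟩ := exists_min_image l.toFinset (fun y => dist (ω y) c)
    (List.toFinset_nonempty_iff l |>.2 hl)
  refine ⟨x, List.mem_toFinset.1 hx, ?_⟩
  rw [← List.sum_map_mul_left]
  refine List.sum_le_sum fun y hy => ?_
  have h1 := hmin y (List.mem_toFinset.2 hy)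
  have h2 := dist_triangle (ω y) c (ω x)
  rw [dist_comm c] at h2
  linarith

theorem list_sum_map_eq_sum {P : Type*} [Fintype P] {S : List P}
    (hS : S.Nodup) (hmem : ∀ x, x ∈ S) (ψ : P → ℝ) : (S.map ψ).sum = ∑ x, ψ x := by
  classical
  rw [← List.sum_toFinset ψ hS]
  congr 1
  ext x
  simp [hmem]

variable {X : Type*} {P : Type} [MetricSpace X] {k : ℕ} [Fintype P] [DecidableEq P]
  {ω : P → X} {f : P → Fin k} {p q : Fin k → P} {G : Finset P} {b μ : ℝ} {S : List P}

theorem Separated.sum_bodies_le (h : Separated ω f p q G b μ) (hS : S.Nodup)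
    (hmem : ∀ x, x ∈ S) (hSne : S ≠ []) {c : Fin k → X} {bodies : List (Fin k × List P)}
    (hperm : (bodies.map Prod.snd).flatten.Perm S)
    (hb : ∀ a ∈ bodies, a.2 ≠ [] ∧ ∀ y ∈ a.2, IsPlaced ω f G b μ c a.1 y) :
    ((bodies.map Prod.snd).map (oneCost S (itemDist ω))).sum ≤
      2 * ((1 + 2 * b / (μ - 3 * b)) * ∑ x, dist (ω x) (c (f x))) := by
  set W := ∑ x, dist (ω x) (c (f x)) with hW
  have hW0 : 0 ≤ W := sum_nonneg fun _ _ => dist_nonneg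
  have hK : 0 < μ - 3 * b := by linarith [h.lt, h.one_le]
  -- The surcharge is put on every bad item, misplaced or not, so the total does not depend on the
  -- parts.
  let ψ : P → ℝ := fun y => dist (ω y) (c (f y)) + if y ∈ G then 0 else 2 * W / (μ - 3 * b)
  have hBn : 0 ≤ 2 * W / (μ - 3 * b) := by positivity
  calc ((bodies.map Prod.snd).map (oneCost S (itemDist ω))).sum
      ≤ (bodies.map fun a => 2 * (a.2.map ψ).sum).sum := by
        rw [List.map_map]
        refine List.sum_le_sum fun a ha => ?_
        obtain ⟨hne, hpl⟩ := hb a ha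
        obtain ⟨x, -, hx⟩ := sum_map_dist_le_two_mul (ω := ω) hne (c a.1)
        refine ((oneCluster_spec hSne a.2).2 x (hmem x)).trans (hx.trans ?_)
        refine mul_le_mul_of_nonneg_left (List.sum_le_sum fun y hy => ?_) zero_le_two
        rcases hpl y hy with hy | ⟨hyG, hy⟩
        · simp only [ψ, hy]
          split_ifs <;> linarith
        · simpa only [ψ, hyG, if_false] using hy
    _ = 2 * ((bodies.map Prod.snd).flatten.map ψ).sum := by
        rw [List.sum_map_mul_left, List.map_flatten, List.sum_flatten, List.map_map, List.map_map]
        rfl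
    _ = 2 * ∑ x, ψ x := by
        rw [(hperm.map ψ).sum_eq, list_sum_map_eq_sum hS hmem]
    _ ≤ _ := by
        refine mul_le_mul_of_nonneg_left ?_ zero_le_two
        simp only [ψ]
        rw [sum_add_distrib, ← hW]
        have h1 : ∑ x, (if x ∈ G then 0 else 2 * W / (μ - 3 * b)) =
            #Gᶜ * (2 * W / (μ - 3 * b)) := by
          rw [sum_ite, sum_const_zero, zero_add, sum_const, nsmul_eq_mul]
          congr 3
          ext
          simp
        rw [h1]
        have h2 := mul_le_mul_of_nonneg_right h.card_compl hBn
        have h3 : (1 + 2 * b / (μ - 3 * b)) * W = W + b * (2 * W / (μ - 3 * b)) := by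
          field_simp
        linarith

/-- The algorithm nearly finds the target clustering. -/
theorem Separated.closureAlgorithm {ε : ℝ} (h : Separated ω f p q G (ε * S.length) μ)
    (hS : S.Nodup) (hmem : ∀ x, x ∈ S) (hk : 0 < k) (c : Fin k → X) :
    let r := (KMedian.closureAlgorithm S (itemDist ω) k μ ε).val
    r ≠ [] ∧ r.length ≤ k ∧
      ∑ x, Metric.infDist (ω x) {y | y ∈ (r.map Prod.fst).map ω} ≤
        2 * ((1 + 2 * (ε * S.length) / (μ - 3 * (ε * S.length))) *
          ∑ x, dist (ω x) (c (f x))) := by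
  intro r
  have hr : r = (pruningPhase S (itemDist ω) k (KMedian.cleaningPhase (itemDist ω)
      (KMedian.linkagePhase S (itemDist ω) μ (ε * S.length)).val).val).val := by
    simp [r, KMedian.closureAlgorithm]
  obtain ⟨hT, hTp⟩ := h.linkagePhase hS hmem
  obtain ⟨t, ht, htp, bodies, hpr, hlab, hb⟩ := h.cleaningPhase hS hmem hk hT hTp c
  have hSne : S ≠ [] := List.ne_nil_of_mem (hmem (q ⟨0, hk⟩))
  have hlen : (bodies.map Prod.snd).length = k := by
    have := hlab.length_eq
    simpa using this
  obtain ⟨s, hs1, hs2, hs3⟩ := pruningPhase_spec (d := itemDist ω) hSne hk ht hpr hlen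
  rw [hs1] at hr
  rw [hr]
  refine ⟨hs2.ne_nil, hs2.length_le, ?_⟩
  refine le_trans ?_ (hs3.trans (h.sum_bodies_le hS hmem hSne ?_ hb))
  · rw [hs2.cost_eq, ← list_sum_map_eq_sum hS hmem,
      ← ((hs2.perm.trans htp).map _).sum_eq, clusterCost, List.map_flatten, List.sum_flatten,
      List.map_map, List.map_map]
    refine List.sum_le_sum fun a ha => List.sum_le_sum fun y hy => ?_
    refine Metric.infDist_le_dist_of_mem ?_
    exact List.mem_map.2 ⟨a.1, List.mem_map.2 ⟨a, ha, rfl⟩, rfl⟩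
  · rw [hpr.flatten_eq]
    exact htp

end KMedian

namespace KMedian

open Finset Timed

/-! ### Running time: lists -/

section Lists

variable {α β : Type} {l : List α} {c : ℕ}

theorem sum_map_le_length_mul {g : α → ℕ} (h : ∀ a ∈ l, g a ≤ c) :
    (l.map g).sum ≤ l.length * c := by
  simpa using List.sum_le_card_nsmul (l.map g) c (by simpa using h)

namespace Timed

theorem steps_mapT_le {g : α → Timed β} (h : ∀ a ∈ l, (g a).steps ≤ c) :
    (mapT g l).steps ≤ l.length * (c + 1) + 1 := by
  have := sum_map_le_length_mul h
  rw [steps_mapT]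
  linarith

theorem steps_filterT_le {g : α → Timed Bool} (h : ∀ a ∈ l, (g a).steps ≤ c) :
    (filterT g l).steps ≤ l.length * (c + 1) + 1 := by
  have := sum_map_le_length_mul h
  rw [steps_filterT]
  linarith

theorem steps_countT_le {g : α → Timed Bool} (h : ∀ a ∈ l, (g a).steps ≤ c) :
    (countT g l).steps ≤ l.length * (c + 1) + 1 := by
  have := sum_map_le_length_mul h
  rw [steps_countT]
  linarith

theorem steps_existsT_le {g : α → Timed Bool} (h : ∀ a ∈ l, (g a).steps ≤ c) :
    (existsT g l).steps ≤ l.length * (c + 1) + 1 := by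
  have := sum_map_le_length_mul h
  rw [steps_existsT]
  linarith

theorem steps_sumT_le {g : α → Timed ℝ} (h : ∀ a ∈ l, (g a).steps ≤ c) :
    (sumT g l).steps ≤ l.length * (c + 1) + 1 := by
  have := sum_map_le_length_mul h
  rw [steps_sumT]
  linarith

theorem foldlT_le {g : β → α → Timed β} (I : β → Prop) {b : β} (hb : I b)
    (h : ∀ b, I b → ∀ a ∈ l, I (g b a).val ∧ (g b a).steps ≤ c) :
    I (foldlT g b l).val ∧ (foldlT g b l).steps ≤ l.length * (c + 1) + 1 := by
  induction l generalizing b with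
  | nil => simpa [foldlT] using hb
  | cons a l ih =>
    obtain ⟨h1, h2⟩ := h b hb a List.mem_cons_self
    obtain ⟨h3, h4⟩ := ih h1 fun b hb a ha => h b hb a (List.mem_cons_of_mem _ ha)
    refine ⟨h3, ?_⟩
    simp only [foldlT, steps_bind, steps_step, List.length_cons]
    linarith

theorem steps_ite_le {p : Prop} [Decidable p] {s t : Timed α} (hs : s.steps ≤ c)
    (ht : t.steps ≤ c) : (if p then s else t).steps ≤ c := by
  split <;> assumption

end Timed

end Lists

/-! ### Running time: linkage -/

namespace Forest

variable {P : Type}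

/-- The number of tree nodes. -/
def size : Forest P → ℕ
  | nil => 0
  | leaf _ F => F.size + 1
  | node ch F => ch.size + F.size + 1

theorem length_leaves_le (F : Forest P) : F.leaves.length ≤ F.size := by
  induction F with
  | nil => simp [leaves]
  | leaf pts F ih => simpa [leaves, size] using ih
  | node ch F ih1 ih2 =>
    simp only [leaves, size, List.length_append]
    omega

end Forest

section Linkage

variable {P : Type} {d : P → P → ℝ} {p : P} {r b μ : ℝ} {n : ℕ}

@[simp] theorem steps_inBall (x : P) : (inBall d p r x).steps = 2 := rfl

@[simp] theorem steps_outBall (x : P) : (outBall d p r x).steps = 3 := rfl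

theorem steps_nearlyInside {C : Cluster P} (h : C.pts.length ≤ n) :
    (nearlyInside d p r b C).steps ≤ 7 * n + 5 := by
  have h1 := steps_countT_le (l := C.pts) (g := outBall d p r) fun _ _ => (steps_outBall _).le
  have h2 := steps_countT_le (l := C.pts) (g := inBall d p r) fun _ _ => (steps_inBall _).le
  simp only [nearlyInside, steps_bind, steps_le, steps_lt, steps_step]
  linarith

theorem steps_unionT (l : List (Cluster P)) :
    (unionT l).steps = (l.flatMap Cluster.pts).length + l.length + 1 := by
  induction l with
  | nil => simp [unionT]
  | cons C l ih =>
    simp only [unionT, steps_bind, ih, steps_appendT, List.flatMap_cons, List.length_append,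
      List.length_cons]
    ring

theorem steps_treesT (l : List (Cluster P)) : (treesT l).steps = l.length + 1 := by
  induction l with
  | nil => simp [treesT]
  | cons C l ih =>
    simp only [treesT, steps_bind, ih, List.length_cons]
    split <;> rfl

theorem steps_marginViolations {ball out : List P} (h1 : ball.length ≤ n) (h2 : out.length ≤ n) :
    (marginViolations d ball out).steps ≤ n * (n * (n * 4 + 2) + 2) + 1 := by
  refine (steps_countT_le (c := n * (n * 4 + 2) + 1) fun y _ => ?_).trans ?_
  · refine (steps_existsT_le (c := n * 4 + 1) fun p _ => ?_).trans ?_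
    · refine (steps_existsT_le (c := 3) fun _ _ => le_rfl).trans ?_
      gcongr
    · gcongr
  · gcongr

/-- The number of nodes of the tree of a cluster is bounded in terms of its number of points. -/
structure IsSmall (C : Cluster P) : Prop where
  size_lt : (Forest.consCluster C .nil).size < 2 * C.pts.length
  length_points : (Forest.consCluster C .nil).points.length = C.pts.length

theorem size_consCluster (C : Cluster P) (F : Forest P) : (Forest.consCluster C F).size =
    (Forest.consCluster C .nil).size + F.size := by
  unfold Forest.consCluster
  split <;> simp only [Forest.size] <;> ring

theorem points_consCluster (C : Cluster P) (F : Forest P) : (Forest.consCluster C F).points =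
    (Forest.consCluster C .nil).points ++ F.points := by
  unfold Forest.consCluster
  split <;> simp [Forest.points]

/-- The strict bound for each cluster saves one node per tree; a merge of at least two clusters has
room for its new root and satisfies the strict bound again. -/
theorem size_foldr_consCluster {U : List (Cluster P)} (h : ∀ C ∈ U, IsSmall C) :
    (U.foldr Forest.consCluster .nil).size + U.length ≤ 2 * (U.flatMap Cluster.pts).length ∧
      (U.foldr Forest.consCluster .nil).points.length = (U.flatMap Cluster.pts).length := by
  induction U with
  | nil => simp [Forest.size, Forest.points]
  | cons C U ih =>
    simp only [List.mem_cons, forall_eq_or_imp] at h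
    obtain ⟨h1, h2⟩ := ih h.2
    have h3 := h.1.size_lt
    rw [List.foldr_cons, List.flatMap_cons, size_consCluster, points_consCluster]
    simp only [List.length_append, List.length_cons, h.1.length_points, h2, and_true]
    omega

theorem length_le_length_flatMap {cl : List (Cluster P)} (h : ∀ C ∈ cl, IsSmall C) :
    cl.length ≤ (cl.flatMap Cluster.pts).length := by
  induction cl with
  | nil => simp
  | cons C U ih =>
    simp only [List.mem_cons, forall_eq_or_imp] at h
    have := ih h.2
    have h3 := h.1.size_lt
    simp only [List.flatMap_cons, List.length_append, List.length_cons]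
    omega

theorem isSmall_merged {U : List (Cluster P)} (h : ∀ C ∈ U, IsSmall C) (hU : 1 < U.length) :
    IsSmall ⟨U.flatMap Cluster.pts, U.foldr Forest.consCluster .nil⟩ := by
  obtain ⟨h1, h2⟩ := size_foldr_consCluster h
  have hne : U.foldr Forest.consCluster .nil ≠ .nil :=
    foldr_consCluster_ne_nil (List.ne_nil_of_length_pos (by omega))
  constructor
  · rw [Forest.consCluster_of_ne_nil hne]
    simp only [Forest.size]
    omega
  · rw [Forest.consCluster_of_ne_nil hne]
    simpa [Forest.points] using h2

theorem linkageStep_le {S : List P} (hS : S.length ≤ n) {cl : List (Cluster P)}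
    (hcl : ∀ C ∈ cl, IsSmall C) (hn : (cl.flatMap Cluster.pts).length ≤ n) (pq : ℝ × P × P) :
    ((∀ C ∈ (linkageStep S d μ b cl pq).val, IsSmall C) ∧
      ((linkageStep S d μ b cl pq).val.flatMap Cluster.pts).length ≤ n) ∧
      (linkageStep S d μ b cl pq).steps ≤ 60 * (n + 1) ^ 3 := by
  obtain ⟨r, p, q⟩ := pq
  have hlen : cl.length ≤ n := (length_le_length_flatMap hcl).trans hn
  set pr : Cluster P → Bool := fun C => (nearlyInside d p r b C).val with hpr
  have hUmem : ∀ C ∈ cl.filter pr, IsSmall C := fun C hC => hcl C (List.mem_filter.1 hC).1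
  have hsplit : ((cl.filter pr).flatMap Cluster.pts).length +
      ((cl.filter fun C => !pr C).flatMap Cluster.pts).length =
      (cl.flatMap Cluster.pts).length := by
    rw [← List.length_append, ← List.flatMap_append]
    exact ((List.filter_append_perm pr cl).flatMap_right Cluster.pts).length_eq
  constructor
  · rw [val_linkageStep]
    dsimp only
    split_ifs with hif
    · refine ⟨?_, ?_⟩
      · simp only [List.mem_cons, forall_eq_or_imp]
        exact ⟨isSmall_merged hUmem hif.2.2.2, fun C hC => hcl C (List.mem_filter.1 hC).1⟩
      · rw [List.flatMap_cons, List.length_append]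
        exact (hsplit.le.trans hn)
    · exact ⟨hcl, hn⟩
  · have hpts : ∀ C ∈ cl, C.pts.length ≤ n := fun C hC => by
      refine le_trans ?_ hn
      rw [List.length_flatMap]
      exact List.single_le_sum (by simp) _ (List.mem_map_of_mem hC)
    have hU : (cl.filter pr).length ≤ n := (List.length_filter_le _ _).trans hlen
    have hUp : ((cl.filter pr).flatMap Cluster.pts).length ≤ n := by omega
    have s1 : (filterT (inBall d p r) S).steps ≤ n * 3 + 1 :=
      (steps_filterT_le fun _ _ => (steps_inBall _).le).trans (by gcongr)
    have s2 : (filterT (outBall d p r) S).steps ≤ n * 4 + 1 :=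
      (steps_filterT_le fun _ _ => (steps_outBall _).le).trans (by gcongr)
    have s3 : (filterT (nearlyInside d p r b) cl).steps ≤ n * (7 * n + 5 + 1) + 1 :=
      (steps_filterT_le fun C hC => steps_nearlyInside (hpts C hC)).trans (by gcongr)
    have s4 : (filterT (fun C => do
        let t ← nearlyInside d p r b C
        step (!t)) cl).steps ≤ n * (7 * n + 6 + 1) + 1 :=
      (steps_filterT_le (c := 7 * n + 6) fun C hC => by
        have := steps_nearlyInside (d := d) (p := p) (r := r) (b := b) (hpts C hC)
        simp only [steps_bind, steps_step]
        linarith).trans (by gcongr)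
    have s5 : (countT (outBall d p r) ((cl.filter pr).flatMap Cluster.pts)).steps ≤ n * 4 + 1 :=
      (steps_countT_le fun _ _ => (steps_outBall _).le).trans (by gcongr)
    have s6 := steps_marginViolations (d := d) (n := n)
      (ball := S.filter fun x => (inBall d p r x).val)
      (out := S.filter fun x => (outBall d p r x).val)
      ((List.length_filter_le _ _).trans hS) ((List.length_filter_le _ _).trans hS)
    simp only [linkageStep, steps_bind, val_bind, val_filterT, val_unionT, steps_unionT,
      val_lengthT, steps_lengthT, steps_step, steps_le, val_step]
    set x := (marginViolations d (S.filter fun x => (inBall d p r x).val)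
      (S.filter fun x => (outBall d p r x).val)).steps
    -- `t` is the final branch. The cubic term comes from the margin test alone; all other tests are
    -- at most quadratic.
    have key : ∀ t : Timed (List (Cluster P)), t.steps ≤ n + 2 →
        (filterT (inBall d p r) S).steps + ((filterT (outBall d p r) S).steps +
        ((filterT (nearlyInside d p r b) cl).steps + ((filterT (fun C => do
        let t ← nearlyInside d p r b C
        step (!t)) cl).steps + (((cl.filter pr).flatMap Cluster.pts).length +
          (cl.filter pr).length + 1 + (((cl.filter pr).flatMap Cluster.pts).length + 1 +
          ((countT (outBall d p r) ((cl.filter pr).flatMap Cluster.pts)).steps + (x +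
          ((cl.filter pr).length + 1 + (1 + (1 + (1 + (1 + (1 + t.steps))))))))))))) ≤
        60 * (n + 1) ^ 3 := by
      intro t ht
      have e1 : 60 * (n + 1) ^ 3 = 60 * n ^ 3 + 180 * n ^ 2 + 180 * n + 60 := by ring
      have e2 : n * (n * (n * 4 + 2) + 2) + 1 = 4 * n ^ 3 + 2 * n ^ 2 + 2 * n + 1 := by ring
      have e3 : n * (7 * n + 5 + 1) + 1 = 7 * n ^ 2 + 6 * n + 1 := by ring
      have e4 : n * (7 * n + 6 + 1) + 1 = 7 * n ^ 2 + 7 * n + 1 := by ring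
      rw [e1]
      rw [e2] at s6
      rw [e3] at s3
      rw [e4] at s4
      omega
    refine key _ (steps_ite_le ?_ ?_)
    · simp only [steps_bind, steps_treesT, steps_step]
      exact Nat.add_le_add_right hU 2
    · simp only [steps_step]
      omega

/-- Insertion sort of `n ^ 2` pairs is of order `n ^ 4`; processing them at cubic cost each gives
the fifth power. The distances are arbitrary here. -/
theorem linkagePhase_le {S : List P} (hS : S.length ≤ n) :
    (linkagePhase S d μ b).val.size ≤ 2 * n ∧ (linkagePhase S d μ b).val.points.length ≤ n ∧
      (linkagePhase S d μ b).steps ≤ 100 * (n + 1) ^ 5 := by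
  set keyed := (S ×ˢ S).map fun pq => (d pq.1 pq.2, pq) with hkeyed
  have hklen : keyed.length ≤ n ^ 2 := by
    rw [hkeyed, List.length_map, List.length_product, sq]
    gcongr
  obtain ⟨⟨h1, h2⟩, h3⟩ := foldlT_le (g := linkageStep S d μ b) (l := (sortT keyed).val)
    (c := 60 * (n + 1) ^ 3) (b := S.map fun p => Cluster.mk [p] .nil)
    (fun cl => (∀ C ∈ cl, IsSmall C) ∧ (cl.flatMap Cluster.pts).length ≤ n)
    (by
      constructor
      · intro C hC
        obtain ⟨x, -, rfl⟩ := List.mem_map.1 hC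
        constructor <;> simp [Forest.consCluster, Forest.size, Forest.points]
      · simpa [List.flatMap_map] using hS)
    (fun cl hcl pq _ => linkageStep_le hS hcl.1 hcl.2 pq)
  have hval : (linkagePhase S d μ b).val = (foldlT (linkageStep S d μ b)
      (S.map fun p => Cluster.mk [p] .nil) (sortT keyed).val).val.foldr
        Forest.consCluster .nil := by
    simp only [linkagePhase, val_bind, val_treesT, val_mapT, val_pairsT, val_step, hkeyed]
  obtain ⟨h4, h5⟩ := size_foldr_consCluster h1
  rw [hval]
  refine ⟨by omega, by omega, ?_⟩
  have s1 : S.length * (3 * S.length + 2) + 1 ≤ n * (3 * n + 2) + 1 := by gcongr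
  have s2 : (mapT (fun pq => step (d pq.1 pq.2, pq)) (S ×ˢ S)).steps ≤ n ^ 2 * (1 + 1) + 1 :=
    (steps_mapT_le (c := 1) fun _ _ => le_rfl).trans (by
      rw [List.length_product, sq]
      gcongr)
  have s3 : (sortT keyed).steps ≤ (2 * n ^ 2 + 1) * n ^ 2 + 1 :=
    (steps_sortT keyed).trans (by gcongr)
  have s4 : (mapT (fun p => step (Cluster.mk [p] .nil)) S).steps ≤ n * (1 + 1) + 1 :=
    (steps_mapT_le (c := 1) fun _ _ => le_rfl).trans (by gcongr)
  have s5 := h3.trans (show _ ≤ n ^ 2 * (60 * (n + 1) ^ 3 + 1) + 1 by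
    rw [(val_sortT keyed).length_eq]
    gcongr)
  have s6 := (length_le_length_flatMap h1).trans h2
  simp only [linkagePhase, steps_bind, val_mapT, val_pairsT, val_step, steps_pairsT, steps_treesT]
  rw [← hkeyed]
  have e0 : 100 * (n + 1) ^ 5 =
    100 * n ^ 5 + 500 * n ^ 4 + 1000 * n ^ 3 + 1000 * n ^ 2 + 500 * n + 100 := by ring
  have e1 : n ^ 2 * (60 * (n + 1) ^ 3 + 1) + 1 =
    60 * n ^ 5 + 180 * n ^ 4 + 180 * n ^ 3 + 61 * n ^ 2 + 1 := by ring
  have e2 : (2 * n ^ 2 + 1) * n ^ 2 + 1 = 2 * n ^ 4 + n ^ 2 + 1 := by ring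
  have e3 : n * (3 * n + 2) + 1 = 3 * n ^ 2 + 2 * n + 1 := by ring
  rw [e0]
  rw [e1] at s5
  rw [e2] at s3
  rw [e3] at s1
  omega

end Linkage

end KMedian

namespace KMedian

open Finset Timed

/-! ### Running time: cleaning -/

section Cleaning

variable {P : Type} {d : P → P → ℝ} {K : ℕ}

theorem steps_onlyLeaves (F : Forest P) :
    (onlyLeaves F).steps ≤ F.points.length + 2 * F.size + 1 := by
  induction F with
  | nil => simp [onlyLeaves]
  | leaf pts F ih =>
    simp only [onlyLeaves, steps_bind, Forest.points, Forest.size, List.length_append]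
    split
    · simp only [steps_step]
      omega
    · simp only [steps_bind, steps_appendT, steps_step]
      omega
  | node ch F => simp [onlyLeaves]

/-- `K` bounds the leaf test at any node, and the test is charged to every node. -/
theorem steps_collapse {F : Forest P} (h : F.points.length + 2 * F.size + 1 ≤ K) :
    (collapse F).steps ≤ F.size * (K + 2) + 1 := by
  induction F with
  | nil => simp [collapse]
  | leaf pts F ih =>
    simp only [Forest.points, Forest.size, List.length_append] at h
    have := ih (by omega)
    simp only [collapse, steps_bind, steps_step, Forest.size]
    linarith
  | node ch F ih1 ih2 =>
    simp only [Forest.points, Forest.size, List.length_append] at h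
    have h1 := ih1 (by omega)
    have h2 := ih2 (by omega)
    have h3 := (steps_onlyLeaves ch).trans (show _ ≤ K by omega)
    simp only [collapse, steps_bind, Forest.size]
    split
    · simp only [steps_step]
      linarith [Nat.zero_le (ch.size * (K + 2))]
    · simp only [steps_bind, steps_step]
      linarith

theorem size_collapse (F : Forest P) : (collapse F).val.size ≤ F.size := by
  induction F with
  | nil => simp [collapse]
  | leaf pts F ih => simpa [Forest.size] using ih
  | node ch F ih1 ih2 =>
    cases h : (onlyLeaves ch).val with
    | none =>
      rw [val_collapse_node_none h]
      simp only [Forest.size]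
      omega
    | some l =>
      rw [val_collapse_node_some h]
      simp only [Forest.size]
      omega

theorem steps_leavesT {F : Forest P} (h : F.size ≤ K) :
    (leavesT F).steps ≤ F.size * (K + 2) + 1 := by
  induction F with
  | nil => simp [leavesT]
  | leaf pts F ih =>
    simp only [Forest.size] at h
    have := ih (by omega)
    simp only [leavesT, steps_bind, steps_step, Forest.size]
    linarith
  | node ch F ih1 ih2 =>
    simp only [Forest.size] at h
    have h1 := ih1 (by omega)
    have h2 := ih2 (by omega)
    have h3 := ch.length_leaves_le
    simp only [leavesT, steps_bind, steps_appendT, val_leavesT, Forest.size]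
    linarith

theorem steps_medianDist (p : P) {L : List P} (hL : L.length ≤ K) :
    (medianDist d p L).steps ≤ 2 * K ^ 2 + 5 * K + 6 := by
  have h1 : (mapT (fun q => step (d p q, ())) L).steps ≤ K * (1 + 1) + 1 :=
    (steps_mapT_le (c := 1) fun _ _ => le_rfl).trans (by gcongr)
  have h2 : (sortT (L.map fun q => (d p q, ()))).steps ≤ (2 * K + 1) * K + 1 :=
    (steps_sortT _).trans (by rw [List.length_map]; gcongr)
  have h3 := steps_getT (0, ()) (sortT (L.map fun q => (d p q, ()))).val (L.length / 2)
  have h4 := (val_sortT (L.map fun q => (d p q, ()))).length_eq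
  rw [List.length_map] at h4
  simp only [medianDist, steps_bind, val_mapT, val_step, steps_lengthT, val_lengthT, steps_step]
  rw [h4] at h3 ⊢
  linarith

theorem steps_assignT {leaves : List (List P)} (hl : leaves.length ≤ 2 * K)
    (hL : ∀ L ∈ leaves, L.length ≤ K) (p : P) :
    (assignT d leaves p).steps ≤ 4 * K ^ 3 + 10 * K ^ 2 + 20 * K + 4 := by
  have h1 : (mapT (fun L => do
      let m ← medianDist d p L
      step (m, L)) leaves).steps ≤ 2 * K * (2 * K ^ 2 + 5 * K + 7 + 1) + 1 :=
    (steps_mapT_le (c := 2 * K ^ 2 + 5 * K + 7) fun L h => by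
      have := steps_medianDist (d := d) p (hL L h)
      simp only [steps_bind, steps_step]
      linarith).trans (by gcongr)
  have h2 : 2 * K * (2 * K ^ 2 + 5 * K + 7 + 1) + 1 = 4 * K ^ 3 + 10 * K ^ 2 + 16 * K + 1 := by
    ring
  rw [h2] at h1
  simp only [assignT, steps_bind]
  split
  · simp only [steps_step]
    linarith
  · rename_i a l hal
    have h3 := congrArg List.length hal
    rw [val_mapT, List.length_map, List.length_cons] at h3
    simp only [steps_bind, steps_argminT]
    split <;> simp only [steps_step] <;> omega

variable [DecidableEq P]

theorem steps_reassign {asg : List (P × P)} {m : ℕ} (ha : asg.length ≤ m) {F : Forest P}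
    (h : F.points.length ≤ K) :
    (reassign asg F).steps ≤ F.size * (4 * m + K + 4) + 1 := by
  induction F with
  | nil => simp [reassign]
  | leaf pts F ih =>
    simp only [Forest.points, List.length_append] at h
    have h1 := ih (by omega)
    match pts with
    | [] =>
      simp only [reassign, steps_bind, steps_step, Forest.size]
      linarith
    | [_] =>
      simp only [reassign, steps_bind, steps_step, Forest.size]
      linarith
    | y :: x :: l =>
      have h2 : (filterT (fun a => step (decide (a.2 = y))) asg).steps ≤ m * (1 + 1) + 1 :=
        (steps_filterT_le (c := 1) fun _ _ => le_rfl).trans (by gcongr)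
      have h3 : (mapT (fun a => step a.1) (asg.filter fun a => decide (a.2 = y))).steps ≤
          m * (1 + 1) + 1 :=
        (steps_mapT_le (c := 1) fun _ _ => le_rfl).trans (by
          have := (List.length_filter_le (fun a => decide (a.2 = y)) asg).trans ha
          gcongr)
      simp only [reassign, steps_bind, steps_step, Forest.size, val_filterT, val_step, val_mapT,
        steps_appendT]
      linarith
  | node ch F ih1 ih2 =>
    simp only [Forest.points, List.length_append] at h
    have h1 := ih1 (by omega)
    have h2 := ih2 (by omega)
    simp only [reassign, steps_bind, steps_step, Forest.size]
    linarith

theorem size_reassign (asg : List (P × P)) (F : Forest P) :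
    (reassign asg F).val.size ≤ F.size := by
  induction F with
  | nil => simp [reassign]
  | leaf pts F ih =>
    by_cases h : 1 < pts.length
    · rw [val_reassign_leaf_large asg F h]
      simpa [Forest.size] using ih
    · rw [val_reassign_leaf_small asg F h]
      simp only [Forest.size]
      omega
  | node ch F ih1 ih2 =>
    simp only [val_reassign_node, Forest.size]
    omega

/-- All assignments are counted at every leaf. This crude bound needs no disjointness, and the
quadratic point count it gives is affordable in the dynamic program. -/
theorem length_points_reassign (asg : List (P × P)) (F : Forest P) :
    (reassign asg F).val.points.length ≤ F.points.length + F.size * asg.length := by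
  induction F with
  | nil => simp [reassign, Forest.points]
  | leaf pts F ih =>
    by_cases h : 1 < pts.length
    · rw [val_reassign_leaf_large asg F h]
      have := List.length_filter_le (fun a => decide (pts.head? = some a.2)) asg
      simp only [Forest.size, Forest.points, List.length_append, extendLeaf, List.length_map]
      linarith
    · rw [val_reassign_leaf_small asg F h]
      simp only [Forest.size, Forest.points, List.length_append]
      linarith
  | node ch F ih1 ih2 =>
    simp only [val_reassign_node, Forest.size, Forest.points, List.length_append]
    linarith

theorem cleaningPhase_le {T : Forest P} {n : ℕ} (h1 : T.size ≤ 2 * n)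
    (h2 : T.points.length ≤ n) :
    (cleaningPhase d T).val.size ≤ 2 * n ∧
      (cleaningPhase d T).val.points.length ≤ 2 * n ^ 2 + n ∧
      (cleaningPhase d T).steps ≤ 200 * (n + 1) ^ 4 := by
  set T' := (collapse T).val with hT'
  have c1 : T'.size ≤ 2 * n := (size_collapse T).trans h1
  have c2 : T'.points.length ≤ n := by rwa [hT', points_collapse]
  set large := T'.leaves.filter fun L => decide (1 < L.length) with hlarge
  set small := T'.leaves.filter fun L => decide (L.length = 1) with hsmall
  set singles := small.foldl (fun acc L => L ++ acc) [] with hsingles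
  have c3 : T'.leaves.length ≤ 2 * n := T'.length_leaves_le.trans c1
  have c4 : ∀ L ∈ T'.leaves, L.length ≤ n := fun L hL => by
    refine le_trans ?_ c2
    rw [← Forest.flatten_leaves]
    exact (List.sublist_flatten_of_mem hL).length_le
  have c5 : small.length ≤ 2 * n := (List.length_filter_le _ _).trans c3
  have c6 : singles.length ≤ n := by
    rw [hsingles, (foldl_append_perm small []).length_eq, List.nil_append]
    refine le_trans ?_ c2
    rw [← Forest.flatten_leaves]
    exact (List.Sublist.flatten List.filter_sublist).length_le
  have c7 : (assignment d T').length ≤ n := by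
    rw [assignment, List.length_map]
    exact c6
  have hval := val_cleaningPhase d T
  refine ⟨?_, ?_, ?_⟩
  · rw [hval]
    exact (size_reassign _ _).trans c1
  · rw [hval]
    refine (length_points_reassign _ _).trans ?_
    rw [add_comm]
    refine Nat.add_le_add ((Nat.mul_le_mul c1 c7).trans (by linarith [sq n])) c2
  · have s1 := steps_collapse (F := T) (K := 5 * n + 1) (by omega)
    have s1' : T.size * (5 * n + 1 + 2) + 1 ≤ 2 * n * (5 * n + 1 + 2) + 1 := by gcongr
    have s2 := steps_leavesT c1
    have s2' : T'.size * (2 * n + 2) + 1 ≤ 2 * n * (2 * n + 2) + 1 := by gcongr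
    have hlen : ∀ (g : ℕ → Bool), (filterT (fun L : List P => do
        let m ← lengthT L
        step (g m)) T'.leaves).steps ≤ 2 * n * (n + 2 + 1) + 1 := fun g =>
      (steps_filterT_le (c := n + 2) fun L hL => by
        have := c4 L hL
        simp only [steps_bind, steps_lengthT, steps_step]
        omega).trans (by gcongr)
    have s3 := hlen fun m => decide (1 < m)
    have s4 := hlen fun m => decide (m = 1)
    have s5 : (foldlT (fun acc L => appendT L acc) [] small).steps ≤ 2 * n * (n + 1 + 1) + 1 :=
      (foldlT_le (fun _ => True) trivial fun acc _ L hL => ⟨trivial, by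
        rw [steps_appendT]
        exact Nat.add_le_add_right (c4 L (List.mem_filter.1 hL).1) 1⟩).2.trans (by gcongr)
    have s6 : (mapT (assignT d large) singles).steps ≤
        n * (4 * n ^ 3 + 10 * n ^ 2 + 20 * n + 4 + 1) + 1 :=
      (steps_mapT_le fun p _ => steps_assignT ((List.length_filter_le _ _).trans c3)
        (fun L hL => c4 L (List.mem_filter.1 hL).1) p).trans (by gcongr)
    have s7 := steps_reassign c7 c2
    have s7' : T'.size * (4 * n + n + 4) + 1 ≤ 2 * n * (4 * n + n + 4) + 1 := by gcongr
    have e : (cleaningPhase d T).steps = (collapse T).steps + ((leavesT T').steps +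
        ((filterT (fun L : List P => do
          let m ← lengthT L
          step (decide (1 < m))) T'.leaves).steps + ((filterT (fun L : List P => do
          let m ← lengthT L
          step (decide (m = 1))) T'.leaves).steps +
        ((foldlT (fun acc L => appendT L acc) [] small).steps +
        ((mapT (assignT d large) singles).steps +
        (reassign (assignment d T') T').steps))))) := by
      simp [cleaningPhase, assignment, val_leavesT, hT', hsmall, hlarge, hsingles]
    rw [e]
    have e0 : 200 * (n + 1) ^ 4 =
      200 * n ^ 4 + 800 * n ^ 3 + 1200 * n ^ 2 + 800 * n + 200 := by ring
    rw [e0]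
    linarith [Nat.zero_le (n ^ 4), Nat.zero_le (n ^ 3), Nat.zero_le (n ^ 2)]

end Cleaning

/-! ### Running time: dynamic programming -/

section Pruning

/-- The number of tree nodes. -/
def BinTree.size {P : Type} : BinTree P → ℕ
  | leaf _ => 1
  | node l r => l.size + r.size + 1

variable {P : Type} {d : P → P → ℝ} {S : List P} {n k K : ℕ}

theorem size_binarize {F : Forest P} {t : BinTree P} (h : (binarize F).val = some t) :
    t.size < 2 * F.size := by
  induction F generalizing t with
  | nil => simp [binarize] at h
  | leaf pts F ih =>
    simp only [binarize, val_bind] at h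
    cases hF : (binarize F).val with
    | none =>
      simp only [hF, val_step, Option.some.injEq] at h
      simp only [← h, BinTree.size, Forest.size]
      omega
    | some t' =>
      simp only [hF, val_step, Option.some.injEq] at h
      have := ih hF
      simp only [← h, BinTree.size, Forest.size]
      omega
  | node ch F ih1 ih2 =>
    simp only [binarize, val_bind] at h
    cases hc : (binarize ch).val with
    | none =>
      simp only [hc, val_step] at h
      have := ih2 h
      simp only [Forest.size]
      omega
    | some t₁ =>
      cases hF : (binarize F).val with
      | none =>
        simp only [hc, hF, val_step, Option.some.injEq] at h
        have := ih1 hc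
        simp only [← h, Forest.size]
        omega
      | some t₂ =>
        simp only [hc, hF, val_step, Option.some.injEq] at h
        have := ih1 hc
        have := ih2 hF
        simp only [← h, BinTree.size, Forest.size]
        omega

theorem steps_binarize (F : Forest P) : (binarize F).steps ≤ 2 * F.size + 1 := by
  induction F with
  | nil => simp [binarize]
  | leaf pts F ih =>
    simp only [binarize, steps_bind, Forest.size]
    split <;> simp only [steps_step] <;> omega
  | node ch F ih1 ih2 =>
    simp only [binarize, steps_bind, Forest.size]
    split <;> simp only [steps_step] <;> omega

theorem steps_oneCluster (hS : S.length ≤ n) {pts : List P} (hp : pts.length ≤ K) :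
    (oneCluster S d pts).steps ≤ n * (2 * K + 5) + 2 := by
  have h1 : (mapT (fun x => do
      let s ← sumT (fun y => step (d y x)) pts
      step ((s, [(x, pts)]) : Solution P)) S).steps ≤ n * (K * (1 + 1) + 1 + 1 + 1) + 1 :=
    (steps_mapT_le (c := K * (1 + 1) + 1 + 1) fun x _ => by
      simp only [steps_bind, steps_step]
      exact Nat.add_le_add_right ((steps_sumT_le (c := 1) fun _ _ => le_rfl).trans (by gcongr))
        1).trans (by gcongr)
  simp only [oneCluster, steps_bind]
  split
  · simp only [steps_step]
    linarith
  · rename_i a l hal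
    have h3 := congrArg List.length hal
    rw [val_mapT, List.length_map, List.length_cons] at h3
    rw [steps_argminT]
    linarith

theorem steps_combineT {L : List (Solution P)} (hL : ∀ s ∈ L, s.2.length ≤ k)
    (R : List (Solution P)) : (combineT L R).steps ≤ L.length * (k + 2) + 1 := by
  induction L generalizing R with
  | nil => simp [combineT]
  | cons a L ih =>
    cases R with
    | nil =>
      simp only [combineT, steps_step]
      omega
    | cons b R =>
      have h1 := ih (fun s hs => hL s (List.mem_cons_of_mem _ hs)) R
      have h2 := hL a List.mem_cons_self
      simp only [combineT, steps_bind, steps_appendT, steps_step, List.length_cons]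
      linarith

theorem steps_splitsT (one : Solution P) {L : List (Solution P)}
    (hL : ∀ s ∈ L, s.2.length ≤ k) (rev R : List (Solution P)) :
    (splitsT one L rev R).steps ≤ R.length * (L.length * (k + 4) + 3) + 1 := by
  induction R generalizing rev with
  | nil => simp [splitsT]
  | cons b R ih =>
    have h1 := steps_combineT hL (b :: rev)
    have h2 := ih (b :: rev)
    have h3 : (combineT L (b :: rev)).val.length ≤ L.length := by
      rw [val_combineT, List.length_zipWith]
      exact Nat.min_le_left _ _
    simp only [splitsT, steps_bind, List.length_cons, steps_step]
    split
    · simp only [steps_step]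
      linarith
    · rename_i a l hal
      rw [hal, List.length_cons] at h3
      rw [steps_argminT]
      linarith

/-- `S ≠ []` makes every table entry a genuine solution with at most `k` clusters, which bounds the
cost of appending them. -/
theorem steps_tableT (hS : S ≠ []) (hn : S.length ≤ n) {t : BinTree P}
    (ht : t.points.length ≤ K) :
    (tableT S d k t).steps ≤ t.size * (n * (2 * K + 5) + K + k * (k * (k + 4) + 4) + 7) := by
  induction t with
  | leaf pts =>
    have h1 := steps_oneCluster (d := d) hn ht
    simp only [tableT, steps_bind, steps_replicateT, steps_step, BinTree.size]
    rw [BinTree.points] at h1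
    linarith [Nat.zero_le (k * (k * (k + 4))), Nat.zero_le K]
  | node l r ihl ihr =>
    simp only [BinTree.points, List.length_append] at ht
    have h1 := ihl (by omega)
    have h2 := ihr (by omega)
    obtain ⟨l1, l2, l3⟩ := tableT_spec (d := d) hS (k := k) l
    obtain ⟨r1, r2, r3⟩ := tableT_spec (d := d) hS (k := k) r
    have h3 := steps_oneCluster (d := d) (K := K) (pts := l.points ++ r.points) hn
      (by rw [List.length_append]; omega)
    have h4 := steps_splitsT (oneCluster S d (l.points ++ r.points)).val (k := k) (L := (tableT S d k l).val.2) (fun s hs => by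
      obtain ⟨j, hj⟩ := List.mem_iff_getElem?.1 hs
      have hjk : j < k := by
        have := (List.getElem?_eq_some_iff.1 hj).1
        omega
      obtain ⟨s', hs', h, -⟩ := l3 j hjk
      rw [hs', Option.some.injEq] at hj
      rw [← hj]
      exact h.length_le.trans hjk) [] (tableT S d k r).val.2
    rw [l2, r2] at h4
    have h5 := steps_takeT k ((oneCluster S d (l.points ++ r.points)).val ::
      (splitsT (oneCluster S d (l.points ++ r.points)).val (tableT S d k l).val.2 []
      (tableT S d k r).val.2).val)
    simp only [tableT, steps_bind, steps_appendT, steps_step, BinTree.size, val_appendT, l1, r1]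
    linarith

theorem pruningPhase_le (hS : S ≠ []) (hn : S.length ≤ n) {F : Forest P} (h1 : F.size ≤ 2 * n)
    (h2 : F.points.length ≤ 2 * n ^ 2 + n) :
    (pruningPhase S d k F).steps ≤ 200 * (n + k + 1) ^ 5 := by
  have h3 := steps_binarize F
  set m := n + k + 1 with hm
  have hn' : n ≤ m := by omega
  have hk' : k ≤ m := by omega
  have hm1 : 1 ≤ m := by omega
  have p1 : m ≤ m ^ 5 := Nat.le_self_pow (by norm_num) m
  have p2 : m ^ 2 ≤ m ^ 5 := Nat.pow_le_pow_right hm1 (by norm_num)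
  have p3 : m ^ 3 ≤ m ^ 5 := Nat.pow_le_pow_right hm1 (by norm_num)
  have p4 : m ^ 4 ≤ m ^ 5 := Nat.pow_le_pow_right hm1 (by norm_num)
  simp only [pruningPhase, steps_bind]
  cases hb : (binarize F).val with
  | none =>
    simp only [steps_step]
    linarith
  | some t =>
    have h4 := size_binarize hb
    have h5 : t.points.length ≤ 2 * n ^ 2 + n := by
      rw [(binarize_spec F).1 t hb]
      exact h2
    have h6 := steps_tableT (d := d) (k := k) hS hn h5
    have h7 : t.size * (n * (2 * (2 * n ^ 2 + n) + 5) + (2 * n ^ 2 + n) +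
        k * (k * (k + 4) + 4) + 7) ≤ 4 * m * (m * (2 * (2 * m ^ 2 + m) + 5) + (2 * m ^ 2 + m) +
        m * (m * (m + 4) + 4) + 7) := by
      gcongr
      omega
    have h8 := (tableT_spec (d := d) hS (k := k) t).2.1
    simp only [steps_bind, steps_lastT, steps_step, h8]
    linarith

end Pruning

/-! ### Running time: the algorithm -/

theorem length_pruningPhase_le {P : Type} {d : P → P → ℝ} {S : List P} (hS : S ≠ []) (k : ℕ)
    (F : Forest P) : (pruningPhase S d k F).val.length ≤ k := by
  simp only [pruningPhase, val_bind]
  cases hb : (binarize F).val with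
  | none => simp
  | some t =>
    obtain ⟨-, h2, h3⟩ := tableT_spec (d := d) hS (k := k) t
    simp only [val_bind, val_lastT, val_step]
    rw [List.getLastD_eq_getLast?, List.getLast?_eq_getElem?, h2]
    rcases Nat.eq_zero_or_pos k with rfl | hk
    · rw [List.getElem?_eq_none (by omega)]
      simp
    · obtain ⟨s, hs, h, -⟩ := h3 (k - 1) (by omega)
      rw [hs]
      exact h.length_le.trans (by omega)

theorem steps_sampleAlgorithm {n : ℕ} (hn : 0 < n) (d : Fin n → Fin n → ℝ) (k : ℕ) (μ ε : ℝ) :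
    (sampleAlgorithm d k μ ε).steps ≤ 600 * (n + k + 1) ^ 5 := by
  set S := List.finRange n with hS
  have hlen : S.length = n := List.length_finRange
  have hne : S ≠ [] := List.ne_nil_of_length_pos (by omega)
  obtain ⟨l1, l2, l3⟩ := linkagePhase_le (d := d) (b := ε * n) (μ := μ) hlen.le
  set T := (linkagePhase S d μ (ε * n)).val
  obtain ⟨c1, c2, c3⟩ := cleaningPhase_le (d := d) l1 l2
  set T' := (cleaningPhase d T).val
  have p1 := pruningPhase_le (d := d) (k := k) hne hlen.le c1 c2
  have p2 := length_pruningPhase_le (d := d) hne k T'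
  have e : (sampleAlgorithm d k μ ε).steps = 2 * n + 1 + (n + 1 + (1 +
      ((linkagePhase S d μ (ε * n)).steps + ((cleaningPhase d T).steps +
        (pruningPhase S d k T').steps))) + (2 * (pruningPhase S d k T').val.length + 1)) := by
    simp [sampleAlgorithm, closureAlgorithm, steps_mapT, T', T, hS]
    ring
  set m := n + k + 1 with hm
  have hm1 : 1 ≤ m := by omega
  have q1 : m ≤ m ^ 5 := Nat.le_self_pow (by norm_num) m
  have q2 : m ^ 4 ≤ m ^ 5 := Nat.pow_le_pow_right hm1 (by norm_num)
  have q3 : 100 * (n + 1) ^ 5 ≤ 100 * m ^ 5 := by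
    gcongr
    omega
  have q4 : 200 * (n + 1) ^ 4 ≤ 200 * m ^ 4 := by
    gcongr
    omega
  omega

end KMedian

namespace KMedian

open Finset Timed

/-! ### The sample -/

/-- If some points of `C` are not central, take one nearest to `c`: all points strictly nearer are
central, and they are more than a hundredth of `C`. -/
theorem card_le_mul_card_central {X : Type*} [PseudoMetricSpace X] (C : Finset X) (c : X) :
    #C ≤ 100 * #{x ∈ C | 100 * #{y ∈ C | dist y c < dist x c} ≤ #C} := by
  classical
  set T := {x ∈ C | 100 * #{y ∈ C | dist y c < dist x c} ≤ #C}
  rcases (C \ T).eq_empty_or_nonempty with h | h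
  · have := card_le_card (sdiff_eq_empty_iff_subset.1 h)
    omega
  · obtain ⟨x, hx, hmin⟩ := exists_min_image _ (fun y => dist y c) h
    rw [mem_sdiff] at hx
    have h1 : #C < 100 * #{y ∈ C | dist y c < dist x c} := by
      by_contra! h1
      exact hx.2 (mem_filter.2 ⟨hx.1, h1⟩)
    have h2 : #{y ∈ C | dist y c < dist x c} ≤ #T := card_le_card fun y hy => by
      by_contra hyT
      obtain ⟨hyC, hlt⟩ := mem_filter.1 hy
      exact (hmin y (mem_sdiff.2 ⟨hyC, hyT⟩)).not_gt hlt
    omega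

section Sample

/-- Clusters have more than `b` items, so each contains good ones, and `q i` can be the farthest of
them. -/
theorem exists_separated {X : Type*} [MetricSpace X] {k : ℕ} {P : Type*} [Fintype P] [DecidableEq P] {ω : P → X} {f : P → Fin k}
    {p : Fin k → P} {b μ : ℝ}
    (hB : (#{s | ∃ j, j ≠ f s ∧ dist (ω s) (ω (p j)) ≤ 8 * dist (ω s) (ω (p (f s)))} : ℝ) ≤ b)
    (hμ : ∀ i, μ ≤ #{s | f s = i}) (hb : 1 ≤ b) (hbμ : 5 * b < μ) :
    ∃ q G, Separated ω f p q G b μ := by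
  classical
  set Z : Finset P :=
    {s | ∃ j, j ≠ f s ∧ dist (ω s) (ω (p j)) ≤ 8 * dist (ω s) (ω (p (f s)))} with hZ
  have hne : ∀ i, ({s ∈ Zᶜ | f s = i} : Finset P).Nonempty := fun i => by
    rw [nonempty_iff_ne_empty]
    intro h
    have hsub : ({s | f s = i} : Finset P) ⊆ Z := fun s hs => by
      by_contra hsZ
      have : s ∈ ({s ∈ Zᶜ | f s = i} : Finset P) :=
        mem_filter.2 ⟨mem_compl.2 hsZ, (mem_filter.1 hs).2⟩
      simp [h] at this
    have h1 : (#{s | f s = i} : ℝ) ≤ #Z := by exact_mod_cast card_le_card hsub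
    linarith [hμ i]
  choose q hq hmax using fun i =>
    exists_max_image _ (fun s => dist (ω (p i)) (ω s)) (hne i)
  refine ⟨q, Zᶜ, ?_, by rwa [compl_compl], hμ, hb, hbμ, fun i => (mem_filter.1 (hq i)).1,
    fun i => (mem_filter.1 (hq i)).2, fun x hx => hmax _ x (mem_filter.2 ⟨hx, rfl⟩)⟩
  intro x hx j hj
  by_contra! hle
  exact mem_compl.1 hx (mem_filter.2 ⟨mem_univ _, j, hj, hle⟩)

/-- Short outputs are padded by repeating the first center, so concentration for `k`-tuples covers
them. -/
theorem exists_range_eq {X : Type*} {k : ℕ} {l : List X} (hne : l ≠ []) (hl : l.length ≤ k) :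
    ∃ e : Fin k → X, Set.range e = {y | y ∈ l} := by
  obtain ⟨a, l', rfl⟩ := List.exists_cons_of_ne_nil hne
  refine ⟨fun i => (a :: l').getD i a, Set.ext fun y => ⟨?_, fun hy => ?_⟩⟩
  · rintro ⟨i, rfl⟩
    by_cases h : (i : ℕ) < (a :: l').length
    · simp only [List.getD_eq_getElem _ _ h]
      exact List.getElem_mem h
    · simp only [List.getD_eq_default _ _ (not_lt.1 h)]
      exact List.mem_cons_self
  · obtain ⟨j, hj, rfl⟩ := List.mem_iff_getElem.1 hy
    exact ⟨⟨j, hj.trans_le hl⟩, List.getD_eq_getElem _ _ hj⟩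

theorem minFraction_mul_card_le {X : Type*} [Fintype X] {k : ℕ} [Nonempty X] (f : X → Fin k) (i : Fin k) :
    minFraction f * Fintype.card X ≤ #{x | f x = i} := by
  rw [minFraction, div_mul_cancel₀ _ (by exact_mod_cast Fintype.card_ne_zero),
    ← clusterSize_eq_card]
  exact ciInf_le (Set.finite_range _).bddBelow i

theorem minFraction_le_one {X : Type*} [Fintype X] {k : ℕ} [Nonempty X] (f : X → Fin k) :
    minFraction f ≤ 1 := by
  have h0 : 0 < (Fintype.card X : ℝ) := by exact_mod_cast Fintype.card_pos
  have h1 := minFraction_mul_card_le f (f (Classical.arbitrary X))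
  have h2 : (#{x | f x = f (Classical.arbitrary X)} : ℝ) ≤ Fintype.card X := by
    exact_mod_cast card_le_univ _
  by_contra! h
  nlinarith

/-- The left side decreases in `μ`, with equality at `μ = ρ / 2 * n`. -/
theorem one_add_div_le {ε ρ n μ : ℝ} (hε : 0 < ε) (hn : 0 < n) (hρ : 20 * ε < ρ)
    (hμ : ρ / 2 * n ≤ μ) :
    1 + 2 * (2 * ε * n) / (μ - 3 * (2 * ε * n)) ≤ 1 + 8 * ε / (ρ - 12 * ε) := by
  have h1 : 0 < ρ - 12 * ε := by linarith
  have h2 : 0 < ρ / 2 * n - 3 * (2 * ε * n) := by nlinarith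
  have e1 : 8 * ε / (ρ - 12 * ε) = 2 * (2 * ε * n) / (ρ / 2 * n - 3 * (2 * ε * n)) := by
    rw [div_eq_div_iff h1.ne' h2.ne']
    ring
  rw [e1]
  gcongr

/-- After scaling by `N / n`, `V - lam * O ≤ 2 * F * (1 + lam) * O`; optimality `O ≤ V` turns the
additive error into the factor `1 - lam`. -/
theorem le_of_average_le {V O N n lam R W F F' : ℝ} (hN : 0 < N) (hn : 0 < n) (hlam0 : 0 ≤ lam)
    (hlam1 : lam < 1) (hF : 0 ≤ F) (hW : 0 ≤ W) (hOV : O ≤ V) (hF' : F' ≤ F)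
    (h1 : n * (V / N - lam * (O / N)) ≤ R) (h2 : R ≤ 2 * (F' * W))
    (h3 : W ≤ n * (O / N + lam * (O / N))) :
    V ≤ 2 * ((1 + lam) / (1 - lam)) * F * O := by
  have h4 : n * (V / N - lam * (O / N)) ≤ 2 * (F * (n * (O / N + lam * (O / N)))) := by
    refine h1.trans (h2.trans ?_)
    gcongr
  have h5 : V - lam * O ≤ 2 * (F * (O + lam * O)) := by
    have h6 := mul_le_mul_of_nonneg_left h4 (div_pos hN hn).le
    have e1 : N / n * (n * (V / N - lam * (O / N))) = V - lam * O := by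
      field_simp
    have e2 : N / n * (2 * (F * (n * (O / N + lam * (O / N))))) = 2 * (F * (O + lam * O)) := by
      field_simp
    rwa [e1, e2] at h6
  have e3 : 2 * ((1 + lam) / (1 - lam)) * F * O = 2 * (F * (O + lam * O)) / (1 - lam) := by
    ring
  rw [e3, le_div_iff₀ (by linarith)]
  linarith [mul_le_mul_of_nonneg_left hOV hlam0]

variable {X : Type*} [MetricSpace X] [Fintype X] {k : ℕ}

theorem IsOptimal.cost_le_sum_infDist {f : X → Fin k} {c : Fin k → X} (h : IsOptimal dist f c)
    (e : Fin k → X) : cost dist f c ≤ ∑ x, Metric.infDist x (Set.range e) := by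
  have hex : ∀ x, ∃ i, Metric.infDist x (Set.range e) = dist x (e i) := fun x => by
    obtain ⟨-, ⟨i, rfl⟩, hi⟩ := (Set.finite_range e).isCompact.exists_infDist_eq_dist
      ⟨_, Set.mem_range_self (f x)⟩ x
    exact ⟨i, hi⟩
  choose g hg using hex
  exact (h g e).trans (sum_congr rfl fun x _ => (hg x).symm).le

theorem avgCost_le_diam [Nonempty X] (f : X → Fin k) (c : Fin k → X) :
    avgCost f c ≤ Metric.diam (Set.univ : Set X) := by
  rw [avgCost, div_le_iff₀ (by exact_mod_cast Fintype.card_pos), mul_comm, ← nsmul_eq_mul,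
    ← card_univ]
  exact sum_le_card_nsmul _ _ _ fun x _ =>
    Metric.dist_le_diam_of_mem (Set.toFinite _).isBounded trivial trivial

/-- The deterministic part of the analysis: a representative sample leads to good centers. -/
theorem implicitCost_sampleAlgorithm_le {f : X → Fin k} {c : Fin k → X} {n : ℕ} {ω : Fin n → X}
    {p : Fin k → Fin n} {ε lam μ ρ : ℝ} (hopt : IsOptimal dist f c) (hk : 0 < k)
    (hn : 1 ≤ 2 * ε * n) (hρ : 20 * ε < ρ) (hμρ : ρ / 2 * n ≤ μ)
    (hμ : ∀ i, μ ≤ #{s | f (ω s) = i}) (hlam0 : 0 ≤ lam) (hlam : lam < 1)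
    (hB : (#{s | ∃ j, j ≠ f (ω s) ∧
      dist (ω s) (ω (p j)) ≤ 8 * dist (ω s) (ω (p (f (ω s))))} : ℝ) ≤ 2 * ε * n)
    (hφ : ∀ e : Fin k → X, n * ((∑ x, Metric.infDist x (Set.range e)) / Fintype.card X -
      lam * avgCost f c) ≤ ∑ s, Metric.infDist (ω s) (Set.range e))
    (hψ : ∑ s, dist (ω s) (c (f (ω s))) ≤ n * (avgCost f c + lam * avgCost f c)) :
    let centers := (sampleAlgorithm (fun s t => dist (ω s) (ω t)) k μ (2 * ε)).val.map ω
    centers ≠ [] ∧ centers.length ≤ k ∧ implicitCost centers ≤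
      2 * ((1 + lam) / (1 - lam)) * (1 + 8 * ε / (ρ - 12 * ε)) * cost dist f c := by
  intro centers
  have hN0 : 0 < (Fintype.card X : ℝ) := by exact_mod_cast Fintype.card_pos_iff.2 ⟨c ⟨0, hk⟩⟩
  have hn0 : 0 < (n : ℝ) := by
    rcases (Nat.cast_nonneg n : (0 : ℝ) ≤ n).eq_or_lt with h | h
    · rw [← h] at hn
      norm_num at hn
    · exact h
  have hε : 0 < ε := by
    by_contra! h
    nlinarith
  obtain ⟨q, G, hsep⟩ := exists_separated hB hμ hn (by nlinarith)
  have hlen : ((List.finRange n).length : ℝ) = n := by rw [List.length_finRange]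
  rw [← hlen] at hsep
  obtain ⟨h1, h2, h3⟩ := hsep.closureAlgorithm (List.nodup_finRange n) List.mem_finRange hk c
  have hcen : centers = ((KMedian.closureAlgorithm (List.finRange n) (itemDist ω) k μ
      (2 * ε)).val.map Prod.fst).map ω := by
    simp [centers, sampleAlgorithm]
  rw [← hcen, hlen] at h3
  have hne : centers ≠ [] := by simpa [hcen] using h1
  have hlek : centers.length ≤ k := by simpa [hcen] using h2
  refine ⟨hne, hlek, ?_⟩
  obtain ⟨e, he⟩ := exists_range_eq hne hlek
  have h4 := hφ e
  have h5 := hopt.cost_le_sum_infDist e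
  rw [he] at h4 h5
  rw [implicitCost]
  have hF0 : 0 ≤ 8 * ε / (ρ - 12 * ε) := div_nonneg (by linarith) (by linarith)
  exact le_of_average_le hN0 hn0 hlam0 hlam (by linarith) (sum_nonneg fun _ _ => dist_nonneg) h5
    (one_add_div_le hε hn0 hρ hμρ) h4 h3 hψ

end Sample

/-! ### The sample size -/

section Scale

variable {X : Type*} [MetricSpace X] [Fintype X] [Nonempty X] {k : ℕ} {f : X → Fin k}
  {c : Fin k → X} {ε lam δ : ℝ}

/-- The two products equal `k * L` times `(D / (lam * ζ)) ^ 2` and `(1 / ε) ^ 2`, both factors at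
least one since `ζ ≤ D`. With `N / δ ≥ 2` one has `L ≥ log 2 > 1 / 2`, so `Q` dominates `k` and 1 up
to a factor 2. -/
theorem sampleScale_bounds (hk : k < Fintype.card X) (hε0 : 0 < ε) (hε1 : ε ≤ 1)
    (hlam0 : 0 < lam) (hlam1 : lam ≤ 1) (hδ0 : 0 < δ) (hδ1 : δ ≤ 1) :
    let L := Real.log (Fintype.card X / δ)
    k * L ≤ sampleScale f c lam ε δ * ε ^ 2 ∧
      k * L ≤ sampleScale f c lam ε δ *
        (lam * avgCost f c / Metric.diam (Set.univ : Set X)) ^ 2 ∧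
      1 ≤ 2 * L ∧ (k : ℝ) ≤ 2 * sampleScale f c lam ε δ ∧ 1 ≤ 2 * sampleScale f c lam ε δ := by
  intro L
  have hk1 : (1 : ℝ) ≤ k := by
    exact_mod_cast Fin.pos (f (Classical.arbitrary X))
  have hN : (2 : ℝ) ≤ Fintype.card X := by
    have : 1 ≤ k := by exact_mod_cast hk1
    exact_mod_cast (by omega : 2 ≤ Fintype.card X)
  have hL : 1 ≤ 2 * L := by
    have h1 : Real.log 2 ≤ L := by
      refine Real.log_le_log two_pos ?_
      rw [le_div_iff₀ hδ0]
      nlinarith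
    linarith [Real.log_two_gt_d9]
  have hζ : 0 < avgCost f c := div_pos (cost_dist_pos hk f c) (by linarith)
  have hζD := avgCost_le_diam f c
  set ζ := avgCost f c
  set D := Metric.diam (Set.univ : Set X)
  have hD : 0 < D := hζ.trans_le hζD
  set Q := sampleScale f c lam ε δ
  have hQ : Q = k * D ^ 2 / (lam ^ 2 * ε ^ 2 * ζ ^ 2) * L := rfl
  have hkL : 0 ≤ k * L := mul_nonneg (by linarith) (by linarith)
  have e1 : Q * ε ^ 2 = k * L * (D / (lam * ζ)) ^ 2 := by
    rw [hQ]
    field_simp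
  have e2 : Q * (lam * ζ / D) ^ 2 = k * L * (1 / ε) ^ 2 := by
    rw [hQ]
    field_simp
  have hR : 1 ≤ D / (lam * ζ) := by
    rw [one_le_div (by positivity)]
    nlinarith
  have h1 : k * L ≤ Q * ε ^ 2 := by
    rw [e1]
    exact le_mul_of_one_le_right hkL (one_le_pow₀ hR)
  have h2 : k * L ≤ Q * (lam * ζ / D) ^ 2 := by
    rw [e2]
    exact le_mul_of_one_le_right hkL (one_le_pow₀ ((one_le_div hε0).2 hε1))
  have h3 : k * L ≤ Q := by
    have hQ0 : 0 ≤ Q := by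
      by_contra! h
      nlinarith [mul_neg_of_neg_of_pos h (sq_pos_of_pos hε0)]
    exact h1.trans (mul_le_of_le_one_right hQ0 (pow_le_one₀ hε0.le hε1))
  have h4 : (k : ℝ) ≤ 2 * Q := by nlinarith
  exact ⟨h1, h2, hL, h4, hk1.trans h4⟩

/-- A large sample leads to good centers with high probability. -/
theorem one_sub_le_sampleLaw [MeasurableSpace X] [DiscreteMeasurableSpace X] {α : ℝ}
    (hk : k < Fintype.card X) (hopt : IsOptimal dist f c) (hPR : PerturbationResilient α ε f)
    (hα : 8 ≤ α) (hε : 0 < ε) (hερ : 20 * ε < minFraction f) (hlam0 : 0 < lam) (hlam1 : lam < 1)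
    (hδ0 : 0 < δ) (hδ1 : δ < 1) {n : ℕ} (hn : 200 * sampleScale f c lam ε δ ≤ n) :
    1 - δ ≤ (sampleLaw X n).real
      {ω | (∀ i, minFraction f / 2 * n ≤ clusterSize (f ∘ ω) i) ∧
        ∀ μ : ℝ, minFraction f / 2 * n ≤ μ → (∀ i, μ ≤ clusterSize (f ∘ ω) i) →
          let centers := (sampleAlgorithm (fun s t => dist (ω s) (ω t)) k μ (2 * ε)).val.map ω
          centers ≠ [] ∧ centers.length ≤ k ∧ implicitCost centers ≤
            2 * ((1 + lam) / (1 - lam)) * (1 + 8 * ε / (minFraction f - 12 * ε)) *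
              cost dist f c} := by
  classical
  have hk0 : 0 < k := Fin.pos (f (Classical.arbitrary X))
  have hN0 : 0 < (Fintype.card X : ℝ) := by exact_mod_cast Fintype.card_pos
  have hρ1 := minFraction_le_one f
  have hC := minFraction_mul_card_le f
  set ρ := minFraction f
  obtain ⟨q1, q2, q3, q4, q5⟩ := sampleScale_bounds (f := f) (c := c) hk hε (by linarith) hlam0
    hlam1.le hδ0 hδ1.le
  set Q := sampleScale f c lam ε δ
  have hn0 : 0 < (n : ℝ) := by linarith
  set N : ℝ := (Fintype.card X : ℝ) with hN
  have hD : 0 < Metric.diam (Set.univ : Set X) :=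
    (div_pos (cost_dist_pos hk f c) hN0).trans_le (avgCost_le_diam f c)
  have hdist : ∀ x y : X, dist x y ≤ Metric.diam (Set.univ : Set X) := fun x y =>
    Metric.dist_le_diam_of_mem (Set.toFinite _).isBounded trivial trivial
  have hn1 : 4 * k * Real.log (N / δ) ≤ n * ε ^ 2 / 50 := by
    have := mul_le_mul_of_nonneg_right hn (sq_nonneg ε)
    linarith
  have hn2 : 4 * k * Real.log (N / δ) ≤
      2 * n * (lam * avgCost f c / Metric.diam (Set.univ : Set X)) ^ 2 := by
    have := mul_le_mul_of_nonneg_right hn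
      (sq_nonneg (lam * avgCost f c / Metric.diam (Set.univ : Set X)))
    have h0 : 0 ≤ k * Real.log (N / δ) := mul_nonneg (Nat.cast_nonneg k) (by linarith)
    linarith
  have hεn : 1 ≤ 2 * ε * n := by
    have h1 : (1 : ℝ) ≤ k := by exact_mod_cast hk0
    have h2 : 1 ≤ 2 * (k * Real.log (N / δ)) := by nlinarith
    have h3 : n * ε ^ 2 ≤ n * ε := by
      have : ε ^ 2 ≤ ε := by nlinarith
      gcongr
    linarith
  -- For `ε * N < 1` the sample must contain the center itself; otherwise the innermost hundredth of
  -- a cluster of more than `20 * ε * N` points is large enough. Either way `T i` has frequency at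
  -- least `ε / 5`, and a deviation `ε / 10` still leaves a hit.
  let T : Fin k → Finset X := fun i => if ε * N < 1 then {c i} else
    {x ∈ ({x | f x = i} : Finset X) |
      100 * #{y ∈ ({x | f x = i} : Finset X) | dist y (c i) < dist x (c i)} ≤
        #{x | f x = i}}
  have hT : ∀ i, ε * N / 5 ≤ #(T i) := fun i => by
    by_cases h : ε * N < 1
    · simp only [T, h, if_true, card_singleton, Nat.cast_one]
      linarith
    · simp only [T, h, if_false]
      have h1 := card_le_mul_card_central ({x | f x = i} : Finset X) (c i)
      have h2 : (#{x | f x = i} : ℝ) ≤ 100 * #{x ∈ ({x | f x = i} : Finset X) |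
        100 * #{y ∈ ({x | f x = i} : Finset X) | dist y (c i) < dist x (c i)} ≤
        #{x | f x = i}} := by exact_mod_cast h1
      nlinarith [hC i]
  refine (one_sub_le_measureReal (C := fun i => {x | f x = i}) (T := T)
    (B := fun e => {x | ∃ j, j ≠ f x ∧ dist x (e j) ≤ 8 * dist x (e (f x))})
    (φ := fun e x => Metric.infDist x (Set.range e)) (ψ := fun x => dist x (c (f x)))
    hk0 hk hε hlam0 (div_pos (cost_dist_pos hk f c) hN0) hD hδ0 hδ1
    (fun _ _ => Metric.infDist_nonneg)
    (fun e x => (Metric.infDist_le_dist_of_mem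
      (Set.mem_range_self (⟨0, hk0⟩ : Fin k))).trans (hdist _ _))
    (fun _ => dist_nonneg) (fun _ => hdist _ _) hn1 hn2).trans
    (measureReal_mono ?_ (measure_ne_top _ _))
  rintro ω ⟨h1, h2, h3, h4, h5⟩
  have hsize : ∀ i, ρ / 2 * n ≤ clusterSize (f ∘ ω) i := fun i => by
    rw [clusterSize_eq_card]
    have h6 := h1 i
    simp only [mem_filter, mem_univ, true_and] at h6
    refine le_trans ?_ h6.le
    have h7 : ρ ≤ #{x | f x = i} / N := (le_div_iff₀ hN0).2 (hC i)
    rw [mul_comm]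
    gcongr
    linarith
  refine ⟨hsize, fun μ hμ1 hμ2 => ?_⟩
  have hex : ∀ i, ∃ s, ω s ∈ T i := fun i => by
    have h6 := h2 i
    have h7 : ε / 5 ≤ #(T i) / N := by
      rw [le_div_iff₀ hN0]
      linarith [hT i]
    have h8 : 0 < n * ((#(T i) : ℝ) / N - ε / 10) := mul_pos hn0 (by linarith)
    have h9 : 0 < #{s | ω s ∈ T i} := by exact_mod_cast h8.trans h6
    obtain ⟨s, hs⟩ := card_pos.1 h9
    exact ⟨s, (mem_filter.1 hs).2⟩
  choose p hp using hex
  have hbad := card_bad_le (c' := fun i => ω (p i)) hk hopt hPR hα hε.le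
    (fun i => by nlinarith [hC i]) (by
      by_cases h : ε * N < 1
      · refine Or.inl ⟨h, funext fun i => ?_⟩
        simpa [T, h] using hp i
      · refine Or.inr ⟨not_lt.1 h, fun i => ?_⟩
        have h6 := hp i
        simp only [T, h, if_false, mem_filter, filter_filter] at h6
        exact h6.2.2)
  refine implicitCost_sampleAlgorithm_le (p := p) hopt hk0 hεn hερ hμ1
    (fun i => by simpa [clusterSize_eq_card] using hμ2 i) hlam0.le hlam1 ?_ (fun e => (h4 e).le) h5.le
  -- The tuple is chosen after the sample, so the uniform bound is used: frequency at most `ε` in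
  -- `X`, plus deviation `ε`, gives `2 * ε`.
  have h6 := h3 fun i => ω (p i)
  simp only [mem_filter, mem_univ, true_and] at h6
  refine h6.le.trans ?_
  have h7 := (div_le_iff₀ hN0).2 hbad
  rw [mul_comm]
  gcongr
  linarith

end Scale

end KMedian

theorem mainTheorem5 :
    ∃ a : ℝ, 0 < a ∧ ∀ A : ℝ, ∃ M : ℝ,
      ∀ (X : Type*) [Fintype X] [Nonempty X] [MetricSpace X] [MeasurableSpace X]
        [DiscreteMeasurableSpace X]
        (k : ℕ) (f : X → Fin k) (c : Fin k → X) (α ε lam δ : ℝ),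
        k < Fintype.card X →
        IsOptimal dist f c →
        PerturbationResilient α ε f →
        8 < α → 0 < ε → ε < minFraction f / 20 →
        0 < lam → lam < 1 → 0 < δ → δ < 1 →
        ∀ n : ℕ, a * sampleScale f c lam ε δ ≤ n → n ≤ A * sampleScale f c lam ε δ →
          1 - δ ≤ (sampleLaw X n).real
            {ω | (∀ i, minFraction f / 2 * n ≤ clusterSize (f ∘ ω) i) ∧
              ∀ μ : ℝ, minFraction f / 2 * n ≤ μ → (∀ i, μ ≤ clusterSize (f ∘ ω) i) →
                let centers :=
                  (sampleAlgorithm (fun s t => dist (ω s) (ω t)) k μ (2 * ε)).val.map ω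
                centers ≠ [] ∧ centers.length ≤ k ∧
                  implicitCost centers ≤
                    2 * ((1 + lam) / (1 - lam)) *
                      (1 + 8 * ε / (minFraction f - 12 * ε)) * cost dist f c} ∧
          ∀ (ω : Fin n → X) (μ : ℝ),
            ((sampleAlgorithm (fun s t => dist (ω s) (ω t)) k μ (2 * ε)).steps : ℝ) ≤
              M * sampleScale f c lam ε δ ^ 5 := by
  -- `a = 200` turns `Q * ε ^ 2 ≥ k * L` into the requirement `n * ε ^ 2 / 50 ≥ 4 * k * L`. For `M`,
  -- `n ≤ |A| * Q`, `k ≤ 2 * Q` and `1 ≤ 2 * Q` add up to `(|A| + 4) * Q`.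
  refine ⟨200, by norm_num, fun A => ⟨600 * (|A| + 4) ^ 5, ?_⟩⟩
  intro X _ _ _ _ _ k f c α ε lam δ hk hopt hPR hα hε hερ hlam0 hlam1 hδ0 hδ1 n hn hnA
  have hρ1 := minFraction_le_one f
  refine ⟨one_sub_le_sampleLaw hk hopt hPR hα.le hε (by linarith) hlam0 hlam1 hδ0 hδ1 hn,
    fun ω μ => ?_⟩
  obtain ⟨-, -, -, q4, q5⟩ := sampleScale_bounds (f := f) (c := c) hk hε (by linarith) hlam0
    hlam1.le hδ0 hδ1.le
  set Q := sampleScale f c lam ε δ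
  have hn0 : 0 < (n : ℝ) := by linarith
  have h1 := steps_sampleAlgorithm (Nat.cast_pos.1 hn0) (fun s t => dist (ω s) (ω t)) k μ (2 * ε)
  have h2 : ((sampleAlgorithm (fun s t => dist (ω s) (ω t)) k μ (2 * ε)).steps : ℝ) ≤
      600 * (n + k + 1) ^ 5 := by exact_mod_cast h1
  have h3 : (n + k + 1 : ℝ) ≤ (|A| + 4) * Q := by
    have := mul_le_mul_of_nonneg_right (le_abs_self A) (by linarith : 0 ≤ Q)
    linarith
  calc _ ≤ 600 * (n + k + 1 : ℝ) ^ 5 := h2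
    _ ≤ 600 * ((|A| + 4) * Q) ^ 5 := by gcongr
    _ = _ := by ring
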